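/- Let $k$ be a real quadratic field with ring of integers $\mathcal O$, let $\bar{\mathbb Q}$ be the algebraic closure of $\mathbb Q$ in $\mathbb C$, and let $\iota_1\neq\iota_2$ be the two embeddings $k\to\bar{\mathbb Q}$. Let $I$ be a (non-zero) fractional ideal of $k$ and $\xi:I\to\bar{\mathbb Q}^\times$ a character of the additive group of $I$ whose values are roots of unity. Let $\mathfrak f=\{a\in\mathcal O:\xi(ax)=1\ \forall x\in I\}$ be its annihilator and let $f\ge 1$ be given by $\mathfrak f\cap\mathbb Z=f\mathbb Z$. Let $p$ be a prime number that is prime to $\mathfrak f$, splits in $k$ (as a product of two distinct prime ideals) and satisfies $f\mid p-1$; assume that $I$ is prime to $p$, i.e. $\mathrm{ord}_{\mathfrak p}(I)=0$ for each $\mathfrak p\mid p$. Let $j:\bar{\mathbb Q}\to\mathbb C_p$ be an embedding and $|\cdot|_p$ the absolute value of $\mathbb C_p$ with $|p|_p=p^{-1}$. Let $\tau_1,\tau_2\in I$ be totally positive, linearly independent over $\mathbb Q$, with $\xi(\tau_1)\neq1$ and $\xi(\tau_2)\neq 1$. Put $P=\{\lambda\tau_1+\mu\tau_2:\lambda,\mu\in\mathbb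 Q,\ 0<\lambda\le1,\ 0\le\mu<1\}$ and $C=\{\lambda\tau_1+\mu\tau_2:\lambda,\mu\in\mathbb Q,\ \lambda>0,\ \mu\ge0\}$. Let $z_{T_p}(s)$ be the meromorphic continuation to $\mathbb C$, analytic at all integers $m\le 0$, of the series $$\sum_{a\in I\cap C,\ p\nmid |I:(a)|}\frac{\xi(a)}{(\iota_1(a)\iota_2(a))^{s}},$$ absolutely convergent for $\mathrm{Re}(s)>1$. Let $w_p$ be the number of roots of unity in $\mathbb Q_p$, $\mathcal M(p)=\{m\in\mathbb Z: m\le0,\ m\equiv1\ (\mathrm{mod}\ w_p)\}$ and $D(p)=1+2\mathbb Z_p$, and let $z^{(j)}_{T_p,p}:D(p)\to\mathbb C_p$ be the unique continuous function such that, for all $m\in\mathcal M(p)$, $z_{T_p}(m)\in\bar{\mathbb Q}$ and $z^{(j)}_{T_p,p}(m)=j(z_{T_p}(m))$. (That this function exists and is unique is part of the assertion.) Define $$F(X_1,X_2)=\frac{\sum_{a\in I\cap P}\xi(a)(1+X_1)^{\iota_1(a)}(1+X_2)^{\iota_2(a)}}{\prod_{r=1}^{2}\bigl(1-\xi(\tau_r)(1+X_1)^{\iota_1(\tau_r)}(1+X_2)^{\iota_2(\tau_r)}\bigr)}\in\bar{\mathbb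 Q}[[X_1,X_2]]$$ with formal binomial series, let $F^j\in\mathbb C_p[[X_1,X_2]]$ be obtained by applying $j$ to the coefficients, and let $a_{i,l}\in\mathbb C_p$ be defined by $$(1+X_1)^{-1}(1+X_2)^{-1}F^j(X_1,X_2)=\sum_{i,l\ge0}a_{i,l}X_1^iX_2^l.$$ Put $c_n=\sum_{\zeta^p=1}(\zeta-1)^n$ for $n\ge1$ (sum over all $p$th roots of unity), and $$f_p(x)=\frac{x+2}{p-1}-\frac{2}{\log p}\log\Bigl(\frac x2+1\Bigr)-2\qquad(x>-2).$$ Proposition. Let $N\ge0$ be an integer, let $M$ be a real number with $M\ge\frac{2(p-1)}{\log p}-2$ and $f_p(M)>N$, and for each pair of integers $i,l\ge0$ with $i+l<M$ let $\tilde a_{i,l}\in\mathbb Z_p$ satisfy $|\tilde a_{i,l}-a_{i,l}|_p<p^{-N}$. Then $$\left|z^{(j)}_{T_p,p}(1)-\frac1{p^2}\sum_{\substack{i,l\ge0\\ i+l<M}}\frac{c_{i+1}c_{l+1}\tilde a_{i,l}}{(i+1)(l+1)}\right|_p<p^{-N}.$$ -/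

import Mathlib

open scoped nonZeroDivisors

noncomputable section

namespace TwistedZeta

/-- The field of algebraic numbers, i.e. the algebraic closure of `ℚ` in `ℂ`. -/
abbrev Qbar : Type := ↥(algebraicClosure ℚ ℂ)

section Complex

variable {k : Type*} [Field k] [NumberField k]

/-- Membership in `k_+^×` (for totally real `k`): positivity at every real place. -/
def TotallyPositive (a : k) : Prop := ∀ φ : k →+* ℝ, 0 < φ a

/-- A fractional ideal as an `𝓞`-submodule of `k`. -/
abbrev toModule (I : (FractionalIdeal (NumberField.RingOfIntegers k)⁰ k)ˣ) :
    Submodule (NumberField.RingOfIntegers k) k :=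
  ((I : FractionalIdeal (NumberField.RingOfIntegers k)⁰ k) :
    Submodule (NumberField.RingOfIntegers k) k)

/-- The annihilator `{a ∈ 𝓞 : ξ (a x) = 1 for all x ∈ I}` of an additive character `ξ` of a
fractional ideal `I`. -/
def annihilator (I : (FractionalIdeal (NumberField.RingOfIntegers k)⁰ k)ˣ)
    (ξ : AddChar ↥(toModule I) Qbar) :
    Ideal (NumberField.RingOfIntegers k) where
  carrier := {a | ∀ x : ↥(toModule I), ξ (a • x) = 1}
  zero_mem' := fun x => by simp
  add_mem' := fun {a b} ha hb x => by
    rw [add_smul, AddChar.map_add_eq_mul, ha x, hb x, one_mul]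
  smul_mem' := fun c a ha x => by
    rw [smul_eq_mul, mul_comm, mul_smul]
    exact ha (c • x)

/-- The index `|I : (a)|`, for `a ∈ I`. -/
def idealIndex (I : (FractionalIdeal (NumberField.RingOfIntegers k)⁰ k)ˣ) (a : k) : ℕ :=
  (Submodule.span (NumberField.RingOfIntegers k) {a}).toAddSubgroup.relIndex
    (toModule I).toAddSubgroup

/-- The half-open parallelogram `P(τ₁, τ₂)`. -/
def parallelogram (τ₁ τ₂ : k) : Set k :=
  {a | ∃ r s : ℚ, 0 < r ∧ r ≤ 1 ∧ 0 ≤ s ∧ s < 1 ∧ a = r • τ₁ + s • τ₂}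

/-- The half-open cone `C(τ₁, τ₂)`. -/
def cone (τ₁ τ₂ : k) : Set k :=
  {a | ∃ r s : ℚ, 0 < r ∧ 0 ≤ s ∧ a = r • τ₁ + s • τ₂}

/-- `Z` is the meromorphic continuation of
`z_{T_p}(s; ξ, I, τ₁, τ₂) = ∑ ξ(a) / (ι₁(a) ι₂(a))^s`, the sum over all `a ∈ I ∩ C(τ₁, τ₂)`
with `p ∤ |I : (a)|`, which converges absolutely for `Re s > 1`. Analyticity at the integers
`m ≤ 0` is required so that `Z m` is the actual value there. -/
structure IsContinuation (p : ℕ) (ι₁ ι₂ : k →+* Qbar)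
    (I : (FractionalIdeal (NumberField.RingOfIntegers k)⁰ k)ˣ)
    (ξ : AddChar ↥(toModule I) Qbar)
    (τ₁ τ₂ : ↥(toModule I)) (Z : ℂ → ℂ) : Prop where
  hasSum : ∀ s : ℂ, 1 < s.re →
    HasSum
      (fun a : {a : ↥(toModule I) //
          (a : k) ∈ cone (τ₁ : k) (τ₂ : k) ∧ ¬ p ∣ idealIndex I (a : k)} =>
        (ξ a.1 : ℂ) / (((ι₁ (a.1 : k) * ι₂ (a.1 : k) : Qbar) : ℂ) ^ s))
      (Z s)
  meromorphic : Meromorphic Z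
  analyticAt : ∀ m : ℤ, m ≤ 0 → AnalyticAt ℂ Z m

end Complex

section PowerSeries

/-- The product `(1+X₁)^u (1+X₂)^v` of two formal binomial series. -/
def binom (u v : Qbar) : MvPowerSeries (Fin 2) Qbar :=
  fun e => Ring.choose u (e 0) * Ring.choose v (e 1)

variable {k : Type*} [Field k] [NumberField k]

/-- The power series `F_ι(X; ξ, I, τ₁, τ₂)`. (The numerator is a finite sum, and the denominator
has constant term `(1 - ξ(τ₁)) (1 - ξ(τ₂))`, so is invertible if `τ₁, τ₂ ∉ ker ξ`.) -/
def shintaniSeries (ι₁ ι₂ : k →+* Qbar)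
    (I : (FractionalIdeal (NumberField.RingOfIntegers k)⁰ k)ˣ)
    (ξ : AddChar ↥(toModule I) Qbar)
    (τ₁ τ₂ : ↥(toModule I)) :
    MvPowerSeries (Fin 2) Qbar :=
  (∑ᶠ a ∈ {a : ↥(toModule I) |
      (a : k) ∈ parallelogram (τ₁ : k) (τ₂ : k)},
      MvPowerSeries.C (ξ a) * binom (ι₁ (a : k)) (ι₂ (a : k))) *
    ((1 - MvPowerSeries.C (ξ τ₁) * binom (ι₁ (τ₁ : k)) (ι₂ (τ₁ : k))) *
      (1 - MvPowerSeries.C (ξ τ₂) * binom (ι₁ (τ₂ : k)) (ι₂ (τ₂ : k))))⁻¹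

end PowerSeries

section Padic

variable (p : ℕ) [Fact p.Prime]

/-- `w_p`, the number of roots of unity in `ℚ_p`. -/
def rootNumber : ℕ := Nat.card (CommGroup.torsion ℚ_[p]ˣ)

/-- `𝓜(p)`, the set of integers `m ≤ 0` with `m ≡ 1 mod w_p`. -/
def interpolationSet : Set ℤ := {m | m ≤ 0 ∧ m ≡ 1 [ZMOD (rootNumber p : ℤ)]}

/-- `D(p) = 1 + 2 ℤ_p`. -/
def domain : Set ℤ_[p] := {x | ∃ y : ℤ_[p], x = 1 + 2 * y}

lemma one_mem_domain : (1 : ℤ_[p]) ∈ domain p := ⟨0, by simp⟩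

lemma two_dvd_rootNumber : 2 ∣ rootNumber p := by
  have h : IsOfFinOrder (-1 : ℚ_[p]ˣ) := isOfFinOrder_iff_pow_eq_one.2 ⟨2, by norm_num, by simp⟩
  have h2 : orderOf (⟨-1, h⟩ : CommGroup.torsion ℚ_[p]ˣ) = 2 := by
    refine orderOf_eq_prime ?_ ?_
    · ext
      simp
    · intro h'
      have h3 : (-1 : ℚ_[p]ˣ) = 1 := congrArg Subtype.val h'
      have h4 : (-1 : ℚ_[p]) = 1 := by simpa using congrArg Units.val h3
      norm_num at h4
  rw [← h2]
  exact orderOf_dvd_natCard _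

lemma intCast_mem_domain {m : ℤ} (hm : m ∈ interpolationSet p) : (m : ℤ_[p]) ∈ domain p := by
  have h : (2 : ℤ) ∣ m - 1 :=
    (Int.natCast_dvd_natCast.2 (two_dvd_rootNumber p)).trans hm.2.symm.dvd
  obtain ⟨t, ht⟩ := h
  refine ⟨(t : ℤ_[p]), ?_⟩
  have : m = 1 + 2 * t := by linarith
  rw [this]
  push_cast
  ring

variable {k : Type*} [Field k] [NumberField k]

/-- `z : D(p) → ℂ_p` is a continuous function with `z(m) = j(z_{T_p}(m; ξ, I, τ₁, τ₂))` for all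
`m ∈ 𝓜(p)`, where `z_{T_p}` is continued to `ℂ`. -/
def IsPadicInterpolation (j : Qbar →+* ℂ_[p]) (ι₁ ι₂ : k →+* Qbar)
    (I : (FractionalIdeal (NumberField.RingOfIntegers k)⁰ k)ˣ)
    (ξ : AddChar ↥(toModule I) Qbar)
    (τ₁ τ₂ : ↥(toModule I))
    (z : domain p → ℂ_[p]) : Prop :=
  Continuous z ∧ ∃ Z : ℂ → ℂ, IsContinuation p ι₁ ι₂ I ξ τ₁ τ₂ Z ∧
    ∀ (m : ℤ) (hm : m ∈ interpolationSet p),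
      ∃ v : Qbar, (v : ℂ) = Z m ∧ z ⟨(m : ℤ_[p]), intCast_mem_domain p hm⟩ = j v

/-- The coefficient `a_{i,l}` of `X₁^i X₂^l` in
`(1+X₁)⁻¹ (1+X₂)⁻¹ F_ι(X; ξ, I, τ₁, τ₂)^j`. -/
def coeffA (j : Qbar →+* ℂ_[p]) (ι₁ ι₂ : k →+* Qbar)
    (I : (FractionalIdeal (NumberField.RingOfIntegers k)⁰ k)ˣ)
    (ξ : AddChar ↥(toModule I) Qbar)
    (τ₁ τ₂ : ↥(toModule I)) (i l : ℕ) : ℂ_[p] :=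
  MvPowerSeries.coeff (Finsupp.single 0 i + Finsupp.single 1 l)
    (((1 + MvPowerSeries.X 0) * (1 + MvPowerSeries.X 1) : MvPowerSeries (Fin 2) ℂ_[p])⁻¹ *
      MvPowerSeries.map j (shintaniSeries ι₁ ι₂ I ξ τ₁ τ₂))

/-- `c_n = ∑ (ζ - 1)^n`, the sum over the `p`-th roots of unity `ζ`. -/
def c (n : ℕ) : ℂ_[p] := ∑ ζ ∈ Polynomial.nthRootsFinset p (1 : ℂ_[p]), (ζ - 1) ^ n

/-- The real function `f_p`. -/
def errorFn (x : ℝ) : ℝ :=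
  (x + 2) / ((p : ℝ) - 1) - 2 / Real.log p * Real.log (x / 2 + 1) - 2

end Padic

end TwistedZeta

end

/-! Since `f ∣ p - 1`, the values of `ξ` are `(p-1)`-th roots of unity; as `ξ τ₁ ≠ 1`, `p` is odd,
so `w_p = p - 1`, and `ξ(pτ) = ξ(τ)`. As `p` splits and `I` is prime to `p`, the embeddings `j ∘
ι₁`, `j ∘ ι₂` map `I` into `ℤ_p`, giving coordinates `c : I → ℤ_p²`. By `dvd_idealIndex_iff`, `p ∤
|I : (a)|` means that both coordinates of `a` are units, a condition stable under translation by
`pτ₁` and `pτ₂`.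

Complex side: the zeta series is therefore a finite sum of double series `∑ uⁿ vᵐ (ι₁ι₂(b + n pτ₁ +
m pτ₂))^(-s)` with `u = ξ(τ₁) ≠ 1`, `v = ξ(τ₂) ≠ 1`. Repeated summation by parts continues each of
them to an entire function (`exists_shintani_continuation`). At `s = -e` the summand is a
polynomial, and the value is the finite expression `abelSum`, which makes sense over every field and
is transported by `j`.

`p`-adic side: with `q = p^r` one has `u^q = u` and `|1 - u| = 1`, so that `κ = (1-u)(1-v)` times
the value at `-e` agrees modulo `p^r` with a Riemann sum of `ξ(a)(c₁c₂)^e` over points with unit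
coordinates (`norm_interpolationValue_sub_riemannSum_le`). Fermat congruences for unit powers give
Kummer congruences for the values, hence the continuous interpolation; density of `𝓜(p)` in `D(p)`
gives uniqueness. Letting `-e` tend to `1` replaces `(c₁c₂)^e` by `1/(c₁c₂)`.

Evaluation at `1`: the function `y ↦ -1/y` on units, extended by zero, has Mahler coefficients
`c_{i+1}/(p(i+1))` in the basis `C(y-1, i)`, and the two signs cancel in the product. Riemann sums
of `ξ · C(c₁-1, i) C(c₂-1, l)` tend to `κ a_{i,l}`, because `(1+X₁)⁻¹(1+X₂)⁻¹F` is their generating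
function (`tendsto_riemann_choose`). The terms with `i + l ≥ M` are at most `p^(-f_p(M))`, and
integrality of the Mahler coefficients allows `a_{i,l}` to be replaced by an approximation. -/

namespace TwistedZeta

/-! ### Iterated summation by parts. -/

section AbelSummation

variable {V : Type*} [Field V]

/-- The weights of the `K`-fold summation by parts of `∑ uⁿ g(n)`. -/
noncomputable def abelWeight (K : ℕ) (u : V) (i : ℕ) : V := u ^ i / (1 - u) ^ min (i + 1) K

/-- The iterated differences in the `K`-fold summation by parts of `∑ uⁿ g(n)`. -/
def abelDiff (K : ℕ) (g : ℕ → V) (i : ℕ) : V := (fwdDiff 1)^[min i K] g (i - K)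

/-- The Abel sum of `∑ uⁿ g(n)`, if `g` is a polynomial of degree less than `K`. -/
noncomputable def abelSum (K : ℕ) (u : V) (g : ℕ → V) : V :=
  ∑ k ∈ Finset.range K, u ^ k / (1 - u) ^ (k + 1) * (fwdDiff 1)^[k] g 0

lemma map_fwdDiff_iterate {W : Type*} [Field W] (φ : V →+* W) (g : ℕ → V) (k n : ℕ) :
    φ ((fwdDiff 1)^[k] g n) = (fwdDiff 1)^[k] (fun n => φ (g n)) n := by
  induction k generalizing g with
  | zero => rfl
  | succ k ih =>
    rw [Function.iterate_succ_apply, ih, Function.iterate_succ_apply]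
    have e : (fun m => φ (fwdDiff 1 g m)) = fwdDiff 1 fun m => φ (g m) := by
      funext m
      simp [fwdDiff]
    rw [e]

lemma map_abelSum {W : Type*} [Field W] (φ : V →+* W) (K : ℕ) (u : V) (g : ℕ → V) :
    φ (abelSum K u g) = abelSum K (φ u) (fun n => φ (g n)) := by
  simp [abelSum, map_fwdDiff_iterate]

lemma abelDiff_eq_zero {K i : ℕ} {g : ℕ → V} (hg : (fwdDiff 1)^[K] g = 0) (hi : K ≤ i) :
    abelDiff K g i = 0 := by
  simp [abelDiff, min_eq_right hi, hg]

lemma abelSum_eq_sum_weight (K : ℕ) (u : V) (g : ℕ → V) :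
    abelSum K u g = ∑ i ∈ Finset.range K, abelWeight K u i * abelDiff K g i := by
  refine Finset.sum_congr rfl fun i hi => ?_
  have hi := Finset.mem_range.1 hi
  rw [abelWeight, abelDiff, min_eq_left (by omega), min_eq_left hi.le, Nat.sub_eq_zero_of_le hi.le]

variable [TopologicalSpace V] [IsTopologicalRing V]

/-- Subtracting the series from its shift turns `g` into its difference; the term `g 0` is the
boundary contribution. -/
lemma hasSum_fwdDiff {u S : V} {g : ℕ → V} (hu : u ≠ 0)
    (h : HasSum (fun n => u ^ n * g n) S) :
    HasSum (fun n => u ^ n * fwdDiff 1 g n) (((1 - u) * S - g 0) / u) := by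
  have h1 : HasSum (fun n => u ^ (n + 1) * g (n + 1)) (S - g 0) := by
    refine (hasSum_nat_add_iff (f := fun n => u ^ n * g n) 1).2 ?_
    simpa using h
  have e1 : (fun n => u ^ n * fwdDiff 1 g n) =
      fun n => u ^ (n + 1) * g (n + 1) / u - u ^ n * g n := by
    funext n
    simp only [fwdDiff]
    field_simp
    ring
  have e2 : ((1 - u) * S - g 0) / u = (S - g 0) / u - S := by
    field_simp
    ring
  rw [e1, e2]
  exact (h1.div_const u).sub h

/-- Each summation by parts splits off one boundary term and multiplies the series of differences by
`u / (1 - u)`. Indices `i < K` hold the `K` boundary terms; indices `i ≥ K` hold the remaining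
series of `K`-th differences. The two `min`s and the truncated subtraction encode both cases at
once. -/
lemma hasSum_abel {u : V} (hu : u ≠ 0) (hu1 : u ≠ 1) (K : ℕ) {S : V} {g : ℕ → V}
    (h : HasSum (fun n => u ^ n * g n) S) :
    HasSum (fun i => abelWeight K u i * abelDiff K g i) S := by
  have hu1' : 1 - u ≠ 0 := sub_ne_zero.2 hu1.symm
  induction K generalizing g S with
  | zero => simpa [abelWeight, abelDiff] using h
  | succ K ih =>
    have h1 := (ih (hasSum_fwdDiff hu h)).mul_left (u / (1 - u))
    refine (hasSum_nat_add_iff' 1).1 ?_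
    have e1 : (fun i => abelWeight (K + 1) u (i + 1) * abelDiff (K + 1) g (i + 1)) =
        fun i => u / (1 - u) * (abelWeight K u i * abelDiff K (fwdDiff 1 g) i) := by
      funext i
      simp only [abelWeight, abelDiff]
      rw [show min (i + 1) (K + 1) = min i K + 1 by omega,
        show min (i + 1 + 1) (K + 1) = min (i + 1) K + 1 by omega,
        Function.iterate_succ_apply, show i + 1 - (K + 1) = i - K by omega, pow_succ, pow_succ]
      field_simp
    have e2 : S - ∑ i ∈ Finset.range 1, abelWeight (K + 1) u i * abelDiff (K + 1) g i =
        u / (1 - u) * (((1 - u) * S - g 0) / u) := by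
      simp only [abelWeight, abelDiff, Finset.range_one, Finset.sum_singleton]
      simp
      field_simp
    rw [e1, e2]
    exact h1

end AbelSummation

/-! ### Decay of iterated differences of `y₁^(-w₁) y₂^(-w₂)` in a cone. -/

section Differences

/-- The function `y ↦ y₁ ^ (-w₁) y₂ ^ (-w₂)`. -/
noncomputable def powNeg (w₁ w₂ : ℂ) (y : ℝ × ℝ) : ℂ := (y.1 : ℂ) ^ (-w₁) * (y.2 : ℂ) ^ (-w₂)

/-- Comparability in both directions makes one bound serve for exponents of either sign. -/
lemma rpow_le_of_ratio {y y' e E ρ : ℝ} (hy : 0 < y) (hy' : 0 < y') (hρ : 1 ≤ ρ)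
    (h1 : y' ≤ ρ * y) (h2 : y ≤ ρ * y') (he : |e| ≤ E) : y' ^ e ≤ ρ ^ E * y ^ e := by
  have h0 : (0 : ℝ) < ρ := by linarith
  have key : y' ^ e ≤ ρ ^ |e| * y ^ e := by
    rcases le_total 0 e with h | h
    · rw [abs_of_nonneg h, ← Real.mul_rpow h0.le hy.le]
      exact Real.rpow_le_rpow hy'.le h1 h
    · rw [abs_of_nonpos h, Real.rpow_neg h0.le, ← Real.inv_rpow h0.le,
        ← Real.mul_rpow (by positivity) hy.le]
      refine Real.rpow_le_rpow_of_nonpos (by positivity) ?_ h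
      rw [inv_mul_le_iff₀ h0]
      exact h2
  refine key.trans ?_
  gcongr

lemma norm_powNeg {w₁ w₂ : ℂ} {y : ℝ × ℝ} (h1 : 0 < y.1) (h2 : 0 < y.2) :
    ‖powNeg w₁ w₂ y‖ = y.1 ^ (-w₁.re) * y.2 ^ (-w₂.re) := by
  simp [powNeg, Complex.norm_cpow_eq_rpow_re_of_pos h1, Complex.norm_cpow_eq_rpow_re_of_pos h2]

lemma hasDerivAt_powNeg (w₁ w₂ : ℂ) (y d : ℝ × ℝ) (t : ℝ) (h1 : 0 < y.1 + t * d.1)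
    (h2 : 0 < y.2 + t * d.2) :
    HasDerivAt (fun t : ℝ => powNeg w₁ w₂ (y + t • d))
      (-w₁ * d.1 * powNeg (w₁ + 1) w₂ (y + t • d) - w₂ * d.2 * powNeg w₁ (w₂ + 1) (y + t • d))
      t := by
  have aux : ∀ (w : ℂ) (a b : ℝ), 0 < a + t * b →
      HasDerivAt (fun t : ℝ => ((a + t * b : ℝ) : ℂ) ^ (-w))
        (-w * ((a + t * b : ℝ) : ℂ) ^ (-(w + 1)) * b) t := by
    intro w a b hab
    have h : HasDerivAt (fun z : ℂ => a + z * b) (b : ℂ) (t : ℂ) := by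
      simpa using ((hasDerivAt_id (t : ℂ)).mul_const (b : ℂ)).const_add (a : ℂ)
    have h' := (h.cpow_const (c := -w) (Or.inl (by
      rw [← Complex.ofReal_mul, ← Complex.ofReal_add, Complex.ofReal_re]; exact hab))).comp_ofReal
    push_cast
    refine h'.congr_deriv ?_
    rw [neg_add, sub_eq_add_neg]
  refine ((aux w₁ y.1 d.1 h1).mul (aux w₂ y.2 d.2 h2)).congr_deriv ?_
  simp only [powNeg, Prod.fst_add, Prod.snd_add, Prod.smul_fst, Prod.smul_snd, smul_eq_mul]
  ring

/-- Differences commute with directional derivatives, and a derivative raises one of the exponents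
by one. Keeping `w₁` and `w₂` independent makes the family closed under differentiation. -/
lemma hasDerivAt_foldr_powNeg (ds : List (ℝ × ℝ)) (hds : ∀ d ∈ ds, 0 ≤ d.1 ∧ 0 ≤ d.2)
    (w₁ w₂ : ℂ) (y d : ℝ × ℝ) (t : ℝ) (h1 : 0 < y.1 + t * d.1) (h2 : 0 < y.2 + t * d.2) :
    HasDerivAt (fun t : ℝ => ds.foldr fwdDiff (powNeg w₁ w₂) (y + t • d))
      (-w₁ * d.1 * ds.foldr fwdDiff (powNeg (w₁ + 1) w₂) (y + t • d)
        - w₂ * d.2 * ds.foldr fwdDiff (powNeg w₁ (w₂ + 1)) (y + t • d)) t := by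
  induction ds generalizing y with
  | nil => exact hasDerivAt_powNeg w₁ w₂ y d t h1 h2
  | cons e ds ih =>
    have he := hds e (by simp)
    have hds' : ∀ d ∈ ds, 0 ≤ d.1 ∧ 0 ≤ d.2 := fun d hd => hds d (by simp [hd])
    have ih1 := ih hds' (y + e) (by simp; linarith) (by simp; linarith)
    have ih2 := ih hds' y h1 h2
    have e1 : ∀ t : ℝ, y + t • d + e = y + e + t • d := fun t => add_right_comm _ _ _
    simp only [List.foldr_cons, fwdDiff, e1]
    refine (ih1.sub ih2).congr_deriv ?_
    ring

/-- Iterated differences of `y ↦ y₁ ^ (-w₁) y₂ ^ (-w₂)` in positive directions decay, within a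
cone. -/
lemma norm_foldr_powNeg_le {κ H c : ℝ} (hκ : 1 ≤ κ) (hH : 0 ≤ H) (hc : 0 < c) (N : ℕ) (R : ℝ) (hR : 0 ≤ R) :
    ∃ C : ℝ, 0 ≤ C ∧ ∀ ds : List (ℝ × ℝ), ds.length = N →
      (∀ d ∈ ds, 0 ≤ d.1 ∧ 0 ≤ d.2 ∧ d.1 ≤ H ∧ d.2 ≤ H ∧ d.1 ≤ κ * d.2 ∧ d.2 ≤ κ * d.1) →
      ∀ w₁ w₂ : ℂ, ‖w₁‖ ≤ R → ‖w₂‖ ≤ R → ∀ y : ℝ × ℝ, c ≤ y.1 → 0 < y.2 → y.1 ≤ κ * y.2 →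
        y.2 ≤ κ * y.1 →
        ‖ds.foldr fwdDiff (powNeg w₁ w₂) y‖ ≤ C * y.1 ^ (-w₁.re - w₂.re - N) := by
  induction N generalizing R with
  | zero =>
    refine ⟨κ ^ R, by positivity, ?_⟩
    intro ds hds _ w₁ w₂ _ hw₂ y hy1 hy2 hy3 hy4
    have hy1 : 0 < y.1 := by linarith
    rw [List.length_eq_zero_iff.1 hds, List.foldr_nil, norm_powNeg hy1 hy2]
    calc y.1 ^ (-w₁.re) * y.2 ^ (-w₂.re) ≤ y.1 ^ (-w₁.re) * (κ ^ R * y.1 ^ (-w₂.re)) := by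
          gcongr
          refine rpow_le_of_ratio hy1 hy2 hκ hy4 hy3 ?_
          rw [abs_neg]
          exact (Complex.abs_re_le_norm w₂).trans hw₂
      _ = _ := by
          rw [mul_left_comm, ← Real.rpow_add hy1]
          simp [sub_eq_add_neg]
  | succ N ih =>
    obtain ⟨C, hC, ih⟩ := ih (R + 1) (by linarith)
    -- On the segment from `y` to `y + d` the first coordinate grows at most by the factor `ρ`,
    -- since `d.1 ≤ H` and `c ≤ y.1`. The exponent `-w₁.re - w₂.re - (N + 1)` has absolute value at
    -- most `2R + 1 + N`.
    set ρ := 1 + H / c with hρ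
    have hρ1 : 1 ≤ ρ := by rw [hρ]; linarith [div_nonneg hH hc.le]
    refine ⟨2 * (R * H * (C * ρ ^ (2 * R + 1 + N))), by positivity, ?_⟩
    intro ds hds hD w₁ w₂ hw₁ hw₂ y hy1 hy2 hy3 hy4
    obtain ⟨d, ds, rfl⟩ := List.exists_cons_of_length_eq_add_one hds
    have hlen : ds.length = N := by simpa using hds
    have hd := hD d (by simp)
    have hD' : ∀ d ∈ ds, _ := fun d hd => hD d (by simp [hd])
    have hy0 : 0 < y.1 := by linarith
    obtain ⟨hd1, hd2, hd3, hd4, hd5, hd6⟩ := hd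
    have hseg : ∀ t ∈ Set.Icc (0 : ℝ) 1, 0 < y.1 + t * d.1 ∧ 0 < y.2 + t * d.2 := fun t ht =>
      ⟨by have := mul_nonneg ht.1 hd1; linarith, by have := mul_nonneg ht.1 hd2; linarith⟩
    -- The mean value inequality bounds a difference by a derivative, and the derivative gains one
    -- power of `y.1`.
    have hmv := norm_image_sub_le_of_norm_deriv_le_segment_01'
      (f := fun t : ℝ => ds.foldr fwdDiff (powNeg w₁ w₂) (y + t • d))
      (C := 2 * (R * H * (C * ρ ^ (2 * R + 1 + N))) * y.1 ^ (-w₁.re - w₂.re - (N + 1 : ℕ)))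
      (fun t ht => (hasDerivAt_foldr_powNeg ds (fun d hd => ⟨(hD' d hd).1, (hD' d hd).2.1⟩)
        w₁ w₂ y d t (hseg t ht).1 (hseg t ht).2).hasDerivWithinAt) ?_
    · simpa [fwdDiff] using hmv
    · intro t ht
      have ht' := hseg t ⟨ht.1, ht.2.le⟩
      have htd1 := mul_nonneg ht.1 hd1
      have htd2 := mul_nonneg ht.1 hd2
      have key : ∀ z₁ z₂ : ℂ, ‖z₁‖ ≤ R + 1 → ‖z₂‖ ≤ R + 1 → z₁.re + z₂.re = w₁.re + w₂.re + 1 →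
          ‖ds.foldr fwdDiff (powNeg z₁ z₂) (y + t • d)‖ ≤
            C * ρ ^ (2 * R + 1 + N) * y.1 ^ (-w₁.re - w₂.re - (N + 1 : ℕ)) := by
        intro z₁ z₂ hz₁ hz₂ hz
        have h := ih ds hlen hD' z₁ z₂ hz₁ hz₂ (y + t • d) (by simp; linarith)
          (by simpa using ht'.2)
          (by simp; nlinarith [ht.1]) (by simp; nlinarith [ht.1])
        refine h.trans ?_
        rw [mul_assoc]
        gcongr
        rw [show -z₁.re - z₂.re - (N : ℝ) = -w₁.re - w₂.re - (N + 1 : ℕ) by push_cast; linarith]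
        have hle : y.1 ≤ y.1 + t * d.1 := by linarith
        refine rpow_le_of_ratio hy0 (by simpa using ht'.1) hρ1 ?_ ?_ ?_
        · simp only [Prod.fst_add, Prod.smul_fst, smul_eq_mul]
          have : t * d.1 ≤ H / c * y.1 := by
            calc t * d.1 ≤ 1 * H := by gcongr; exact ht.2.le
              _ = H / c * c := by field_simp
              _ ≤ _ := by gcongr
          rw [hρ]; linarith
        · simp only [Prod.fst_add, Prod.smul_fst, smul_eq_mul]
          nlinarith
        · have h1 := (Complex.abs_re_le_norm w₁).trans hw₁
          have h2 := (Complex.abs_re_le_norm w₂).trans hw₂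
          rw [abs_le] at h1 h2 ⊢
          push_cast
          constructor <;> linarith [(Nat.cast_nonneg N : (0 : ℝ) ≤ N)]
      have k1 := key (w₁ + 1) w₂ ((norm_add_le _ _).trans (by simpa using hw₁)) (by linarith)
        (by simp; ring)
      have k2 := key w₁ (w₂ + 1) (by linarith) ((norm_add_le _ _).trans (by simpa using hw₂))
        (by simp; ring)
      have hB : 0 ≤ C * ρ ^ (2 * R + 1 + N) * y.1 ^ (-w₁.re - w₂.re - (N + 1 : ℕ)) := by positivity
      refine (norm_sub_le _ _).trans ?_
      rw [norm_mul, norm_mul, norm_mul, norm_mul, norm_neg, Complex.norm_real, Complex.norm_real,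
        Real.norm_of_nonneg hd1, Real.norm_of_nonneg hd2]
      have m1 : ‖w₁‖ * d.1 * ‖ds.foldr fwdDiff (powNeg (w₁ + 1) w₂) (y + t • d)‖ ≤
        R * H * (C * ρ ^ (2 * R + 1 + N) * y.1 ^ (-w₁.re - w₂.re - (N + 1 : ℕ))) := by gcongr
      have m2 : ‖w₂‖ * d.2 * ‖ds.foldr fwdDiff (powNeg w₁ (w₂ + 1)) (y + t • d)‖ ≤
        R * H * (C * ρ ^ (2 * R + 1 + N) * y.1 ^ (-w₁.re - w₂.re - (N + 1 : ℕ))) := by gcongr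
      calc _ ≤ _ := add_le_add m1 m2
        _ = _ := by ring

end Differences

/-! ### Uniform convergence of the double series after summation by parts. -/

section Continuation

variable {y a b : ℝ × ℝ}

lemma iterate_fwdDiff_comp {M G : Type*} [AddCommMonoid M] [AddCommGroup G] (F : M → G) (x d : M)
    (k n : ℕ) :
    (fwdDiff 1)^[k] (fun n : ℕ => F (x + n • d)) n = (fwdDiff d)^[k] F (x + n • d) := by
  induction k generalizing n with
  | zero => rfl
  | succ k ih =>
    rw [Function.iterate_succ_apply', Function.iterate_succ_apply', fwdDiff, fwdDiff, ih, ih,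
      succ_nsmul, add_assoc]

lemma foldr_replicate_eq_iterate {α β : Type*} (f : α → β → β) (x : α) (z : β) (k : ℕ) :
    (List.replicate k x).foldr f z = (f x)^[k] z := by
  induction k with
  | zero => rfl
  | succ k ih => rw [List.replicate_succ, List.foldr_cons, ih, Function.iterate_succ_apply']

/-- Differences in the indices become differences in the directions `a` and `b`, to which the decay
estimate applies. -/
lemma abelDiff_abelDiff_eq_foldr (F : ℝ × ℝ → ℂ) (K i j : ℕ) :
    abelDiff K (fun n => abelDiff K (fun m => F (y + n • a + m • b)) j) i =
      (List.replicate (min i K) a ++ List.replicate (min j K) b).foldr fwdDiff F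
        (y + (i - K) • a + (j - K) • b) := by
  have h : ∀ n : ℕ, abelDiff K (fun m => F (y + n • a + m • b)) j =
      (fwdDiff b)^[min j K] F (y + (j - K) • b + n • a) := fun n => by
    rw [abelDiff, iterate_fwdDiff_comp F (y + n • a) b, add_right_comm]
  simp only [h]
  rw [abelDiff, iterate_fwdDiff_comp _ (y + (j - K) • b) a, List.foldr_append,
    foldr_replicate_eq_iterate, foldr_replicate_eq_iterate, add_right_comm]

lemma summable_rpow_prod {σ : ℝ} (hσ : 1 < σ) :
    Summable fun n : ℕ × ℕ => (1 + n.1 : ℝ) ^ (-σ) * (1 + n.2 : ℝ) ^ (-σ) := by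
  have h : Summable fun n : ℕ => (1 + n : ℝ) ^ (-σ) := by
    have := (summable_nat_add_iff 1).2 (Real.summable_nat_rpow.2 (by linarith : -σ < -1))
    simpa [add_comm] using this
  exact h.mul_of_nonneg h (fun n => by positivity) (fun n => by positivity)

/-- By `(1 + i + j)² ≥ (1 + i)(1 + j)`, decay in `i + j` is bounded by a product of two one-variable
terms. -/
lemma rpow_two_mul_le {σ c r : ℝ} (hσ : 0 ≤ σ) (hc : 0 < c) {i j : ℕ} (h : c * (1 + i + j) ≤ r) :
    r ^ (-(2 * σ)) ≤ c ^ (-(2 * σ)) * ((1 + i : ℝ) ^ (-σ) * (1 + j : ℝ) ^ (-σ)) := by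
  have h1 : (0 : ℝ) < 1 + i := by positivity
  have h2 : (0 : ℝ) < 1 + j := by positivity
  calc r ^ (-(2 * σ)) ≤ (c * (1 + i + j)) ^ (-(2 * σ)) :=
        Real.rpow_le_rpow_of_nonpos (by positivity) h (by linarith)
    _ = c ^ (-(2 * σ)) * ((1 + i + j : ℝ) ^ (2 : ℝ)) ^ (-σ) := by
        rw [Real.mul_rpow hc.le (by positivity), ← Real.rpow_mul (by positivity)]
        congr 2
        ring
    _ ≤ c ^ (-(2 * σ)) * ((1 + i : ℝ) * (1 + j : ℝ)) ^ (-σ) := by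
        refine mul_le_mul_of_nonneg_left ?_ (by positivity)
        refine Real.rpow_le_rpow_of_nonpos (by positivity) ?_ (by linarith)
        norm_cast
        nlinarith [Nat.zero_le (i * j), Nat.zero_le (i*i), Nat.zero_le (j*j)]
    _ = _ := by rw [Real.mul_rpow h1.le h2.le]

lemma norm_abelWeight_le {u : ℂ} (hu : ‖u‖ = 1) (K i : ℕ) :
    ‖abelWeight K u i‖ ≤ (max 1 ‖1 - u‖⁻¹) ^ K := by
  rw [abelWeight, norm_div, norm_pow, norm_pow, hu, one_pow, one_div, ← inv_pow]
  calc ‖1 - u‖⁻¹ ^ min (i + 1) K ≤ (max 1 ‖1 - u‖⁻¹) ^ min (i + 1) K := by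
        gcongr; exact le_max_right _ _
    _ ≤ _ := pow_le_pow_right₀ (le_max_left _ _) (min_le_right _ _)

/-- The summands of the summed by parts zeta series. -/
noncomputable def abelTerm (y a b : ℝ × ℝ) (u v : ℂ) (K : ℕ) (s : ℂ) (q : ℕ × ℕ) : ℂ :=
  abelWeight K u q.1 * (abelWeight K v q.2 *
    abelDiff K (fun n => abelDiff K (fun m => powNeg s s (y + n • a + m • b)) q.2) q.1)

/-- The ratios and sizes of `y`, `a`, `b` are bounded simultaneously; both ratio bounds are
inherited by all points `y + n a + m b`. -/
lemma exists_cone_constants (hy : 0 < y.1 ∧ 0 < y.2) (ha : 0 < a.1 ∧ 0 < a.2)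
    (hb : 0 < b.1 ∧ 0 < b.2) :
    ∃ κ c : ℝ, 1 ≤ κ ∧ 0 < c ∧ (∀ d : ℝ × ℝ, d = y ∨ d = a ∨ d = b →
      d.1 ≤ κ * d.2 ∧ d.2 ≤ κ * d.1 ∧ d.1 ≤ κ ∧ d.2 ≤ κ ∧ c ≤ d.1) := by
  have key : ∀ d : ℝ × ℝ, 0 < d.1 ∧ 0 < d.2 → ∃ κ c : ℝ, 1 ≤ κ ∧ 0 < c ∧ ∀ κ', κ ≤ κ' → ∀ c' ≤ c,
      d.1 ≤ κ' * d.2 ∧ d.2 ≤ κ' * d.1 ∧ d.1 ≤ κ' ∧ d.2 ≤ κ' ∧ c' ≤ d.1 := by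
    rintro d ⟨h1, h2⟩
    have p1 := div_pos h1 h2
    have p2 := div_pos h2 h1
    refine ⟨1 + d.1 / d.2 + d.2 / d.1 + d.1 + d.2, d.1, by linarith, h1, ?_⟩
    intro κ hκ c hc
    refine ⟨?_, ?_, by linarith, by linarith, hc⟩
    · rw [← div_le_iff₀ h2]; linarith
    · rw [← div_le_iff₀ h1]; linarith
  obtain ⟨κ₁, c₁, h1, h1', H1⟩ := key y hy
  obtain ⟨κ₂, c₂, h2, h2', H2⟩ := key a ha
  obtain ⟨κ₃, c₃, h3, h3', H3⟩ := key b hb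
  refine ⟨κ₁ + κ₂ + κ₃, min c₁ (min c₂ c₃), by linarith, by positivity, ?_⟩
  rintro d (rfl | rfl | rfl)
  · exact H1 _ (by linarith) _ (min_le_left _ _)
  · exact H2 _ (by linarith) _ ((min_le_right _ _).trans (min_le_left _ _))
  · exact H3 _ (by linarith) _ ((min_le_right _ _).trans (min_le_right _ _))

lemma lattice_point_mem_cone {κ : ℝ} (hκ : ∀ d : ℝ × ℝ, d = y ∨ d = a ∨ d = b →
      d.1 ≤ κ * d.2 ∧ d.2 ≤ κ * d.1) (n m : ℕ) :
    (y + n • a + m • b).1 ≤ κ * (y + n • a + m • b).2 ∧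
      (y + n • a + m • b).2 ≤ κ * (y + n • a + m • b).1 := by
  obtain ⟨h1, h1'⟩ := hκ y (by simp)
  obtain ⟨h2, h2'⟩ := hκ a (by simp)
  obtain ⟨h3, h3'⟩ := hκ b (by simp)
  have hn : (0 : ℝ) ≤ n := by positivity
  have hm : (0 : ℝ) ≤ m := by positivity
  simp only [Prod.fst_add, Prod.snd_add, Prod.smul_fst, Prod.smul_snd]
  simp only [nsmul_eq_mul]
  constructor <;> nlinarith [mul_le_mul_of_nonneg_left h2 hn, mul_le_mul_of_nonneg_left h3 hm,
    mul_le_mul_of_nonneg_left h2' hn, mul_le_mul_of_nonneg_left h3' hm]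

lemma le_lattice_point {c : ℝ} (hc : ∀ d : ℝ × ℝ, d = y ∨ d = a ∨ d = b → c ≤ d.1) (n m : ℕ) :
    c * (1 + n + m) ≤ (y + n • a + m • b).1 := by
  have h1 := hc y (by simp)
  have h2 := hc a (by simp)
  have h3 := hc b (by simp)
  have hn : (0 : ℝ) ≤ n := by positivity
  have hm : (0 : ℝ) ≤ m := by positivity
  simp only [Prod.fst_add, Prod.smul_fst]
  simp only [nsmul_eq_mul]
  nlinarith

lemma lattice_point_pos (hy : 0 < y.1 ∧ 0 < y.2) (ha : 0 < a.1 ∧ 0 < a.2)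
    (hb : 0 < b.1 ∧ 0 < b.2) (n m : ℕ) :
    0 < (y + n • a + m • b).1 ∧ 0 < (y + n • a + m • b).2 := by
  obtain ⟨h1, h1'⟩ := hy
  obtain ⟨h2, h2'⟩ := ha
  obtain ⟨h3, h3'⟩ := hb
  simp only [Prod.fst_add, Prod.snd_add, Prod.smul_fst, Prod.smul_snd]
  simp only [nsmul_eq_mul]
  constructor <;> positivity

/-- If `i ≥ K` or `j ≥ K`, at least `K` differences have been taken, so the term is of order at most
`x^(2R - K) ≤ x^(-4)` up to constants, where the first coordinate `x` grows like `1 + i + j`.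
Uniformity in `‖s‖ ≤ R` will give holomorphy. -/
lemma exists_abelTerm_bound (hy : 0 < y.1 ∧ 0 < y.2) (ha : 0 < a.1 ∧ 0 < a.2)
    (hb : 0 < b.1 ∧ 0 < b.2) {u v : ℂ} (hu : ‖u‖ = 1) (hv : ‖v‖ = 1) {R : ℝ} (hR : 0 ≤ R) {K : ℕ}
    (hK : 2 * R + 4 ≤ K) :
    ∃ g : ℕ × ℕ → ℝ, Summable g ∧ ∀ q, ∀ s : ℂ, ‖s‖ ≤ R → ‖abelTerm y a b u v K s q‖ ≤ g q := by
  obtain ⟨κ, c, hκ, hc, h⟩ := exists_cone_constants hy ha hb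
  have hκ0 : 0 < κ := by linarith
  choose C hC hC' using fun N => norm_foldr_powNeg_le hκ hκ0.le hc N R hR
  set C₀ := ∑ N ∈ Finset.range (2 * K + 1), C N with hC₀
  set ρ := max κ c⁻¹ with hρ
  have hρ1 : 1 ≤ ρ := hκ.trans (le_max_left _ _)
  have hρ0 : 0 < ρ := by linarith
  -- The factor `1 + 2K` pays for having `i - K` and `j - K` in place of `i` and `j`.
  set c' := c / (1 + 2 * K) with hc'
  have hc'0 : 0 < c' := by positivity
  set W := (max 1 ‖1 - u‖⁻¹) ^ K
  set W' := (max 1 ‖1 - v‖⁻¹) ^ K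
  have hC₀0 : 0 ≤ C₀ := Finset.sum_nonneg fun N _ => hC N
  refine ⟨fun q => W * (W' * (C₀ * (ρ ^ (2 * R + 2 * K + 4) * (c' ^ (-(2 * 2 : ℝ)) *
    ((1 + q.1 : ℝ) ^ (-2 : ℝ) * (1 + q.2 : ℝ) ^ (-2 : ℝ)))))),
    ((((summable_rpow_prod one_lt_two).mul_left _).mul_left _).mul_left _).mul_left _ |>.mul_left _,
    ?_⟩
  rintro ⟨i, j⟩ s hs
  rw [abelTerm, norm_mul, norm_mul]
  refine mul_le_mul (norm_abelWeight_le hu K i) (mul_le_mul (norm_abelWeight_le hv K j) ?_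
    (norm_nonneg _) (by positivity)) (by positivity) (by positivity)
  rw [abelDiff_abelDiff_eq_foldr]
  set x := y + (i - K) • a + (j - K) • b with hx
  have hxpos := lattice_point_pos hy ha hb (i - K) (j - K)
  rw [← hx] at hxpos
  have hx1 := hxpos.1
  have hxcone := lattice_point_mem_cone (fun d hd => ⟨(h d hd).1, (h d hd).2.1⟩) (i - K) (j - K)
  rw [← hx] at hxcone
  have hxle := le_lattice_point (fun d hd => (h d hd).2.2.2.2) (i - K) (j - K)
  rw [← hx] at hxle
  have hcx : c ≤ x.1 := by
    refine le_trans ?_ hxle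
    have : (1 : ℝ) ≤ 1 + (i - K : ℕ) + (j - K : ℕ) := by norm_cast; omega
    nlinarith
  have hc'x : c' * (1 + i + j) ≤ x.1 := by
    refine le_trans ?_ hxle
    rw [hc', div_mul_eq_mul_div, div_le_iff₀ (by positivity), mul_assoc]
    refine mul_le_mul_of_nonneg_left ?_ hc.le
    have h1 : (i : ℝ) ≤ (i - K : ℕ) + K := by norm_cast; omega
    have h2 : (j : ℝ) ≤ (j - K : ℕ) + K := by norm_cast; omega
    have h3 : (0 : ℝ) ≤ (i - K : ℕ) := by positivity
    have h4 : (0 : ℝ) ≤ (j - K : ℕ) := by positivity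
    have h5 : (0 : ℝ) ≤ K := by positivity
    nlinarith [mul_nonneg h3 h5, mul_nonneg h4 h5]
  set ds := List.replicate (min i K) a ++ List.replicate (min j K) b with hds
  have hlen : ds.length = min i K + min j K := by simp [hds]
  have hmem : ∀ d ∈ ds, d = a ∨ d = b := by
    intro d hd
    rw [hds, List.mem_append, List.mem_replicate, List.mem_replicate] at hd
    tauto
  have hbound := hC' _ ds hlen (fun d hd => by
    have h0 := h d (Or.inr (hmem d hd))
    have h1 : 0 < d.1 ∧ 0 < d.2 := by rcases hmem d hd with rfl | rfl <;> assumption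
    exact ⟨h1.1.le, h1.2.le, h0.2.2.1, h0.2.2.2.1, h0.1, h0.2.1⟩) s s hs hs x hcx hxpos.2
    hxcone.1 hxcone.2
  refine hbound.trans ?_
  have hCle : C (min i K + min j K) ≤ C₀ :=
    Finset.single_le_sum (f := C) (fun N _ => hC N) (Finset.mem_range.2 (by omega))
  refine mul_le_mul hCle ?_ (by positivity) hC₀0
  set e := -s.re - s.re - ((min i K + min j K : ℕ) : ℝ) with he
  have hre := (Complex.abs_re_le_norm s).trans hs
  rw [abs_le] at hre
  -- The factor `x^(-4)` gives summability; the remaining exponent `e + 4` only has to be kept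
  -- bounded.
  have hsplit : x.1 ^ e = x.1 ^ (e + 4) * x.1 ^ (-(2 * 2 : ℝ)) := by
    rw [← Real.rpow_add hxpos.1]
    congr 1
    ring
  rw [hsplit]
  have hle2 : ((min i K + min j K : ℕ) : ℝ) ≤ 2 * K := by norm_cast; omega
  have hge0 : (0 : ℝ) ≤ ((min i K + min j K : ℕ) : ℝ) := by positivity
  have habs : |e + 4| ≤ 2 * R + 2 * K + 4 := by
    rw [abs_le]; constructor <;> linarith
  refine mul_le_mul ?_ (rpow_two_mul_le zero_le_two hc'0 hc'x) (by positivity) (by positivity)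
  have hclow : 1 ≤ ρ * c := by
    have : c⁻¹ ≤ ρ := le_max_right _ _
    calc 1 = c⁻¹ * c := by field_simp
      _ ≤ ρ * c := by gcongr
  -- In the finite block the base point is `y` itself, so any exponent is harmless. Outside it `e +
  -- 4 ≤ 0`, and `c ≤ x.1` suffices.
  by_cases hij : i < K ∧ j < K
  · have hxy : x = y := by simp [hx, Nat.sub_eq_zero_of_le hij.1.le, Nat.sub_eq_zero_of_le hij.2.le]
    have := rpow_le_of_ratio (e := e + 4) zero_lt_one hxpos.1 hρ1
      (by rw [hxy, mul_one]; exact (h y (by simp)).2.2.1.trans (le_max_left _ _))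
      (hclow.trans (by gcongr)) habs
    simpa using this
  · have he4 : e + 4 ≤ 0 := by
      have : (K : ℝ) ≤ ((min i K + min j K : ℕ) : ℝ) := by norm_cast; omega
      linarith
    refine (Real.rpow_le_rpow_of_nonpos hc hcx he4).trans ?_
    have := rpow_le_of_ratio (e := e + 4) zero_lt_one hc hρ1
      (by
        rw [mul_one]
        exact ((h y (by simp)).2.2.2.2.trans (h y (by simp)).2.2.1).trans (le_max_left _ _))
      hclow habs
    simpa using this

lemma summable_norm_powNeg (hy : 0 < y.1 ∧ 0 < y.2) (ha : 0 < a.1 ∧ 0 < a.2)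
    (hb : 0 < b.1 ∧ 0 < b.2) {s : ℂ} (hs : 1 < s.re) :
    Summable fun q : ℕ × ℕ => ‖powNeg s s (y + q.1 • a + q.2 • b)‖ := by
  obtain ⟨κ, c, hκ, hc, h⟩ := exists_cone_constants hy ha hb
  have hκ0 : 0 < κ := by linarith
  refine Summable.of_nonneg_of_le (fun _ => norm_nonneg _) (fun q => ?_)
    (((summable_rpow_prod hs).mul_left (c ^ (-(2 * s.re)))).mul_left (κ ^ |s.re|))
  have hx := lattice_point_pos hy ha hb q.1 q.2
  have hxcone := lattice_point_mem_cone (fun d hd => ⟨(h d hd).1, (h d hd).2.1⟩) q.1 q.2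
  have hxle := le_lattice_point (fun d hd => (h d hd).2.2.2.2) q.1 q.2
  set x := y + q.1 • a + q.2 • b
  rw [norm_powNeg hx.1 hx.2]
  calc x.1 ^ (-s.re) * x.2 ^ (-s.re) ≤ x.1 ^ (-s.re) * (κ ^ |s.re| * x.1 ^ (-s.re)) := by
        refine mul_le_mul_of_nonneg_left ?_ (Real.rpow_nonneg hx.1.le _)
        exact rpow_le_of_ratio hx.1 hx.2 hκ hxcone.2 hxcone.1 (abs_neg _).le
    _ = κ ^ |s.re| * x.1 ^ (-(2 * s.re)) := by
        rw [mul_left_comm, ← Real.rpow_add hx.1]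
        congr 2
        ring
    _ ≤ _ := by
        gcongr
        exact rpow_two_mul_le (by linarith) hc hxle

end Continuation

/-! ### Entire continuation of the double series and its values at non-positive integers. -/

section Continuation

variable {y a b : ℝ × ℝ}

lemma hasSum_fwdDiff_iterate {ι G : Type*} [AddCommGroup G] [TopologicalSpace G]
    [IsTopologicalAddGroup G] {F : ι → ℕ → G} {S : ℕ → G}
    (h : ∀ n, HasSum (fun j => F j n) (S n)) (k n : ℕ) :
    HasSum (fun j => (fwdDiff 1)^[k] (F j) n) ((fwdDiff 1)^[k] S n) := by
  induction k generalizing n with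
  | zero => exact h n
  | succ k ih =>
    simp only [Function.iterate_succ_apply', fwdDiff]
    exact (ih (n + 1)).sub (ih n)

lemma fwdDiff_iterate_sub {G : Type*} [AddCommGroup G] (f g : ℕ → G) (k n : ℕ) :
    (fwdDiff 1)^[k] (fun n => f n - g n) n = (fwdDiff 1)^[k] f n - (fwdDiff 1)^[k] g n := by
  induction k generalizing n with
  | zero => rfl
  | succ k ih =>
    simp only [Function.iterate_succ_apply', fwdDiff, ih]
    abel

lemma fwdDiff_iterate_zero {G : Type*} [AddCommGroup G] (k n : ℕ) :
    (fwdDiff 1)^[k] (fun _ : ℕ => (0 : G)) n = 0 := by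
  induction k generalizing n with
  | zero => rfl
  | succ k ih => simp only [Function.iterate_succ_apply', fwdDiff, ih, sub_zero]

lemma fwdDiff_iterate_comm {G : Type*} [AddCommGroup G] (F : ℕ → ℕ → G) (k l n m : ℕ) :
    (fwdDiff 1)^[k] (fun n => (fwdDiff 1)^[l] (F n) m) n =
      (fwdDiff 1)^[l] (fun m => (fwdDiff 1)^[k] (fun n => F n m) n) m := by
  induction k generalizing n with
  | zero => rfl
  | succ k ih =>
    simp only [Function.iterate_succ_apply', fwdDiff, ih, fwdDiff_iterate_sub]

lemma fwdDiff_iterate_sum_mul {ι G : Type*} [Ring G] (t : Finset ι) (w : ι → G)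
    (F : ι → ℕ → G) (k n : ℕ) :
    (fwdDiff 1)^[k] (fun n => ∑ j ∈ t, w j * F j n) n =
      ∑ j ∈ t, w j * (fwdDiff 1)^[k] (F j) n := by
  induction k generalizing n with
  | zero => rfl
  | succ k ih =>
    simp only [Function.iterate_succ_apply', fwdDiff, ih, mul_sub, Finset.sum_sub_distrib]

/-- Both double sums are evaluated as iterated sums: summation by parts in `m` is done for each
fixed `n`, differences in `n` pass through the sum over `m`, and then summation by parts is done in
`n`. -/
lemma tsum_abel_abel {u v : ℂ} (hu0 : u ≠ 0) (hv0 : v ≠ 0) (hu1 : u ≠ 1) (hv1 : v ≠ 1)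
    (K : ℕ) (h : ℕ → ℕ → ℂ) (hS : Summable fun q : ℕ × ℕ => u ^ q.1 * (v ^ q.2 * h q.1 q.2))
    (hsum : Summable fun q : ℕ × ℕ => abelWeight K u q.1 * (abelWeight K v q.2 *
      abelDiff K (fun n => abelDiff K (h n) q.2) q.1)) :
    ∑' q : ℕ × ℕ, abelWeight K u q.1 * (abelWeight K v q.2 *
      abelDiff K (fun n => abelDiff K (h n) q.2) q.1) =
    ∑' q : ℕ × ℕ, u ^ q.1 * (v ^ q.2 * h q.1 q.2) := by
  have hS2 : ∀ n, Summable fun m => v ^ m * h n m := fun n => by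
    have := (hS.prod_factor n).mul_left (u ^ n)⁻¹
    simpa [hu0] using this
  have h1 : HasSum (fun n => u ^ n * ∑' m, v ^ m * h n m)
      (∑' q : ℕ × ℕ, u ^ q.1 * (v ^ q.2 * h q.1 q.2)) := by
    have h0 : ∀ n, HasSum (fun m => u ^ n * (v ^ m * h n m)) (u ^ n * ∑' m, v ^ m * h n m) :=
      fun n => (hS2 n).hasSum.mul_left _
    exact HasSum.prod_fiberwise hS.hasSum h0
  have h3 : ∀ i, HasSum (fun j => abelWeight K u i * (abelWeight K v j *
      abelDiff K (fun n => abelDiff K (h n) j) i))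
      (abelWeight K u i * abelDiff K (fun n => ∑' m, v ^ m * h n m) i) := fun i => by
    refine HasSum.mul_left _ ?_
    have := hasSum_fwdDiff_iterate (fun n => hasSum_abel hv0 hv1 K (hS2 n).hasSum) (min i K) (i - K)
    have e : ∀ j, (fwdDiff 1)^[min i K] (fun n => abelWeight K v j * abelDiff K (h n) j) (i - K) =
        abelWeight K v j * (fwdDiff 1)^[min i K] (fun n => abelDiff K (h n) j) (i - K) := fun j => by
      simpa using fwdDiff_iterate_sum_mul {j} (abelWeight K v)
        (fun j n => abelDiff K (h n) j) (min i K) (i - K)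
    simp only [e] at this
    exact this
  exact (hsum.hasSum.prod_fiberwise h3).unique (hasSum_abel hu0 hu1 K h1)

lemma hasSum_of_summable_abelTerm (hy : 0 < y.1 ∧ 0 < y.2) (ha : 0 < a.1 ∧ 0 < a.2)
    (hb : 0 < b.1 ∧ 0 < b.2) {u v : ℂ} (hu : ‖u‖ = 1) (hv : ‖v‖ = 1) (hu1 : u ≠ 1) (hv1 : v ≠ 1)
    {K : ℕ} {s : ℂ} (hs : 1 < s.re) (hsum : Summable (abelTerm y a b u v K s)) :
    HasSum (fun q : ℕ × ℕ => u ^ q.1 * v ^ q.2 * powNeg s s (y + q.1 • a + q.2 • b))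
      (∑' q, abelTerm y a b u v K s q) := by
  have hu0 : u ≠ 0 := by rintro rfl; simp at hu
  have hv0 : v ≠ 0 := by rintro rfl; simp at hv
  have hS : Summable fun q : ℕ × ℕ =>
      u ^ q.1 * (v ^ q.2 * powNeg s s (y + q.1 • a + q.2 • b)) := by
    refine Summable.of_norm ?_
    simpa only [norm_mul, norm_pow, hu, hv, one_pow, one_mul] using
      summable_norm_powNeg hy ha hb hs
  have h := tsum_abel_abel hu0 hv0 hu1 hv1 K (fun n m => powNeg s s (y + n • a + m • b)) hS hsum
  simp only [mul_assoc]
  have h' : (∑' q, abelTerm y a b u v K s q) = _ := h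
  rw [h']
  exact hS.hasSum

lemma differentiable_foldr_powNeg (ds : List (ℝ × ℝ)) (hds : ∀ d ∈ ds, 0 < d.1 ∧ 0 < d.2)
    {y : ℝ × ℝ} (hy : 0 < y.1 ∧ 0 < y.2) :
    Differentiable ℂ fun s => ds.foldr fwdDiff (powNeg s s) y := by
  induction ds generalizing y with
  | nil =>
    simp only [List.foldr_nil, powNeg]
    refine Differentiable.mul ?_ ?_
    · exact (differentiable_id.neg).const_cpow (Or.inl (by simpa using hy.1.ne'))
    · exact (differentiable_id.neg).const_cpow (Or.inl (by simpa using hy.2.ne'))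
  | cons d ds ih =>
    have hd := hds d (by simp)
    have ih := fun {y} => @ih (fun d hd => hds d (by simp [hd])) y
    simp only [List.foldr_cons, fwdDiff]
    exact (ih (y := y + d) ⟨add_pos hy.1 hd.1, add_pos hy.2 hd.2⟩).sub (ih hy)

lemma differentiable_abelTerm (hy : 0 < y.1 ∧ 0 < y.2) (ha : 0 < a.1 ∧ 0 < a.2)
    (hb : 0 < b.1 ∧ 0 < b.2) (u v : ℂ) (K : ℕ) (q : ℕ × ℕ) :
    Differentiable ℂ fun s => abelTerm y a b u v K s q := by
  simp only [abelTerm, abelDiff_abelDiff_eq_foldr]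
  refine ((differentiable_foldr_powNeg _ ?_ (lattice_point_pos hy ha hb _ _)).const_mul _).const_mul _
  intro d hd
  rw [List.mem_append, List.mem_replicate, List.mem_replicate] at hd
  rcases hd with ⟨_, rfl⟩ | ⟨_, rfl⟩ <;> assumption

lemma differentiableOn_tsum_abelTerm (hy : 0 < y.1 ∧ 0 < y.2) (ha : 0 < a.1 ∧ 0 < a.2)
    (hb : 0 < b.1 ∧ 0 < b.2) {u v : ℂ} (hu : ‖u‖ = 1) (hv : ‖v‖ = 1) {R : ℝ} (hR : 0 ≤ R) {K : ℕ}
    (hK : 2 * R + 4 ≤ K) :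
    DifferentiableOn ℂ (fun s => ∑' q, abelTerm y a b u v K s q) (Metric.ball 0 R) := by
  obtain ⟨g, hg, hg'⟩ := exists_abelTerm_bound hy ha hb hu hv hR hK
  exact Complex.differentiableOn_tsum_of_summable_norm hg
    (fun q => (differentiable_abelTerm hy ha hb u v K q).differentiableOn) Metric.isOpen_ball
    fun q s hs => hg' q s (mem_ball_zero_iff.1 hs).le

/-- Where `Re s > 1` both sides equal the original series, and `R > 1` makes the ball meet this
half-plane; the identity theorem does the rest. -/
lemma tsum_abelTerm_eqOn (hy : 0 < y.1 ∧ 0 < y.2) (ha : 0 < a.1 ∧ 0 < a.2)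
    (hb : 0 < b.1 ∧ 0 < b.2) {u v : ℂ} (hu : ‖u‖ = 1) (hv : ‖v‖ = 1) (hu1 : u ≠ 1) (hv1 : v ≠ 1)
    {R : ℝ} (hR : 1 < R) {K K' : ℕ} (hK : 2 * R + 4 ≤ K) (hK' : 2 * R + 4 ≤ K') :
    Set.EqOn (fun s => ∑' q, abelTerm y a b u v K s q) (fun s => ∑' q, abelTerm y a b u v K' s q)
      (Metric.ball 0 R) := by
  have hR0 : 0 ≤ R := by linarith
  have hsummable : ∀ L : ℕ, 2 * R + 4 ≤ L → ∀ s ∈ Metric.ball (0 : ℂ) R,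
      Summable (abelTerm y a b u v L s) := fun L hL s hs => by
    obtain ⟨g, hg, hg'⟩ := exists_abelTerm_bound hy ha hb hu hv hR0 hL
    exact hg.of_norm_bounded fun q => hg' q s (mem_ball_zero_iff.1 hs).le
  have hz : (((1 + R) / 2 : ℝ) : ℂ) ∈ Metric.ball (0 : ℂ) R := by
    rw [mem_ball_zero_iff, Complex.norm_real, Real.norm_of_nonneg (by linarith)]
    linarith
  refine AnalyticOnNhd.eqOn_of_preconnected_of_eventuallyEq
    ((differentiableOn_tsum_abelTerm hy ha hb hu hv hR0 hK).analyticOnNhd Metric.isOpen_ball)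
    ((differentiableOn_tsum_abelTerm hy ha hb hu hv hR0 hK').analyticOnNhd Metric.isOpen_ball)
    (convex_ball _ _).isPreconnected hz ?_
  have ho : IsOpen {s : ℂ | 1 < s.re} := isOpen_lt continuous_const Complex.continuous_re
  filter_upwards [Metric.isOpen_ball.mem_nhds hz, ho.mem_nhds
    (by rw [Set.mem_ofPred_eq, Complex.ofReal_re]; linarith)] with s hs1 hs2
  exact (hasSum_of_summable_abelTerm hy ha hb hu hv hu1 hv1 hs2 (hsummable K hK s hs1)).unique
    (hasSum_of_summable_abelTerm hy ha hb hu hv hu1 hv1 hs2 (hsummable K' hK' s hs1))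

lemma fwdDiff_iterate_linear_pow_eq_zero {V : Type*} [Field V] (x₁ x₂ d₁ d₂ : V) {e K : ℕ}
    (hK : 2 * e < K) :
    (fwdDiff 1)^[K] (fun n : ℕ => ((x₁ + n * d₁) * (x₂ + n * d₂)) ^ e) = 0 := by
  set P : Polynomial V := ((Polynomial.C x₁ + Polynomial.C d₁ * Polynomial.X) *
    (Polynomial.C x₂ + Polynomial.C d₂ * Polynomial.X)) ^ e with hP
  have h1 : (fun n : ℕ => ((x₁ + n * d₁) * (x₂ + n * d₂)) ^ e) =
      fun n : ℕ => P.eval (0 + n • 1) := by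
    funext n
    simp only [hP, Polynomial.eval_pow, Polynomial.eval_mul, Polynomial.eval_add,
      Polynomial.eval_C, Polynomial.eval_X, nsmul_eq_mul]
    ring
  have hdeg : P.natDegree < K := by
    refine lt_of_le_of_lt ?_ hK
    rw [hP]
    refine Polynomial.natDegree_pow_le.trans ?_
    rw [mul_comm]
    gcongr
    compute_degree
  funext n
  rw [h1, iterate_fwdDiff_comp P.eval (0 : V) 1,
    Polynomial.fwdDiff_iter_eq_zero_of_degree_lt hdeg]
  rfl

lemma fwdDiff_iterate_powNeg_eq_zero (x d : ℝ × ℝ) {e K : ℕ} (hK : 2 * e < K) :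
    (fwdDiff 1)^[K] (fun n : ℕ => powNeg (-(e : ℂ)) (-(e : ℂ)) (x + n • d)) = 0 := by
  rw [← fwdDiff_iterate_linear_pow_eq_zero (x.1 : ℂ) x.2 d.1 d.2 hK]
  congr 1
  funext n
  simp only [powNeg, neg_neg, Complex.cpow_natCast, Prod.fst_add, Prod.snd_add,
    Prod.smul_fst, Prod.smul_snd, mul_pow]
  simp only [nsmul_eq_mul]
  push_cast
  ring

/-- At `s = -e` the summand is a polynomial of degree at most `2e` in each index, so `K`-th
differences vanish and only the boundary terms with `i, j < K` survive. -/
lemma tsum_abelTerm_neg_natCast (y a b : ℝ × ℝ) (u v : ℂ) {e K : ℕ} (hK : 2 * e < K) :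
    ∑' q, abelTerm y a b u v K (-e) q = abelSum K u fun n => abelSum K v fun m =>
      powNeg (-(e : ℂ)) (-(e : ℂ)) (y + n • a + m • b) := by
  have hb0 : ∀ n : ℕ, (fwdDiff 1)^[K] (fun m : ℕ =>
      powNeg (-(e : ℂ)) (-(e : ℂ)) (y + n • a + m • b)) = 0 := fun n =>
    fwdDiff_iterate_powNeg_eq_zero (y + n • a) b hK
  have ha0 : ∀ m : ℕ, (fwdDiff 1)^[K] (fun n : ℕ =>
      powNeg (-(e : ℂ)) (-(e : ℂ)) (y + n • a + m • b)) = 0 := fun m => by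
    have := fwdDiff_iterate_powNeg_eq_zero (y + m • b) a hK
    simpa only [add_right_comm y] using this
  have hdiff : ∀ i j, abelDiff K (fun n => abelDiff K (fun m =>
      powNeg (-(e : ℂ)) (-(e : ℂ)) (y + n • a + m • b)) j) i ≠ 0 → i < K ∧ j < K := by
    intro i j hij
    by_contra hcon
    refine hij ?_
    by_cases hj : j < K
    · have hi : K ≤ i := by by_contra h; exact hcon ⟨by omega, hj⟩
      refine abelDiff_eq_zero ?_ hi
      funext n
      simp only [abelDiff, fwdDiff_iterate_comm, ha0, Pi.zero_apply]
      exact fwdDiff_iterate_zero _ _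
    · have h0 : (fun n => abelDiff K (fun m =>
          powNeg (-(e : ℂ)) (-(e : ℂ)) (y + n • a + m • b)) j) = fun _ => 0 :=
        funext fun n => abelDiff_eq_zero (hb0 n) (by omega)
      rw [h0, abelDiff, fwdDiff_iterate_zero]
  rw [tsum_eq_sum (s := Finset.range K ×ˢ Finset.range K)]
  · rw [Finset.sum_product, abelSum_eq_sum_weight]
    refine Finset.sum_congr rfl fun i _ => ?_
    simp only [abelTerm]
    rw [← Finset.mul_sum]
    congr 1
    simp only [abelSum_eq_sum_weight]
    simp only [abelDiff, fwdDiff_iterate_sum_mul]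
  · rintro ⟨i, j⟩ hq
    rw [abelTerm]
    by_cases h0 : abelDiff K (fun n => abelDiff K (fun m =>
      powNeg (-(e : ℂ)) (-(e : ℂ)) (y + n • a + m • b)) j) i = 0
    · rw [h0, mul_zero, mul_zero]
    · exact absurd (hdiff i j h0) (by simpa using hq)

theorem exists_shintani_continuation (hy : 0 < y.1 ∧ 0 < y.2) (ha : 0 < a.1 ∧ 0 < a.2)
    (hb : 0 < b.1 ∧ 0 < b.2) {u v : ℂ} (hu : ‖u‖ = 1) (hv : ‖v‖ = 1) (hu1 : u ≠ 1) (hv1 : v ≠ 1) :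
    ∃ Z : ℂ → ℂ, Differentiable ℂ Z ∧
      (∀ s : ℂ, 1 < s.re → HasSum
        (fun q : ℕ × ℕ => u ^ q.1 * v ^ q.2 * powNeg s s (y + q.1 • a + q.2 • b)) (Z s)) ∧
      ∀ e K : ℕ, 2 * e + 8 ≤ K → Z (-e) = abelSum K u fun n => abelSum K v fun m =>
        powNeg (-(e : ℂ)) (-(e : ℂ)) (y + n • a + m • b) := by
  -- The number of summations by parts has to grow with `‖s‖`; independence of that number lets the
  -- local sums be glued to an entire function.
  set κ : ℂ → ℕ := fun s => ⌈2 * (‖s‖ + 2) + 4⌉₊ with hκ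
  have hκ' : ∀ s, 2 * (‖s‖ + 2) + 4 ≤ κ s := fun s => Nat.le_ceil _
  set Z : ℂ → ℂ := fun s => ∑' q, abelTerm y a b u v (κ s) s q with hZ
  have key : ∀ (R : ℝ) (K : ℕ), 2 ≤ R → 2 * R + 4 ≤ K → ∀ s ∈ Metric.ball (0 : ℂ) R,
      Z s = ∑' q, abelTerm y a b u v K s q := by
    intro R K hR hK s hs
    have hs' := mem_ball_zero_iff.1 hs
    have h0 := norm_nonneg s
    refine tsum_abelTerm_eqOn hy ha hb hu hv hu1 hv1 (R := min R (‖s‖ + 2))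
      (lt_min (by linarith) (by linarith)) ?_ ?_
      (mem_ball_zero_iff.2 (lt_min hs' (by linarith)))
    · exact le_trans (by linarith [min_le_right R (‖s‖ + 2)]) (hκ' s)
    · exact le_trans (by linarith [min_le_left R (‖s‖ + 2)]) hK
  refine ⟨Z, fun s₀ => ?_, fun s hs => ?_, fun e K hK => ?_⟩
  · have h0 := norm_nonneg s₀
    have hmem : s₀ ∈ Metric.ball (0 : ℂ) (‖s₀‖ + 2) := mem_ball_zero_iff.2 (by linarith)
    have hd := (differentiableOn_tsum_abelTerm hy ha hb hu hv (by linarith)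
      (hκ' s₀)).differentiableAt (Metric.isOpen_ball.mem_nhds hmem)
    refine hd.congr_of_eventuallyEq ?_
    filter_upwards [Metric.isOpen_ball.mem_nhds hmem] with s hs
    exact key _ _ (by linarith) (hκ' s₀) s hs
  · obtain ⟨g, hg, hg'⟩ := exists_abelTerm_bound hy ha hb hu hv
      (by positivity : 0 ≤ ‖s‖ + 2) (hκ' s)
    exact hasSum_of_summable_abelTerm hy ha hb hu hv hu1 hv1 hs
      (hg.of_norm_bounded fun q => hg' q s (by linarith))
  · rw [← tsum_abelTerm_neg_natCast y a b u v (by omega)]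
    have hK' : (2 * e + 8 : ℝ) ≤ K := by exact_mod_cast hK
    have he : (0 : ℝ) ≤ e := by positivity
    -- The radius `R = e + 2` contains `-e`, and `2R + 4 = 2e + 8` explains the bound on `K`.
    refine key (e + 2) K (by linarith) (by linarith) _ ?_
    rw [mem_ball_zero_iff]
    simp

end Continuation

/-- The difference has infinite order at `2`, hence at every point of the connected plane; at a
point of analyticity the value is the limit over the punctured neighbourhood. This makes the
interpolated values independent of the chosen continuation. -/
lemma eq_of_meromorphic_of_eqOn {Z Z' : ℂ → ℂ} (hZ : Meromorphic Z) (hZ' : Meromorphic Z')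
    (h : ∀ s : ℂ, 1 < s.re → Z s = Z' s) {m : ℂ} (hm : AnalyticAt ℂ Z m)
    (hm' : AnalyticAt ℂ Z' m) : Z m = Z' m := by
  have hD : MeromorphicOn (Z - Z') Set.univ := fun x _ => (hZ x).sub (hZ' x)
  have h2 : meromorphicOrderAt (Z - Z') 2 = ⊤ := by
    rw [meromorphicOrderAt_eq_top_iff]
    have ho : IsOpen {s : ℂ | 1 < s.re} := isOpen_lt continuous_const Complex.continuous_re
    refine Filter.Eventually.filter_mono nhdsWithin_le_nhds ?_
    filter_upwards [ho.mem_nhds (show (2 : ℂ) ∈ {s : ℂ | 1 < s.re} by simp)] with s hs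
    exact sub_eq_zero.2 (h s hs)
  have hmt : meromorphicOrderAt (Z - Z') m = ⊤ := by
    by_contra hne
    exact hD.meromorphicOrderAt_ne_top_of_isPreconnected isPreconnected_univ (Set.mem_univ m)
      (Set.mem_univ 2) hne h2
  rw [meromorphicOrderAt_eq_top_iff] at hmt
  have hc := ((hm.sub hm').continuousAt.tendsto).mono_left (nhdsWithin_le_nhds (s := {m}ᶜ))
  have h0 : Filter.Tendsto (Z - Z') (nhdsWithin m {m}ᶜ) (nhds 0) :=
    tendsto_const_nhds.congr' (hmt.mono fun _ hx => hx.symm)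
  exact sub_eq_zero.1 (tendsto_nhds_unique hc h0)

/-! ### Abel sums are congruent to finite sums. -/

section Ultrametric

variable {V : Type*} [NormedField V]

lemma abelSum_sub (K : ℕ) (u : V) (f g : ℕ → V) :
    abelSum K u (fun n => f n - g n) = abelSum K u f - abelSum K u g := by
  simp only [abelSum, fwdDiff_iterate_sub, mul_sub, Finset.sum_sub_distrib]

/-- The formal rule `∑ uⁿ g(n) = g(0) + u ∑ uⁿ g(n+1)` survives without convergence: the defining
sum telescopes because the `K`-th difference vanishes. -/
lemma abelSum_succ (K : ℕ) {u : V} (hu : u ≠ 1) {g : ℕ → V} (hg : (fwdDiff 1)^[K] g = 0) :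
    abelSum K u g = g 0 + u * abelSum K u fun n => g (n + 1) := by
  have hu' : 1 - u ≠ 0 := sub_ne_zero.2 hu.symm
  have h1 : (1 - u) * abelSum K u g - u * abelSum K u (fwdDiff 1 g) = g 0 := by
    have h := Finset.sum_range_sub' (fun k => u ^ k / (1 - u) ^ k * (fwdDiff 1)^[k] g 0) K
    rw [hg] at h
    simp only [pow_zero, div_one, one_mul, Pi.zero_apply, mul_zero, sub_zero,
      Function.iterate_zero, id] at h
    rw [← h, abelSum, abelSum, Finset.mul_sum, Finset.mul_sum, ← Finset.sum_sub_distrib]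
    refine Finset.sum_congr rfl fun k _ => ?_
    rw [← Function.iterate_succ_apply, pow_succ, pow_succ]
    field_simp
  have h2 : abelSum K u (fwdDiff 1 g) = abelSum K u (fun n => g (n + 1)) - abelSum K u g :=
    abelSum_sub K u _ _
  rw [h2] at h1
  linear_combination h1

lemma fwdDiff_iterate_shift_eq_zero {K : ℕ} {g : ℕ → V} (hg : (fwdDiff 1)^[K] g = 0) (q : ℕ) :
    (fwdDiff 1)^[K] (fun n => g (n + q)) = 0 := by
  funext n
  have := fwdDiff_iter_comp_add 1 g q K n
  rw [this, hg]
  rfl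

lemma abelSum_eq_sum_add (K : ℕ) {u : V} (hu : u ≠ 1) {g : ℕ → V} (hg : (fwdDiff 1)^[K] g = 0)
    (q : ℕ) :
    abelSum K u g = ∑ n ∈ Finset.range q, u ^ n * g n + u ^ q * abelSum K u fun n => g (n + q) := by
  induction q with
  | zero => simp
  | succ q ih =>
    rw [ih, abelSum_succ K hu (fwdDiff_iterate_shift_eq_zero hg q), Finset.sum_range_succ, zero_add]
    simp only [add_right_comm _ 1 q, add_assoc]
    ring

variable [IsUltrametricDist V]

lemma norm_sub_le_of_le {x y : V} {C : ℝ} (hx : ‖x‖ ≤ C) (hy : ‖y‖ ≤ C) : ‖x - y‖ ≤ C :=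
  sub_eq_add_neg x y ▸ (IsUltrametricDist.norm_add_le_max x (-y)).trans
    (max_le hx ((norm_neg y).symm ▸ hy))

lemma norm_fwdDiff_iterate_le {C : ℝ} {g : ℕ → V} (hg : ∀ n, ‖g n‖ ≤ C) (k n : ℕ) :
    ‖(fwdDiff 1)^[k] g n‖ ≤ C := by
  induction k generalizing n with
  | zero => exact hg n
  | succ k ih =>
    rw [Function.iterate_succ_apply', fwdDiff]
    exact norm_sub_le_of_le (ih _) (ih _)

lemma norm_abelSum_le (K : ℕ) {u : V} (hu : ‖u‖ = 1) (hu1 : ‖1 - u‖ = 1) {C : ℝ} (hC : 0 ≤ C)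
    {g : ℕ → V} (hg : ∀ n, ‖g n‖ ≤ C) : ‖abelSum K u g‖ ≤ C := by
  refine IsUltrametricDist.norm_sum_le_of_forall_le_of_nonneg hC fun k _ => ?_
  simpa [hu, hu1] using norm_fwdDiff_iterate_le hg k 0

/-- After a shift by `q` the factor `u^q = u` reappears, so the error is exactly `u` times the Abel
sum of `g(n+q) - g(n)`. Abel sums do not increase norms, since `‖u‖ = ‖1 - u‖ = 1`. -/
lemma norm_abelSum_sub_sum_le (K : ℕ) {u : V} (hu : ‖u‖ = 1) (hu1 : ‖1 - u‖ = 1) {ε : ℝ}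
    (hε : 0 ≤ ε) {g : ℕ → V} (hg : (fwdDiff 1)^[K] g = 0) {q : ℕ} (hq : u ^ q = u)
    (h : ∀ n, ‖g (n + q) - g n‖ ≤ ε) :
    ‖(1 - u) * abelSum K u g - ∑ n ∈ Finset.range q, u ^ n * g n‖ ≤ ε := by
  have hne : u ≠ 1 := by rintro rfl; simp at hu1
  have h1 := abelSum_eq_sum_add K hne hg q
  have h2 : (1 - u) * abelSum K u g - ∑ n ∈ Finset.range q, u ^ n * g n =
      u * abelSum K u (fun n => g (n + q) - g n) := by
    rw [abelSum_sub]
    rw [hq] at h1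
    linear_combination h1
  rw [h2, norm_mul, hu, one_mul]
  exact norm_abelSum_le K hu hu1 hε h

lemma norm_abelSum_abelSum_sub_sum_le (K : ℕ) {u v : V} (hu : ‖u‖ = 1) (hu1 : ‖1 - u‖ = 1)
    (hv : ‖v‖ = 1) (hv1 : ‖1 - v‖ = 1) {ε : ℝ} (hε : 0 ≤ ε) {G : ℕ → ℕ → V}
    (hG1 : ∀ m, (fwdDiff 1)^[K] (fun n => G n m) = 0) (hG2 : ∀ n, (fwdDiff 1)^[K] (G n) = 0)
    {q : ℕ} (hqu : u ^ q = u) (hqv : v ^ q = v)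
    (h1 : ∀ n m, ‖G (n + q) m - G n m‖ ≤ ε) (h2 : ∀ n m, ‖G n (m + q) - G n m‖ ≤ ε) :
    ‖(1 - u) * (1 - v) * abelSum K u (fun n => abelSum K v (G n)) -
      ∑ n ∈ Finset.range q, ∑ m ∈ Finset.range q, u ^ n * (v ^ m * G n m)‖ ≤ ε := by
  have hz : (fwdDiff 1)^[K] (fun n => abelSum K v (G n)) = 0 := by
    funext n
    simp only [abelSum, fwdDiff_iterate_sum_mul, fwdDiff_iterate_comm, hG1, Pi.zero_apply,
      fwdDiff_iterate_zero]
    simp only [mul_zero, Finset.sum_const_zero]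
  have e1 := norm_abelSum_sub_sum_le K hu hu1 hε hz hqu fun n => by
    rw [← abelSum_sub]
    exact norm_abelSum_le K hv hv1 hε fun m => h1 n m
  have e2 : ‖∑ n ∈ Finset.range q, u ^ n * ((1 - v) * abelSum K v (G n) -
      ∑ m ∈ Finset.range q, v ^ m * G n m)‖ ≤ ε := by
    refine IsUltrametricDist.norm_sum_le_of_forall_le_of_nonneg hε fun n _ => ?_
    rw [norm_mul, norm_pow, hu, one_pow, one_mul]
    exact norm_abelSum_sub_sum_le K hv hv1 hε (hG2 n) hqv (h2 n)
  have e3 : (1 - u) * (1 - v) * abelSum K u (fun n => abelSum K v (G n)) -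
      ∑ n ∈ Finset.range q, ∑ m ∈ Finset.range q, u ^ n * (v ^ m * G n m) =
      (1 - v) * ((1 - u) * abelSum K u (fun n => abelSum K v (G n)) -
        ∑ n ∈ Finset.range q, u ^ n * abelSum K v (G n)) +
      ∑ n ∈ Finset.range q, u ^ n * ((1 - v) * abelSum K v (G n) -
      ∑ m ∈ Finset.range q, v ^ m * G n m) := by
    simp only [mul_sub, Finset.sum_sub_distrib, ← Finset.mul_sum]
    have : ∑ n ∈ Finset.range q, u ^ n * ((1 - v) * abelSum K v (G n)) =
        (1 - v) * ∑ n ∈ Finset.range q, u ^ n * abelSum K v (G n) := by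
      rw [Finset.mul_sum]
      exact Finset.sum_congr rfl fun _ _ => by ring
    rw [this]
    ring
  rw [e3]
  refine (IsUltrametricDist.norm_add_le_max _ _).trans (max_le ?_ e2)
  rwa [norm_mul, hv1, one_mul]

end Ultrametric

/-! ### Mahler expansion of the inverse on `p`-adic units. -/

section Mahler

variable (p : ℕ) [hp : Fact p.Prime]

/-- The inclusion of `ℤ_p` into `ℂ_p`. -/
noncomputable def ofPadicInt : ℤ_[p] →+* ℂ_[p] :=
  (algebraMap ℚ_[p] ℂ_[p]).comp PadicInt.Coe.ringHom

@[simp] lemma norm_ofPadicInt (x : ℤ_[p]) : ‖ofPadicInt p x‖ = ‖x‖ := by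
  rw [ofPadicInt, RingHom.comp_apply, norm_algebraMap']
  rfl

lemma norm_ofPadicInt_le_one (x : ℤ_[p]) : ‖ofPadicInt p x‖ ≤ 1 := by
  rw [norm_ofPadicInt]
  exact x.norm_le_one

lemma continuous_ofPadicInt : Continuous (ofPadicInt p) :=
  (AddMonoidHomClass.isometry_of_norm (ofPadicInt p) (norm_ofPadicInt p)).continuous

/-- The function on `ℤ_p` which is `y ↦ -1/y` on the units and vanishes elsewhere. -/
noncomputable def negInvUnit (y : ℤ_[p]) : ℂ_[p] :=
  open Classical in if ‖y‖ = 1 then -(ofPadicInt p y)⁻¹ else 0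

/-- The coefficients of `y ↦ negInvUnit (y + 1)` in the Mahler basis. -/
noncomputable def mahlerCoeff (i : ℕ) : ℂ_[p] := c p (i + 1) / (p * (i + 1))

lemma natCast_ne_zero_padicComplex : (p : ℂ_[p]) ≠ 0 := Nat.cast_ne_zero.2 hp.out.ne_zero

lemma sum_nthRoots_pow (N : ℕ) :
    ∑ ζ ∈ Polynomial.nthRootsFinset p (1 : ℂ_[p]), ζ ^ N = if p ∣ N then (p : ℂ_[p]) else 0 := by
  have : NeZero (p : ℂ_[p]) := ⟨natCast_ne_zero_padicComplex p⟩
  obtain ⟨ζ₀, h₀⟩ := HasEnoughRootsOfUnity.exists_primitiveRoot ℂ_[p] p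
  have hp0 := hp.out.pos
  have hmem : ∀ ζ : ℂ_[p], ζ ∈ Polynomial.nthRootsFinset p (1 : ℂ_[p]) ↔ ζ ^ p = 1 := fun ζ =>
    Polynomial.mem_nthRootsFinset hp0 1
  split_ifs with h
  · obtain ⟨k, rfl⟩ := h
    rw [Finset.sum_congr rfl (g := fun _ => 1) fun ζ hζ => by
      rw [pow_mul, (hmem ζ).1 hζ, one_pow]]
    rw [Finset.sum_const, h₀.card_nthRootsFinset, nsmul_eq_mul, mul_one]
  · have hne : ζ₀ ^ N ≠ 1 := fun h1 => h (h₀.dvd_of_pow_eq_one N h1)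
    have hz0 : ζ₀ ≠ 0 := h₀.ne_zero hp0.ne'
    have hsum : ∑ ζ ∈ Polynomial.nthRootsFinset p (1 : ℂ_[p]), (ζ₀ * ζ) ^ N =
        ∑ ζ ∈ Polynomial.nthRootsFinset p (1 : ℂ_[p]), ζ ^ N := by
      refine Finset.sum_nbij' (fun ζ => ζ₀ * ζ) (fun ζ => ζ₀⁻¹ * ζ) ?_ ?_ ?_ ?_ ?_
      · intro ζ hζ
        rw [hmem] at hζ ⊢
        rw [mul_pow, hζ, h₀.pow_eq_one, one_mul]
      · intro ζ hζ
        rw [hmem] at hζ ⊢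
        rw [mul_pow, hζ, inv_pow, h₀.pow_eq_one, inv_one, one_mul]
      · intro ζ _
        field_simp
      · intro ζ _
        field_simp
      · intro ζ _
        rfl
    simp only [mul_pow, ← Finset.mul_sum] at hsum
    have : (ζ₀ ^ N - 1) * ∑ ζ ∈ Polynomial.nthRootsFinset p (1 : ℂ_[p]), ζ ^ N = 0 := by
      linear_combination hsum
    exact (mul_eq_zero.1 this).resolve_left (sub_ne_zero.2 hne)

/-- Expand `ζ^(n+1) = ((ζ - 1) + 1)^(n+1)`, remove the constant term and sum over the `p`-th roots
of unity. -/
lemma sum_choose_mul_c (n : ℕ) :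
    ∑ i ∈ Finset.range (n + 1), ((n + 1).choose (i + 1) : ℂ_[p]) * c p (i + 1) =
      (if p ∣ n + 1 then (p : ℂ_[p]) else 0) - p := by
  have h0 : ∑ ζ ∈ Polynomial.nthRootsFinset p (1 : ℂ_[p]), (1 : ℂ_[p]) = p := by
    simpa using sum_nthRoots_pow p 0
  rw [← sum_nthRoots_pow]
  conv_rhs => rw [← h0]
  rw [← Finset.sum_sub_distrib]
  simp only [c, Finset.mul_sum]
  rw [Finset.sum_comm]
  refine Finset.sum_congr rfl fun ζ _ => ?_
  have h := add_pow (ζ - 1) 1 (n + 1)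
  rw [sub_add_cancel, Finset.sum_range_succ'] at h
  rw [h]
  simp [mul_comm]

/-- Since `(n+1) C(n,i) = (i+1) C(n+1,i+1)`, the right side is `(p·[p ∣ n+1] - p) / (p(n+1))`. This
vanishes when `p ∣ n+1` and is `-1/(n+1)` otherwise, whence the sign in `negInvUnit`. -/
lemma negInvUnit_natCast_add_one (n : ℕ) :
    negInvUnit p (n + 1) = ∑ i ∈ Finset.range (n + 1), mahlerCoeff p i * (n.choose i : ℂ_[p]) := by
  have hp0 := natCast_ne_zero_padicComplex p
  have hn : ((n : ℂ_[p]) + 1) ≠ 0 := by exact_mod_cast Nat.succ_ne_zero n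
  have h1 : ∀ i ∈ Finset.range (n + 1), mahlerCoeff p i * (n.choose i : ℂ_[p]) =
      (p * (n + 1) : ℂ_[p])⁻¹ * (((n + 1).choose (i + 1) : ℂ_[p]) * c p (i + 1)) := by
    intro i _
    have hi : ((i : ℂ_[p]) + 1) ≠ 0 := by exact_mod_cast Nat.succ_ne_zero i
    have h2 : ((n : ℂ_[p]) + 1) * n.choose i = (n + 1).choose (i + 1) * (i + 1) := by
      exact_mod_cast congrArg (Nat.cast (R := ℂ_[p])) (Nat.add_one_mul_choose_eq n i)
    rw [mahlerCoeff]
    field_simp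
    linear_combination (c p (i + 1)) * h2
  rw [Finset.sum_congr rfl h1, ← Finset.mul_sum, sum_choose_mul_c, negInvUnit]
  have h3 : ‖((n : ℤ_[p]) + 1)‖ = 1 ↔ ¬p ∣ n + 1 := by
    rw [← Nat.cast_add_one, PadicInt.norm_natCast_eq_one_iff, hp.out.coprime_iff_not_dvd]
  by_cases h : p ∣ n + 1
  · simp [h3, h]
  · simp only [h3, h, not_false_eq_true, if_true, if_false, map_add, map_natCast, map_one]
    field_simp
    ring

lemma negInvUnit_natCast_add_one' {n L : ℕ} (hL : n < L) :
    negInvUnit p (n + 1) = ∑ i ∈ Finset.range L, mahlerCoeff p i * (n.choose i : ℂ_[p]) := by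
  rw [negInvUnit_natCast_add_one]
  refine Finset.sum_subset (Finset.range_mono hL) fun i _ hi => ?_
  rw [Nat.choose_eq_zero_of_lt (by simpa using hi)]
  simp

lemma norm_negInvUnit_le (y : ℤ_[p]) : ‖negInvUnit p y‖ ≤ 1 := by
  rw [negInvUnit]
  split_ifs with h
  · simp [h]
  · simp

lemma norm_natCast_le_one_padicComplex (n : ℕ) : ‖(n : ℂ_[p])‖ ≤ 1 := by
  rw [← map_natCast (ofPadicInt p)]
  exact norm_ofPadicInt_le_one p _

/-- The expansion at `n` is triangular with leading coefficient `1`, so integrality of the values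
passes to the coefficients by induction. -/
lemma norm_mahlerCoeff_le_one (i : ℕ) : ‖mahlerCoeff p i‖ ≤ 1 := by
  induction i using Nat.strong_induction_on with
  | _ n ih =>
    have h := negInvUnit_natCast_add_one p n
    rw [Finset.sum_range_succ, Nat.choose_self, Nat.cast_one, mul_one] at h
    rw [← sub_eq_iff_eq_add'] at h
    rw [← h]
    refine norm_sub_le_of_le (norm_negInvUnit_le p _) ?_
    refine IsUltrametricDist.norm_sum_le_of_forall_le_of_nonneg zero_le_one fun i hi => ?_
    rw [norm_mul]
    exact mul_le_one₀ (ih i (Finset.mem_range.1 hi)) (norm_nonneg _)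
      (norm_natCast_le_one_padicComplex p _)

lemma norm_p_padicComplex : ‖(p : ℂ_[p])‖ = (p : ℝ)⁻¹ := by
  rw [← map_natCast (algebraMap ℚ_[p] ℂ_[p]), norm_algebraMap', Padic.norm_p]

lemma add_one_pow_eq {R : Type*} [CommRing R] (x : R) {N : ℕ} (hN : 0 < N) :
    (x + 1) ^ N = x ^ N + ∑ k ∈ Finset.range (N - 1), x ^ (k + 1) * (N.choose (k + 1) : R) + 1 := by
  obtain ⟨q, rfl⟩ : ∃ q, N = q + 1 := ⟨N - 1, by omega⟩
  rw [add_pow, Finset.sum_range_succ, Finset.sum_range_succ', Nat.add_sub_cancel]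
  simp
  ring

/-- For `π = ζ - 1` the equation `(π + 1)^p = 1` expresses `π^p` by terms divisible by `pπ`, so
`‖π‖^(p-1) ≤ 1/p`. -/
lemma norm_root_sub_one_le {ζ : ℂ_[p]} (hζ : ζ ^ p = 1) :
    ‖ζ - 1‖ ≤ (p : ℝ) ^ (-(1 / ((p : ℝ) - 1))) := by
  have hp1 : (1 : ℝ) < p := by exact_mod_cast hp.out.one_lt
  have hn : ‖ζ‖ = 1 := by
    have : ‖ζ‖ ^ p = 1 := by rw [← norm_pow, hζ, norm_one]
    exact (pow_eq_one_iff_of_nonneg (norm_nonneg _) hp.out.ne_zero).1 this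
  set π := ζ - 1 with hπ
  have hπ1 : ‖π‖ ≤ 1 := norm_sub_le_of_le hn.le norm_one.le
  rcases eq_or_ne π 0 with h0 | h0
  · rw [h0, norm_zero]; positivity
  have hpos : 0 < ‖π‖ := norm_pos_iff.2 h0
  have h := add_one_pow_eq π hp.out.pos
  have hsum : ‖∑ k ∈ Finset.range (p - 1), π ^ (k + 1) * (p.choose (k + 1) : ℂ_[p])‖ ≤
      (p : ℝ)⁻¹ * ‖π‖ := by
    refine IsUltrametricDist.norm_sum_le_of_forall_le_of_nonneg (by positivity) fun k hk => ?_
    have hk := Finset.mem_range.1 hk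
    obtain ⟨d, hd⟩ := hp.out.dvd_choose_self (k := k + 1) (by omega) (by omega)
    rw [hd, Nat.cast_mul, norm_mul, norm_mul, norm_p_padicComplex, pow_succ, norm_mul, norm_pow]
    have h1 : ‖π‖ ^ k ≤ 1 := pow_le_one₀ (norm_nonneg _) hπ1
    have h2 := norm_natCast_le_one_padicComplex p d
    calc ‖π‖ ^ k * ‖π‖ * ((p : ℝ)⁻¹ * ‖(d : ℂ_[p])‖) ≤ 1 * ‖π‖ * ((p : ℝ)⁻¹ * 1) := by gcongr
      _ = _ := by ring
  have hpow : ‖π‖ ^ (p - 1) ≤ (p : ℝ)⁻¹ := by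
    have e : π ^ p = -∑ k ∈ Finset.range (p - 1), π ^ (k + 1) * (p.choose (k + 1) : ℂ_[p]) := by
      rw [hπ, sub_add_cancel, hζ, ← hπ] at h
      linear_combination -h
    have h' := congrArg norm e
    rw [norm_neg] at h'
    rw [← h', norm_pow, ← mul_pow_sub_one hp.out.ne_zero, mul_comm] at hsum
    exact le_of_mul_le_mul_right hsum hpos
  have hp1' : ((p - 1 : ℕ) : ℝ) = (p : ℝ) - 1 := by
    rw [Nat.cast_sub hp.out.one_lt.le, Nat.cast_one]
  have hpp : (0 : ℝ) < (p : ℝ) - 1 := by linarith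
  calc ‖π‖ = (‖π‖ ^ (p - 1)) ^ (1 / ((p : ℝ) - 1)) := by
        rw [← Real.rpow_natCast, ← Real.rpow_mul (norm_nonneg _), hp1']
        rw [mul_one_div_cancel hpp.ne', Real.rpow_one]
    _ ≤ ((p : ℝ)⁻¹) ^ (1 / ((p : ℝ) - 1)) := by gcongr
    _ = _ := by rw [Real.inv_rpow (by positivity), Real.rpow_neg (by positivity)]

lemma norm_c_le (n : ℕ) : ‖c p n‖ ≤ (p : ℝ) ^ (-(n / ((p : ℝ) - 1))) := by
  refine IsUltrametricDist.norm_sum_le_of_forall_le_of_nonneg (by positivity) fun ζ hζ => ?_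
  rw [norm_pow]
  calc ‖ζ - 1‖ ^ n ≤ ((p : ℝ) ^ (-(1 / ((p : ℝ) - 1)))) ^ n := by
        gcongr
        exact norm_root_sub_one_le p ((Polynomial.mem_nthRootsFinset hp.out.pos 1).1 hζ)
    _ = _ := by
        rw [← Real.rpow_natCast, ← Real.rpow_mul (by positivity)]
        congr 1
        ring

lemma inv_le_norm_natCast {n : ℕ} (hn : n ≠ 0) : (n : ℝ)⁻¹ ≤ ‖(n : ℂ_[p])‖ := by
  rw [← map_natCast (algebraMap ℚ_[p] ℂ_[p]), norm_algebraMap', Padic.norm_eq_zpow_neg_valuation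
    (Nat.cast_ne_zero.2 hn), Padic.valuation_natCast, zpow_neg, zpow_natCast]
  have hp0 : (0 : ℝ) < p := by exact_mod_cast hp.out.pos
  gcongr
  exact_mod_cast Nat.le_of_dvd (Nat.pos_of_ne_zero hn) pow_padicValNat_dvd

lemma norm_mahlerCoeff_le (i : ℕ) :
    ‖mahlerCoeff p i‖ ≤ (p : ℝ) ^ (1 - (i + 1) / ((p : ℝ) - 1)) * (i + 1) := by
  have hp0 : (0 : ℝ) < p := by exact_mod_cast hp.out.pos
  rw [mahlerCoeff, norm_div, norm_mul, norm_p_padicComplex, Real.rpow_sub hp0, Real.rpow_one,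
    div_eq_mul_inv, mul_inv, inv_inv]
  have h1 := norm_c_le p (i + 1)
  have h2 := inv_le_norm_natCast p (Nat.succ_ne_zero i)
  push_cast [Nat.succ_eq_add_one] at h1 h2
  have h3 : ‖(i : ℂ_[p]) + 1‖⁻¹ ≤ i + 1 := inv_le_of_inv_le₀ (by positivity) h2
  rw [Real.rpow_neg hp0.le] at h1
  calc ‖c p (i + 1)‖ * (p * ‖(i : ℂ_[p]) + 1‖⁻¹) ≤
        ((p : ℝ) ^ ((i + 1) / ((p : ℝ) - 1)))⁻¹ * (p * (i + 1)) := by gcongr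
    _ = _ := by ring

/-- The lower bound on `M` is where the derivative `1/(p-1) - 2/((x+2) log p)` stops being negative.
The proof replaces the derivative by `log r ≤ r - 1`. -/
lemma errorFn_mono {M x : ℝ} (hM : 2 * ((p : ℝ) - 1) / Real.log p - 2 ≤ M) (hx : M ≤ x) :
    errorFn p M ≤ errorFn p x := by
  have hp1 : (1 : ℝ) < p := by exact_mod_cast hp.out.one_lt
  have hlog : 0 < Real.log p := Real.log_pos hp1
  have hpp : 0 < (p : ℝ) - 1 := by linarith
  set t₀ := M / 2 + 1 with ht₀
  set t := x / 2 + 1 with ht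
  have h1 : ((p : ℝ) - 1) / Real.log p ≤ t₀ := by
    rw [ht₀]
    have : 2 * ((p : ℝ) - 1) / Real.log p = 2 * (((p : ℝ) - 1) / Real.log p) := by ring
    linarith
  have h0 : 0 < t₀ := lt_of_lt_of_le (div_pos hpp hlog) h1
  have htt : t₀ ≤ t := by rw [ht₀, ht]; linarith
  have h2 : Real.log t - Real.log t₀ ≤ (t - t₀) / t₀ := by
    rw [← Real.log_div (by linarith) h0.ne']
    refine (Real.log_le_sub_one_of_pos (div_pos (by linarith) h0)).trans (le_of_eq ?_)
    field_simp
  have h3 : (t - t₀) / t₀ ≤ (t - t₀) * (Real.log p / ((p : ℝ) - 1)) := by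
    rw [div_eq_mul_inv]
    refine mul_le_mul_of_nonneg_left ?_ (by linarith)
    refine inv_le_of_inv_le₀ (by positivity) ?_
    rwa [inv_div]
  have h4 : 2 / Real.log p * (Real.log t - Real.log t₀) ≤ 2 * (t - t₀) / ((p : ℝ) - 1) := by
    calc _ ≤ 2 / Real.log p * ((t - t₀) * (Real.log p / ((p : ℝ) - 1))) := by
          gcongr
          exact h2.trans h3
      _ = _ := by field_simp
  rw [errorFn, errorFn, ← ht₀, ← ht, show M + 2 = 2 * t₀ by rw [ht₀]; ring,
    show x + 2 = 2 * t by rw [ht]; ring]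
  have h5 : 2 * (t - t₀) / ((p : ℝ) - 1) = 2 * t / ((p : ℝ) - 1) - 2 * t₀ / ((p : ℝ) - 1) := by ring
  linarith

/-- The function `f_p` comes from here: after multiplying the two individual bounds, `(i+1)(l+1) ≤
((i+l)/2 + 1)²` leaves a bound depending on `i + l` alone. -/
lemma norm_mahlerCoeff_mul_le (i l : ℕ) :
    ‖mahlerCoeff p i * mahlerCoeff p l‖ ≤ (p : ℝ) ^ (-errorFn p ((i : ℝ) + l)) := by
  have hp1 : (1 : ℝ) < p := by exact_mod_cast hp.out.one_lt
  have hp0 : (0 : ℝ) < p := by linarith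
  have hlog : 0 < Real.log p := Real.log_pos hp1
  have hpp : (p : ℝ) - 1 ≠ 0 := by linarith
  set t : ℝ := ((i : ℝ) + l) / 2 + 1 with ht
  have ht0 : 0 < t := by positivity
  have h1 : (p : ℝ) ^ (2 / Real.log p * Real.log t) = t ^ 2 := by
    rw [Real.rpow_def_of_pos hp0, ← Real.exp_log (pow_pos ht0 2), Real.log_pow]
    congr 1
    push_cast
    field_simp
  have h2 : (p : ℝ) ^ (-errorFn p ((i : ℝ) + l)) =
      (p : ℝ) ^ (1 - ((i : ℝ) + 1) / ((p : ℝ) - 1)) * (p : ℝ) ^ (1 - ((l : ℝ) + 1) / ((p : ℝ) - 1))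
        * t ^ 2 := by
    rw [← h1, ← Real.rpow_add hp0, ← Real.rpow_add hp0, errorFn, ← ht]
    congr 1
    field_simp
    ring
  rw [norm_mul, h2]
  refine (mul_le_mul (norm_mahlerCoeff_le p i) (norm_mahlerCoeff_le p l) (norm_nonneg _)
    (by positivity)).trans ?_
  rw [mul_mul_mul_comm]
  refine mul_le_mul_of_nonneg_left ?_ (by positivity)
  rw [ht]
  nlinarith [sq_nonneg ((i : ℝ) - l)]

/-- The finite set of pairs `(i, l)` with `i + l < M`. -/
noncomputable def pairsBelow (M : ℝ) : Finset (ℕ × ℕ) :=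
  open Classical in
  {q ∈ Finset.range ⌈M⌉₊ ×ˢ Finset.range ⌈M⌉₊ | (q.1 : ℝ) + (q.2 : ℝ) < M}

lemma mem_pairsBelow {M : ℝ} {q : ℕ × ℕ} : q ∈ pairsBelow M ↔ (q.1 : ℝ) + (q.2 : ℝ) < M := by
  rw [pairsBelow, Finset.mem_filter, Finset.mem_product, Finset.mem_range, Finset.mem_range]
  refine ⟨fun h => h.2, fun h => ⟨⟨?_, ?_⟩, h⟩⟩
  · exact Nat.lt_ceil.2 (lt_of_le_of_lt (by simp) h)
  · exact Nat.lt_ceil.2 (lt_of_le_of_lt (by simp) h)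

lemma continuous_negInvUnit : Continuous (negInvUnit p) := by
  classical
  have hcl : IsClopen {y : ℤ_[p] | ‖y‖ = 1} := by
    have h := (IsUltrametricDist.isClopen_ball (0 : ℤ_[p]) 1).compl
    convert h using 1
    ext y
    simp only [Set.mem_ofPred_eq, Set.mem_compl_iff, mem_ball_zero_iff, not_lt]
    exact ⟨fun h => h.ge, fun h => le_antisymm y.norm_le_one h⟩
  unfold negInvUnit
  refine continuous_if (p := fun y : ℤ_[p] => ‖y‖ = 1) (by rw [hcl.frontier_eq]; simp) ?_
    continuousOn_const
  rw [hcl.isClosed.closure_eq]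
  refine ((continuous_ofPadicInt p).continuousOn.inv₀ fun y hy h => ?_).neg
  have := norm_ofPadicInt p y
  rw [h, norm_zero, show ‖y‖ = 1 from hy] at this
  exact zero_ne_one this

/-- By continuity it suffices to treat natural numbers, where the Mahler expansions are finite and
the error is a finite sum of terms with `i + l ≥ M`. -/
lemma norm_negInvUnit_mul_sub_le {M : ℝ} (hM : 2 * ((p : ℝ) - 1) / Real.log p - 2 ≤ M)
    (x₁ x₂ : ℤ_[p]) :
    ‖negInvUnit p (x₁ + 1) * negInvUnit p (x₂ + 1) - ∑ q ∈ pairsBelow M,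
      mahlerCoeff p q.1 * mahlerCoeff p q.2 *
        (ofPadicInt p (Ring.choose x₁ q.1) * ofPadicInt p (Ring.choose x₂ q.2))‖ ≤
      (p : ℝ) ^ (-errorFn p M) := by
  have hp1 : (1 : ℝ) ≤ p := by exact_mod_cast hp.out.one_lt.le
  have hcont : ∀ i, Continuous fun x : ℤ_[p] => ofPadicInt p (Ring.choose x i) := fun i =>
    (continuous_ofPadicInt p).comp (PadicInt.continuous_choose i)
  have hneg := continuous_negInvUnit p
  refine PadicInt.denseRange_natCast.induction_on₂ (p := fun x₁ x₂ : ℤ_[p] =>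
    ‖negInvUnit p (x₁ + 1) * negInvUnit p (x₂ + 1) - ∑ q ∈ pairsBelow M,
      mahlerCoeff p q.1 * mahlerCoeff p q.2 *
        (ofPadicInt p (Ring.choose x₁ q.1) * ofPadicInt p (Ring.choose x₂ q.2))‖ ≤
      (p : ℝ) ^ (-errorFn p M)) ?_ ?_ x₁ x₂
  · refine isClosed_le (Continuous.norm (Continuous.sub ?_ ?_)) continuous_const
    · fun_prop
    · refine continuous_finsetSum _ fun q _ => continuous_const.mul ?_
      exact ((hcont q.1).comp continuous_fst).mul ((hcont q.2).comp continuous_snd)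
  · intro n₁ n₂
    -- Beyond `n₁` and `n₂` the expansions are exact, and beyond `⌈M⌉₊` the square contains all
    -- pairs with `i + l < M`.
    set L := n₁ + n₂ + ⌈M⌉₊ + 1 with hL
    rw [negInvUnit_natCast_add_one' p (show n₁ < L by omega),
      negInvUnit_natCast_add_one' p (show n₂ < L by omega), Finset.sum_mul_sum,
      ← Finset.sum_product']
    simp only [Ring.choose_natCast, map_natCast]
    have hsub : pairsBelow M ⊆ Finset.range L ×ˢ Finset.range L := by
      intro q hq
      rw [pairsBelow, Finset.mem_filter, Finset.mem_product, Finset.mem_range,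
        Finset.mem_range] at hq
      rw [Finset.mem_product, Finset.mem_range, Finset.mem_range]
      omega
    rw [← Finset.sum_sdiff hsub, add_sub_assoc, ← Finset.sum_sub_distrib]
    rw [Finset.sum_eq_zero (s := pairsBelow M) fun q _ => by ring, add_zero]
    refine IsUltrametricDist.norm_sum_le_of_forall_le_of_nonneg (by positivity) fun q hq => ?_
    have hq' : M ≤ (q.1 : ℝ) + q.2 := by
      by_contra hlt
      exact (Finset.mem_sdiff.1 hq).2 (mem_pairsBelow.2 (not_le.1 hlt))
    rw [mul_mul_mul_comm, norm_mul]
    calc _ ≤ (p : ℝ) ^ (-errorFn p ((q.1 : ℝ) + q.2)) * 1 := by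
          refine mul_le_mul (norm_mahlerCoeff_mul_le p _ _) ?_ (norm_nonneg _) (by positivity)
          rw [norm_mul]
          exact mul_le_one₀ (norm_natCast_le_one_padicComplex p _) (norm_nonneg _)
            (norm_natCast_le_one_padicComplex p _)
      _ ≤ _ := by
          rw [mul_one]
          exact Real.rpow_le_rpow_of_exponent_le hp1 (neg_le_neg (errorFn_mono p hM hq'))

end Mahler

/-! ### Roots of unity in `ℚ_p` and Fermat congruences. -/

section RootsOfUnity

variable {p : ℕ} [hp : Fact p.Prime]

lemma exists_hensel_root (F : Polynomial ℤ_[p]) (a : ℤ_[p]) (h : ‖F.eval a‖ < 1)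
    (h' : ‖F.derivative.eval a‖ = 1) : ∃ z : ℤ_[p], F.eval z = 0 ∧ ‖z - a‖ < 1 := by
  obtain ⟨z, hz, hza, -⟩ := hensels_lemma (F := F) (a := a) (by
    rw [Polynomial.coe_aeval_eq_eval, h', one_pow]; exact h)
  rw [Polynomial.coe_aeval_eq_eval] at hz hza
  exact ⟨z, hz, h' ▸ hza⟩

lemma dvd_pow_sub_one_sub_one {y : ℤ_[p]} (hy : ‖y‖ = 1) : (p : ℤ_[p]) ∣ y ^ (p - 1) - 1 := by
  rw [← PadicInt.norm_lt_one_iff_dvd, ← PadicInt.mem_nonunits, ← IsLocalRing.mem_maximalIdeal,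
    ← PadicInt.ker_toZMod, RingHom.mem_ker, map_sub, map_pow, map_one,
    ZMod.pow_card_sub_one_eq_one, sub_self]
  intro h0
  rw [← RingHom.mem_ker, PadicInt.ker_toZMod, IsLocalRing.mem_maximalIdeal, PadicInt.mem_nonunits,
    hy] at h0
  exact lt_irrefl _ h0

/-- The congruence `y^(p-1) ≡ 1` modulo `p` gains a factor `p` with each further `p`-th power. -/
lemma norm_pow_sub_one_le {y : ℤ_[p]} (hy : ‖y‖ = 1) {t d : ℕ} (hd : (p - 1) * p ^ t ∣ d) :
    ‖y ^ d - 1‖ ≤ (p : ℝ) ^ (-(t : ℤ)) := by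
  have h1 : (p : ℤ_[p]) ^ (t + 1) ∣ y ^ d - 1 := by
    obtain ⟨k, rfl⟩ := hd
    have h := dvd_sub_pow_of_dvd_sub (dvd_pow_sub_one_sub_one hy) t
    rw [one_pow] at h
    refine h.trans ?_
    rw [pow_mul, pow_mul]
    exact sub_one_dvd_pow_sub_one _ _
  rw [PadicInt.norm_le_pow_iff_mem_span_pow, Ideal.mem_span_singleton]
  exact (pow_dvd_pow _ t.le_succ).trans h1

/-- Lifting the exponent for odd `p`: raising to the power `pᵃm` with `p ∤ m` adds only `a` to the
valuation of `w - 1`, so an infinite valuation must have been infinite already. -/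
lemma eq_one_of_pow_eq_one_of_dvd (hodd : Odd p) {w : ℤ_[p]} (hw : (p : ℤ_[p]) ∣ w - 1) {n : ℕ}
    (hn : n ≠ 0) (h : w ^ n = 1) : w = 1 := by
  have hprime : Prime (p : ℤ_[p]) := PadicInt.prime_p
  have htop : ∀ x : ℤ_[p], emultiplicity (p : ℤ_[p]) (x - 1) = ⊤ → x = 1 := fun x hx => by
    by_contra hne
    exact (emultiplicity_eq_top.1 hx) (FiniteMultiplicity.of_prime_left hprime (sub_ne_zero.2 hne))
  have hnd : ∀ x : ℤ_[p], (p : ℤ_[p]) ∣ x - 1 → ¬ (p : ℤ_[p]) ∣ x := fun x hx hx' =>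
    hprime.not_isUnit (isUnit_of_dvd_one ((dvd_sub_right hx').1 hx))
  obtain ⟨a, m, hm, rfl⟩ := Nat.exists_eq_pow_mul_and_not_dvd hn p hp.out.ne_one
  have hw' : (p : ℤ_[p]) ∣ w ^ p ^ a - 1 := hw.trans (sub_one_dvd_pow_sub_one _ _)
  have hm' : ¬ (p : ℤ_[p]) ∣ (m : ℤ_[p]) := by
    rw [← PadicInt.norm_lt_one_iff_dvd, PadicInt.norm_natCast_lt_one_iff]
    exact hm
  have h1 : w ^ p ^ a = 1 := by
    apply htop
    rw [← emultiplicity_pow_sub_pow_of_prime hprime (y := 1) hw' (hnd _ hw') hm', ← pow_mul, h,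
      one_pow, sub_self, emultiplicity_zero]
  apply htop
  have h2 := emultiplicity_pow_prime_pow_sub_pow_prime_pow hprime hodd hw (hnd _ hw) a
  rw [h1, one_pow, sub_self, emultiplicity_zero] at h2
  by_contra hne
  obtain ⟨r, hr⟩ := ENat.ne_top_iff_exists.1 hne
  rw [← hr] at h2
  exact absurd h2.symm (by exact_mod_cast ENat.natCast_ne_top (r + a))

lemma torsion_eq_rootsOfUnity (hodd : Odd p) :
    CommGroup.torsion ℚ_[p]ˣ = rootsOfUnity (p - 1) ℚ_[p] := by
  have hp1 : 0 < p - 1 := by have := hp.out.two_le; omega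
  ext ζ
  rw [CommGroup.mem_torsion, isOfFinOrder_iff_pow_eq_one, mem_rootsOfUnity]
  refine ⟨fun ⟨n, hn, h⟩ => ?_, fun h => ⟨p - 1, hp1, h⟩⟩
  have h' : (ζ : ℚ_[p]) ^ n = 1 := by rw [← Units.val_pow_eq_pow_val, h, Units.val_one]
  have hnorm : ‖(ζ : ℚ_[p])‖ = 1 := by
    refine (pow_eq_one_iff_of_nonneg (norm_nonneg _) hn.ne').1 ?_
    rw [← norm_pow, h', norm_one]
  set z : ℤ_[p] := ⟨ζ, hnorm.le⟩ with hz
  have hz1 : ‖z‖ = 1 := hnorm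
  have hzn : z ^ n = 1 := Subtype.ext h'
  have h1 : z ^ (p - 1) = 1 := eq_one_of_pow_eq_one_of_dvd hodd (dvd_pow_sub_one_sub_one hz1) hn.ne'
    (by rw [← pow_mul, mul_comm, pow_mul, hzn, one_pow])
  ext
  rw [Units.val_pow_eq_pow_val, Units.val_one]
  exact congrArg Subtype.val h1

lemma exists_teichmuller (a : ℕ) (ha : ¬ p ∣ a) :
    ∃ z : ℤ_[p], z ^ (p - 1) = 1 ∧ ‖z - a‖ < 1 := by
  have ha1 : ‖(a : ℤ_[p])‖ = 1 := by
    rwa [PadicInt.norm_natCast_eq_one_iff, hp.out.coprime_iff_not_dvd]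
  obtain ⟨z, hz, hza⟩ := exists_hensel_root (Polynomial.X ^ (p - 1) - 1) (a : ℤ_[p])
    (by
      rw [Polynomial.eval_sub, Polynomial.eval_pow, Polynomial.eval_X, Polynomial.eval_one,
        PadicInt.norm_lt_one_iff_dvd]
      exact dvd_pow_sub_one_sub_one ha1)
    (by
      rw [Polynomial.derivative_sub, Polynomial.derivative_one, sub_zero,
        Polynomial.derivative_X_pow, Polynomial.eval_mul, Polynomial.eval_pow, Polynomial.eval_X,
        Polynomial.eval_C, norm_mul, norm_pow, ha1, one_pow, mul_one]
      rw [PadicInt.norm_natCast_p_sub_one])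
  refine ⟨z, ?_, hza⟩
  simpa [sub_eq_zero] using hz

/-- The Teichmüller lifts of `1, …, p - 1` are distinct modulo `p`, and a field has at most `p - 1`
roots of `X^(p-1) - 1`. -/
lemma rootNumber_eq (hodd : Odd p) : rootNumber p = p - 1 := by
  have hp1 : p - 1 ≠ 0 := by have := hp.out.two_le; omega
  have : NeZero (p - 1) := ⟨hp1⟩
  rw [rootNumber, torsion_eq_rootsOfUnity hodd]
  refine le_antisymm (card_rootsOfUnity _ _) ?_
  have hdvd : ∀ a : Fin (p - 1), ¬ p ∣ (a : ℕ) + 1 := fun a h => by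
    have := Nat.le_of_dvd (Nat.succ_pos _) h
    have := a.2
    omega
  choose z hz hza using fun a : Fin (p - 1) => exists_teichmuller (p := p) (a + 1) (hdvd a)
  have hzq : ∀ a, ((z a : ℤ_[p]) : ℚ_[p]) ^ (p - 1) = 1 := fun a => by
    rw [← PadicInt.coe_pow, hz, PadicInt.coe_one]
  set g : Fin (p - 1) → rootsOfUnity (p - 1) ℚ_[p] := fun a => rootsOfUnity.mkOfPowEq _ (hzq a)
  have hg : Function.Injective g := by
    intro a b hab
    have h1 : ((z a : ℤ_[p]) : ℚ_[p]) = z b := by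
      have := congrArg (fun u : rootsOfUnity (p - 1) ℚ_[p] => ((u : ℚ_[p]ˣ) : ℚ_[p])) hab
      simpa [g] using this
    have h1 : z a = z b := Subtype.ext h1
    have h2 : (p : ℤ_[p]) ∣ (((a : ℕ) - (b : ℕ) : ℤ) : ℤ_[p]) := by
      have e : (((a : ℕ) - (b : ℕ) : ℤ) : ℤ_[p]) =
          (z b - ((b + 1 : ℕ) : ℤ_[p])) - (z a - ((a + 1 : ℕ) : ℤ_[p])) := by
        rw [h1]; push_cast; ring
      rw [e]
      exact dvd_sub ((PadicInt.norm_lt_one_iff_dvd _).1 (by exact_mod_cast hza b))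
        ((PadicInt.norm_lt_one_iff_dvd _).1 (by exact_mod_cast hza a))
    rw [← PadicInt.norm_lt_one_iff_dvd, PadicInt.norm_int_lt_one_iff_dvd] at h2
    have h3 := Int.eq_zero_of_abs_lt_dvd h2 (by rw [abs_lt]; omega)
    omega
  have hf : Finite (rootsOfUnity (p - 1) ℚ_[p]) := inferInstance
  simpa using Nat.card_le_card_of_injective g hg

end RootsOfUnity

/-! ### Binomial power series in two variables. -/

section BinomialSeries

/-- The product `(1+X₁)^(y.1) (1+X₂)^(y.2)` of two formal binomial series. -/
noncomputable def binomSeries {R : Type*} [CommRing R] [BinomialRing R] (y : R × R) :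
    MvPowerSeries (Fin 2) R :=
  fun e => Ring.choose y.1 (e 0) * Ring.choose y.2 (e 1)

variable {R : Type*} [CommRing R] [BinomialRing R]

lemma coeff_binomSeries (y : R × R) (e : Fin 2 →₀ ℕ) :
    MvPowerSeries.coeff e (binomSeries y) = Ring.choose y.1 (e 0) * Ring.choose y.2 (e 1) := rfl

/-- Vandermonde's identity in each variable. -/
lemma binomSeries_add (y z : R × R) : binomSeries (y + z) = binomSeries y * binomSeries z := by
  ext e
  rw [MvPowerSeries.coeff_mul, coeff_binomSeries, Prod.fst_add, Prod.snd_add,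
    Ring.add_choose_eq _ (Commute.all _ _), Ring.add_choose_eq _ (Commute.all _ _),
    Finset.sum_mul_sum, ← Finset.sum_product']
  refine Finset.sum_nbij' (fun q => (Finsupp.single 0 q.1.1 + Finsupp.single 1 q.2.1,
    Finsupp.single 0 q.1.2 + Finsupp.single 1 q.2.2)) (fun q => ((q.1 0, q.2 0), (q.1 1, q.2 1)))
    ?_ ?_ ?_ ?_ ?_
  · rintro ⟨⟨a, b⟩, ⟨c, d⟩⟩ h
    simp only [Finset.mem_product, Finset.HasAntidiagonal.mem_antidiagonal] at h ⊢
    ext i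
    fin_cases i <;> simp [h.1, h.2]
  · rintro ⟨a, b⟩ h
    rw [Finset.HasAntidiagonal.mem_antidiagonal] at h
    simp [← h]
  · rintro ⟨⟨a, b⟩, ⟨c, d⟩⟩ _
    simp
  · rintro ⟨a, b⟩ _
    refine Prod.ext ?_ ?_ <;> ext i <;> fin_cases i <;> simp
  · rintro ⟨⟨a, b⟩, ⟨c, d⟩⟩ _
    simp [coeff_binomSeries]
    ring

lemma binomSeries_zero : binomSeries (0 : R × R) = 1 := by
  ext e
  classical
  rw [coeff_binomSeries, MvPowerSeries.coeff_one, Prod.fst_zero, Prod.snd_zero,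
    Ring.choose_zero_ite, Ring.choose_zero_ite]
  by_cases h0 : e 0 = 0 <;> by_cases h1 : e 1 = 0
  · have : e = 0 := by ext i; fin_cases i <;> simp [h0, h1]
    simp [this]
  all_goals
    have : e ≠ 0 := by rintro rfl; simp_all
    simp [h0, h1, this]

lemma binomSeries_nsmul (y : R × R) (n : ℕ) : binomSeries (n • y) = binomSeries y ^ n := by
  induction n with
  | zero => rw [zero_smul, binomSeries_zero, pow_zero]
  | succ n ih => rw [succ_nsmul, binomSeries_add, ih, pow_succ]

lemma binomSeries_one : binomSeries (1 : R × R) =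
    (1 + MvPowerSeries.X 0) * (1 + MvPowerSeries.X 1) := by
  classical
  have h1 : ∀ n, Ring.choose (1 : R) n = if n ≤ 1 then 1 else 0 := fun n => by
    have := Ring.choose_natCast (R := R) 1 n
    rw [Nat.cast_one] at this
    rw [this]
    rcases n with _ | _ | n
    · simp
    · simp
    · simp [Nat.choose_eq_zero_of_lt]
  have hsplit : (1 : R × R) = (1, 0) + (0, 1) := Prod.ext (by simp) (by simp)
  have he : ∀ e e' : Fin 2 →₀ ℕ, e = e' ↔ e 0 = e' 0 ∧ e 1 = e' 1 := fun e e' => by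
    simp [Finsupp.ext_iff, Fin.forall_fin_two]
  rw [hsplit, binomSeries_add]
  congr 1
  · ext e
    rw [coeff_binomSeries, map_add, MvPowerSeries.coeff_one, MvPowerSeries.coeff_X, h1,
      Ring.choose_zero_ite]
    simp only [he e]
    rcases h : e 0 with _ | _ | n <;> by_cases h' : e 1 = 0 <;> simp [h']
  · ext e
    rw [coeff_binomSeries, map_add, MvPowerSeries.coeff_one, MvPowerSeries.coeff_X, h1,
      Ring.choose_zero_ite]
    simp only [he e]
    rcases h : e 1 with _ | _ | n <;> by_cases h' : e 0 = 0 <;> simp [h']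

lemma map_binomSeries {S : Type*} [CommRing S] [BinomialRing S] (φ : R →+* S) (y : R × R) :
    MvPowerSeries.map φ (binomSeries y) = binomSeries (φ y.1, φ y.2) := by
  ext e
  rw [MvPowerSeries.coeff_map, coeff_binomSeries, coeff_binomSeries, map_mul, Ring.map_choose,
    Ring.map_choose]

lemma geom_sum_binomSeries (u : R) (t : R × R) (q : ℕ) :
    (∑ n ∈ Finset.range q, MvPowerSeries.C (u ^ n) * binomSeries (n • t)) *
      (1 - MvPowerSeries.C u * binomSeries t) =
    1 - MvPowerSeries.C (u ^ q) * binomSeries (q • t) := by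
  have h := geom_sum_mul_neg (MvPowerSeries.C u * binomSeries t) q
  rw [mul_pow, ← map_pow, ← binomSeries_nsmul] at h
  rw [← h]
  congr 1
  refine Finset.sum_congr rfl fun n _ => ?_
  rw [mul_pow, ← map_pow, ← binomSeries_nsmul]

/-- Summation over `n, m < q` multiplies the numerator of `F` by two finite geometric sums, which
telescope against the two factors of the denominator. -/
lemma sum_binomSeries_eq {ι : Type*} (S : Finset ι) (w : ι → R) (x : ι → R × R) (t t' : R × R)
    (u v : R) (F : MvPowerSeries (Fin 2) R)
    (hF : F * ((1 - MvPowerSeries.C u * binomSeries t) * (1 - MvPowerSeries.C v * binomSeries t')) =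
      ∑ a ∈ S, MvPowerSeries.C (w a) * binomSeries (x a)) (z : R × R) (q : ℕ) :
    ∑ a ∈ S, ∑ n ∈ Finset.range q, ∑ m ∈ Finset.range q,
      MvPowerSeries.C (w a * (u ^ n * v ^ m)) * binomSeries (x a + n • t + m • t' + z) =
    binomSeries z * F * (1 - MvPowerSeries.C (u ^ q) * binomSeries (q • t)) *
      (1 - MvPowerSeries.C (v ^ q) * binomSeries (q • t')) := by
  rw [← geom_sum_binomSeries, ← geom_sum_binomSeries]
  set A := ∑ n ∈ Finset.range q, MvPowerSeries.C (u ^ n) * binomSeries (n • t) with hA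
  set B := ∑ n ∈ Finset.range q, MvPowerSeries.C (v ^ n) * binomSeries (n • t') with hB
  have h1 : binomSeries z * F * (A * (1 - MvPowerSeries.C u * binomSeries t)) *
      (B * (1 - MvPowerSeries.C v * binomSeries t')) =
      (F * ((1 - MvPowerSeries.C u * binomSeries t) * (1 - MvPowerSeries.C v * binomSeries t'))) *
        (A * B * binomSeries z) := by ring
  rw [h1, hF, Finset.sum_mul]
  refine Finset.sum_congr rfl fun a _ => ?_
  rw [hA, hB, Finset.sum_mul_sum, Finset.sum_mul, Finset.mul_sum]
  refine Finset.sum_congr rfl fun n _ => ?_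
  rw [Finset.sum_mul, Finset.mul_sum]
  refine Finset.sum_congr rfl fun m _ => ?_
  rw [binomSeries_add, binomSeries_add, binomSeries_add, map_mul, map_mul]
  ring

end BinomialSeries

/-! ### Limits of Riemann sums of binomial coefficients. -/

section Limit

open MvPowerSeries.WithPiTopology

variable {p : ℕ} [hp : Fact p.Prime]

/-- The image of a point of `ℤ_p²` in `ℂ_p²`. -/
noncomputable def ofPadicIntProd (y : ℤ_[p] × ℤ_[p]) : ℂ_[p] × ℂ_[p] :=
  (ofPadicInt p y.1, ofPadicInt p y.2)

lemma tendsto_binomSeries_pow_nsmul (t : ℤ_[p] × ℤ_[p]) :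
    Filter.Tendsto (fun r : ℕ => binomSeries (p ^ r • ofPadicIntProd t)) Filter.atTop (nhds 1) := by
  rw [← binomSeries_zero, tendsto_iff_coeff_tendsto]
  intro e
  simp only [coeff_binomSeries]
  have key : ∀ (y : ℤ_[p]) (i : ℕ), Filter.Tendsto
      (fun r : ℕ => Ring.choose (p ^ r • ofPadicInt p y) i) Filter.atTop
      (nhds (Ring.choose (0 : ℂ_[p]) i)) := fun y i => by
    have h1 : Filter.Tendsto (fun r : ℕ => (p : ℤ_[p]) ^ r * y) Filter.atTop (nhds 0) := by
      have : Filter.Tendsto (fun r : ℕ => (p : ℤ_[p]) ^ r) Filter.atTop (nhds 0) :=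
        tendsto_pow_atTop_nhds_zero_of_norm_lt_one ((PadicInt.norm_lt_one_iff_dvd _).2 dvd_rfl)
      simpa using this.mul_const y
    have h2 := ((continuous_ofPadicInt p).comp (PadicInt.continuous_choose i)).tendsto 0
    have h3 := h2.comp h1
    simp only [Function.comp_def, Ring.map_choose, map_zero, map_mul, map_pow, map_natCast] at h3
    simpa [nsmul_eq_mul] using h3
  exact (key t.1 (e 0)).mul (key t.2 (e 1))

/-- Take coefficients in the telescoped identity for `q = p^r`: the series `binomSeries (p^r • t)`
tends to `1` coefficientwise, while `u^q = u` and `v^q = v` are constant. The shift by `-1` in the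
binomial coefficients is the factor `(1+X₁)⁻¹(1+X₂)⁻¹`. -/
lemma tendsto_riemann_choose {ι : Type*} (S : Finset ι) (w : ι → ℂ_[p]) (x : ι → ℤ_[p] × ℤ_[p])
    (t t' : ℤ_[p] × ℤ_[p]) {u v : ℂ_[p]} (hu : ∀ r, u ^ p ^ r = u) (hv : ∀ r, v ^ p ^ r = v)
    (F : MvPowerSeries (Fin 2) ℂ_[p])
    (hF : F * ((1 - MvPowerSeries.C u * binomSeries (ofPadicIntProd t)) *
        (1 - MvPowerSeries.C v * binomSeries (ofPadicIntProd t'))) =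
      ∑ a ∈ S, MvPowerSeries.C (w a) * binomSeries (ofPadicIntProd (x a))) (i l : ℕ) :
    Filter.Tendsto (fun r : ℕ => ∑ a ∈ S, ∑ n ∈ Finset.range (p ^ r), ∑ m ∈ Finset.range (p ^ r),
      w a * (u ^ n * v ^ m) *
        (ofPadicInt p (Ring.choose ((x a).1 + n * t.1 + m * t'.1 - 1) i) *
          ofPadicInt p (Ring.choose ((x a).2 + n * t.2 + m * t'.2 - 1) l)))
      Filter.atTop (nhds ((1 - u) * (1 - v) *
        MvPowerSeries.coeff (Finsupp.single 0 i + Finsupp.single 1 l)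
          (((1 + MvPowerSeries.X 0) * (1 + MvPowerSeries.X 1) :
            MvPowerSeries (Fin 2) ℂ_[p])⁻¹ * F))) := by
  have hinv : ((1 + MvPowerSeries.X 0) * (1 + MvPowerSeries.X 1) :
      MvPowerSeries (Fin 2) ℂ_[p])⁻¹ = binomSeries (-1) := by
    rw [← binomSeries_one, MvPowerSeries.inv_eq_iff_mul_eq_one, ← binomSeries_add]
    · simpa using binomSeries_zero
    · rw [binomSeries_one]
      simp
  rw [hinv]
  have h1 : Filter.Tendsto (fun r : ℕ => binomSeries (-1) * F *
      (1 - MvPowerSeries.C (u ^ p ^ r) * binomSeries (p ^ r • ofPadicIntProd t)) *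
      (1 - MvPowerSeries.C (v ^ p ^ r) * binomSeries (p ^ r • ofPadicIntProd t'))) Filter.atTop
      (nhds (binomSeries (-1) * F * (1 - MvPowerSeries.C u * 1) *
        (1 - MvPowerSeries.C v * 1))) := by
    simp only [hu, hv]
    exact (tendsto_const_nhds.mul (tendsto_const_nhds.sub
      (tendsto_const_nhds.mul (tendsto_binomSeries_pow_nsmul t)))).mul (tendsto_const_nhds.sub
      (tendsto_const_nhds.mul (tendsto_binomSeries_pow_nsmul t')))
  rw [tendsto_iff_coeff_tendsto] at h1
  have h2 := h1 (Finsupp.single 0 i + Finsupp.single 1 l)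
  simp only [← sum_binomSeries_eq S w (fun a => ofPadicIntProd (x a)) _ _ u v F hF] at h2
  convert h2 using 2
  · simp only [map_sum, MvPowerSeries.coeff_C_mul, coeff_binomSeries]
    refine Finset.sum_congr rfl fun a _ => Finset.sum_congr rfl fun n _ =>
      Finset.sum_congr rfl fun m _ => ?_
    rw [Ring.map_choose, Ring.map_choose]
    simp [ofPadicIntProd, sub_eq_add_neg]
  · have : binomSeries (-1) * F * (1 - MvPowerSeries.C u * 1) * (1 - MvPowerSeries.C v * 1) =
      MvPowerSeries.C ((1 - u) * (1 - v)) * (binomSeries (-1) * F) := by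
      simp only [map_mul, map_sub, map_one]
      ring
    rw [this, MvPowerSeries.coeff_C_mul]

end Limit

lemma isIntegral_of_trace_norm {k E : Type*} [Field k] [Field E] {σ₁ σ₂ : k →+* E} {x : k} {T N : ℤ} (hT : σ₁ x + σ₂ x = T) (hN : σ₁ x * σ₂ x = N) :
    IsIntegral ℤ x := by
  refine ⟨Polynomial.X ^ 2 - Polynomial.C T * Polynomial.X + Polynomial.C N, ?_, ?_⟩
  · monicity!
  · apply σ₁.injective
    simp only [Polynomial.eval₂_add, Polynomial.eval₂_sub, Polynomial.eval₂_mul,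
      Polynomial.eval₂_pow, Polynomial.eval₂_X, Polynomial.eval₂_C]
    simp only [eq_intCast, map_add, map_sub, map_mul, map_pow, map_intCast, map_zero]
    rw [← hT, ← hN]
    ring

/-! ### Trace and norm in a quadratic field. -/

section Quadratic

open NumberField

variable {k : Type*} [Field k] [NumberField k]
variable {E : Type*} [Field E] [CharZero E] [IsAlgClosed E] {σ₁ σ₂ : k →+* E}

lemma univ_eq_pair_of_finrank_eq_two (hk2 : Module.finrank ℚ k = 2) (hσ : σ₁ ≠ σ₂) :
    open Classical in
    (Finset.univ : Finset (k →ₐ[ℚ] E)) = {σ₁.toRatAlgHom, σ₂.toRatAlgHom} := by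
  classical
  refine (Finset.eq_of_subset_of_card_le (Finset.subset_univ _) ?_).symm
  rw [Finset.card_univ, AlgHom.card, hk2, Finset.card_pair]
  intro h
  apply hσ
  ext x
  exact DFunLike.congr_fun h x

lemma ratCast_trace_eq (hk2 : Module.finrank ℚ k = 2) (hσ : σ₁ ≠ σ₂) (x : k) :
    ((Algebra.trace ℚ k x : ℚ) : E) = σ₁ x + σ₂ x := by
  classical
  rw [← eq_ratCast (algebraMap ℚ E), trace_eq_sum_embeddings E,
    univ_eq_pair_of_finrank_eq_two hk2 hσ, Finset.sum_pair]
  · rfl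
  · intro h
    apply hσ
    ext x
    exact DFunLike.congr_fun h x

lemma ratCast_norm_eq (hk2 : Module.finrank ℚ k = 2) (hσ : σ₁ ≠ σ₂) (x : k) :
    ((Algebra.norm ℚ x : ℚ) : E) = σ₁ x * σ₂ x := by
  classical
  rw [← eq_ratCast (algebraMap ℚ E), Algebra.norm_eq_prod_embeddings ℚ E,
    univ_eq_pair_of_finrank_eq_two hk2 hσ, Finset.prod_pair]
  · rfl
  · intro h
    apply hσ
    ext x
    exact DFunLike.congr_fun h x

lemma intCast_trace_eq (hk2 : Module.finrank ℚ k = 2) (hσ : σ₁ ≠ σ₂) (x : 𝓞 k) :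
    ((Algebra.trace ℤ (𝓞 k) x : ℤ) : E) = σ₁ x + σ₂ x := by
  rw [← ratCast_trace_eq hk2 hσ, ← Algebra.coe_trace_int]
  norm_cast

lemma intCast_norm_eq (hk2 : Module.finrank ℚ k = 2) (hσ : σ₁ ≠ σ₂) (x : 𝓞 k) :
    ((Algebra.norm ℤ x : ℤ) : E) = σ₁ x * σ₂ x := by
  rw [← ratCast_norm_eq hk2 hσ, ← Algebra.coe_norm_int]
  norm_cast

lemma norm_eq_mul_trace_sub (hk2 : Module.finrank ℚ k = 2) (hσ : σ₁ ≠ σ₂) (x : 𝓞 k) :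
    ((Algebra.norm ℤ x : ℤ) : 𝓞 k) = x * ((Algebra.trace ℤ (𝓞 k) x : ℤ) - x) := by
  apply NumberField.RingOfIntegers.ext
  apply σ₁.injective
  have h1 := intCast_trace_eq hk2 hσ x
  have h2 := intCast_norm_eq hk2 hσ x
  simp only [map_mul, map_sub, map_intCast]
  rw [h1, h2]
  ring

lemma exists_trace_norm (hk2 : Module.finrank ℚ k = 2) (hσ : σ₁ ≠ σ₂) (x : 𝓞 k) :
    ∃ T N : ℤ, (T : E) = σ₁ x + σ₂ x ∧ (N : E) = σ₁ x * σ₂ x ∧ (N : 𝓞 k) = x * (T - x) :=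
  ⟨_, _, intCast_trace_eq hk2 hσ x, intCast_norm_eq hk2 hσ x, norm_eq_mul_trace_sub hk2 hσ x⟩

end Quadratic

/-! ### The two `p`-adic places above a split prime. -/

section SplitPrime

open NumberField

variable {k : Type*} [Field k] [NumberField k]
variable {p : ℕ} [hp : Fact p.Prime] {σ₁ σ₂ : k →+* ℂ_[p]}

lemma injective_ofPadicInt : Function.Injective (ofPadicInt p) :=
  (AddMonoidHomClass.isometry_of_norm (ofPadicInt p) (norm_ofPadicInt p)).injective

lemma dvd_of_intCast_mem {𝔭 : Ideal (𝓞 k)} (h𝔭 : 𝔭.IsPrime) (hp𝔭 : (p : 𝓞 k) ∈ 𝔭) {n : ℤ}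
    (hn : (n : 𝓞 k) ∈ 𝔭) : (p : ℤ) ∣ n := by
  by_contra h
  have hc : IsCoprime (p : ℤ) n :=
    (Nat.prime_iff_prime_int.1 hp.out).coprime_iff_not_dvd.2 h
  obtain ⟨α, β, hαβ⟩ := hc
  apply h𝔭.ne_top
  rw [Ideal.eq_top_iff_one]
  have : (1 : 𝓞 k) = (α : 𝓞 k) * (p : 𝓞 k) + (β : 𝓞 k) * (n : 𝓞 k) := by
    exact_mod_cast congrArg (Int.cast : ℤ → 𝓞 k) hαβ.symm
  rw [this]
  exact 𝔭.add_mem (𝔭.mul_mem_left _ hp𝔭) (𝔭.mul_mem_left _ hn)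

/-- A quadratic polynomial `X² - T X + N` with `p ∤ T` and `p ∣ N` has a unit root. -/
lemma exists_unit_root {T N : ℤ} (hpT : ¬ (p : ℤ) ∣ T) (hpN : (p : ℤ) ∣ N) :
    ∃ z : ℤ_[p], z ^ 2 - T * z + N = 0 ∧ ‖z‖ = 1 ∧ ‖(T : ℤ_[p]) - z‖ < 1 := by
  have hN1 : ‖(N : ℤ_[p])‖ < 1 := PadicInt.norm_int_lt_one_iff_dvd N |>.2 hpN
  have hT1 : ‖(T : ℤ_[p])‖ = 1 := by
    refine le_antisymm (PadicInt.norm_le_one _) (not_lt.1 fun h => hpT ?_)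
    exact (PadicInt.norm_int_lt_one_iff_dvd T).1 h
  obtain ⟨z, hz, hzT⟩ := exists_hensel_root
    (Polynomial.X ^ 2 - Polynomial.C (T : ℤ_[p]) * Polynomial.X + Polynomial.C (N : ℤ_[p]))
    (T : ℤ_[p]) (by simpa [sq] using hN1) (by
      simp only [Polynomial.derivative_add, Polynomial.derivative_sub, Polynomial.derivative_X_pow,
        Polynomial.derivative_C_mul, Polynomial.derivative_X, Polynomial.derivative_C]
      simp only [Polynomial.eval_add, Polynomial.eval_sub, Polynomial.eval_mul,
        Polynomial.eval_pow, Polynomial.eval_X, Polynomial.eval_C, Polynomial.eval_zero,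
        Polynomial.eval_one]
      rw [show ((2 : ℕ) : ℤ_[p]) * (T : ℤ_[p]) ^ (2 - 1) - T * 1 + 0 = T by push_cast; ring]
      exact hT1)
  have hz1 : ‖z‖ = 1 := by
    refine le_antisymm (PadicInt.norm_le_one _) (not_lt.1 fun h => ?_)
    have := (PadicInt.nonarchimedean z (T - z)).trans_lt
      (max_lt h (by rwa [norm_sub_rev]))
    rw [add_sub_cancel, hT1] at this
    exact lt_irrefl _ this
  have hz2 : ‖(T : ℤ_[p]) - z‖ < 1 := by rwa [norm_sub_rev]
  exact ⟨z, by simpa using hz, hz1, hz2⟩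

/-- An integer of `k` which generates `k` and separates the two primes above the split prime `p`. -/
lemma exists_separating_integer (hk2 : Module.finrank ℚ k = 2) (hσ : σ₁ ≠ σ₂)
    {𝔭₁ 𝔭₂ : Ideal (𝓞 k)} (h₁ : 𝔭₁.IsPrime) (h₂ : 𝔭₂.IsPrime) (hne : 𝔭₁ ≠ 𝔭₂)
    (hsplit : Ideal.span {(p : 𝓞 k)} = 𝔭₁ * 𝔭₂) :
    ∃ (e : 𝓞 k) (w₁ w₂ : ℤ_[p]), σ₁ e = ofPadicInt p w₁ ∧ σ₂ e = ofPadicInt p w₂ ∧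
      ‖w₁‖ = 1 ∧ ‖w₂‖ < 1 := by
  have hp0 : (p : 𝓞 k) ≠ 0 := Nat.cast_ne_zero.2 hp.out.ne_zero
  have hpm : (p : 𝓞 k) ∈ 𝔭₁ * 𝔭₂ := by
    rw [← hsplit]; exact Ideal.mem_span_singleton_self _
  have hpm₁ : (p : 𝓞 k) ∈ 𝔭₁ := (Ideal.mul_le_inf hpm).1
  have hpm₂ : (p : 𝓞 k) ∈ 𝔭₂ := (Ideal.mul_le_inf hpm).2
  have hb₁ : 𝔭₁ ≠ ⊥ := fun h => hp0 (by rw [h] at hpm₁; exact hpm₁)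
  have hnle : ¬ 𝔭₁ ≤ 𝔭₂ := fun h =>
    hne ((h₁.isMaximal hb₁).eq_of_le h₂.ne_top h)
  -- For `e ∈ 𝔭₁ ∖ 𝔭₂` the norm `N` is divisible by `p`. The trace `T` is not, since otherwise `e² =
  -- eT - N` would lie in `𝔭₂`. So Hensel's lemma provides a unit root `z` in `ℤ_p`.
  obtain ⟨e, he₁, he₂⟩ := SetLike.not_le_iff_exists.1 hnle
  obtain ⟨T, N, hTe, hNe, hNT⟩ := exists_trace_norm hk2 hσ e
  have hpN : (p : ℤ) ∣ N := dvd_of_intCast_mem h₁ hpm₁ (by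
    rw [hNT]; exact 𝔭₁.mul_mem_right _ he₁)
  have hpT : ¬ (p : ℤ) ∣ T := by
    intro h
    have hN2 : (N : 𝓞 k) ∈ 𝔭₂ := by
      obtain ⟨n, hn⟩ := hpN
      rw [hn]; push_cast; exact 𝔭₂.mul_mem_right _ hpm₂
    have hT2 : (T : 𝓞 k) ∈ 𝔭₂ := by
      obtain ⟨n, hn⟩ := h
      rw [hn]; push_cast; exact 𝔭₂.mul_mem_right _ hpm₂
    apply he₂
    refine h₂.mem_of_pow_mem 2 ?_
    have : e ^ 2 = e * (T : 𝓞 k) - (N : 𝓞 k) := by rw [hNT]; ring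
    rw [this]
    exact 𝔭₂.sub_mem (𝔭₂.mul_mem_left _ hT2) hN2
  obtain ⟨z, hz', hz1, hz2⟩ := exists_unit_root hpT hpN
  have hprod : (σ₁ e - ofPadicInt p z) * (σ₁ e - ofPadicInt p (T - z)) = 0 := by
    have h := congrArg (ofPadicInt p) hz'
    simp only [map_add, map_sub, map_mul, map_pow, map_intCast, map_zero] at h ⊢
    rw [hTe, hNe] at h
    rw [hTe]
    linear_combination -h
  rcases mul_eq_zero.1 hprod with h | h
  · refine ⟨e, z, T - z, sub_eq_zero.1 h, ?_, hz1, hz2⟩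
    rw [map_sub, map_intCast, hTe, ← sub_eq_zero.1 h]
    ring
  -- If `σ₁ e` is the non-unit root, the conjugate `T - e` takes the place of `e`.
  · refine ⟨(T : 𝓞 k) - e, z, T - z, ?_, ?_, hz1, hz2⟩
    · have := sub_eq_zero.1 h
      simp only [map_sub, map_intCast] at this ⊢
      rw [this]; ring
    · have := sub_eq_zero.1 h
      simp only [map_sub, map_intCast] at this ⊢
      rw [← this, hTe]
      ring

lemma isUnit_sub_of_norm {w₁ w₂ : ℤ_[p]} (h₁ : ‖w₁‖ = 1) (h₂ : ‖w₂‖ < 1) : IsUnit (w₁ - w₂) := by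
  rw [PadicInt.isUnit_iff]
  refine le_antisymm (PadicInt.norm_le_one _) (not_lt.1 fun h => ?_)
  have := (PadicInt.nonarchimedean (w₁ - w₂) w₂).trans_lt (max_lt h h₂)
  rw [sub_add_cancel, h₁] at this
  exact lt_irrefl _ this

/-- The traces of `a` and `ea` are rational integers and give a linear system for `σ₁ a`, `σ₂ a`
over `ℤ_p` whose determinant `w₁ - w₂` is, up to sign, a unit; Cramer's rule solves it. -/
lemma exists_ofPadicInt_eq (hk2 : Module.finrank ℚ k = 2) (hσ : σ₁ ≠ σ₂) {e : 𝓞 k}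
    {w₁ w₂ : ℤ_[p]} (he₁ : σ₁ e = ofPadicInt p w₁) (he₂ : σ₂ e = ofPadicInt p w₂)
    (h₁ : ‖w₁‖ = 1) (h₂ : ‖w₂‖ < 1) (a : 𝓞 k) :
    ∃ y₁ y₂ : ℤ_[p], σ₁ a = ofPadicInt p y₁ ∧ σ₂ a = ofPadicInt p y₂ := by
  obtain ⟨d, hd⟩ := isUnit_sub_of_norm h₁ h₂
  have hd' : (ofPadicInt p w₁ - ofPadicInt p w₂) * ofPadicInt p (↑d⁻¹ : ℤ_[p]) = 1 := by
    rw [← map_sub, ← hd, ← map_mul, Units.mul_inv, map_one]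
  have ht := intCast_trace_eq hk2 hσ a
  have ht' := intCast_trace_eq hk2 hσ (e * a)
  simp only [map_mul] at ht'
  rw [he₁, he₂] at ht'
  refine ⟨(Algebra.trace ℤ (𝓞 k) (e * a) - w₂ * Algebra.trace ℤ (𝓞 k) a) * ↑d⁻¹,
    (w₁ * Algebra.trace ℤ (𝓞 k) a - Algebra.trace ℤ (𝓞 k) (e * a)) * ↑d⁻¹, ?_, ?_⟩
  · simp only [map_mul, map_sub, map_intCast]
    rw [ht, ht']
    linear_combination (-σ₁ a) * hd'
  · simp only [map_mul, map_sub, map_intCast]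
    rw [ht, ht']
    linear_combination (-σ₂ a) * hd'

/-- An integer of `k` that is non-invertible at both places above `p` is divisible by `p`. -/
lemma exists_eq_prime_mul (hk2 : Module.finrank ℚ k = 2) (hσ : σ₁ ≠ σ₂) {a : 𝓞 k}
    {y₁ y₂ : ℤ_[p]} (hy₁ : σ₁ a = ofPadicInt p y₁) (hy₂ : σ₂ a = ofPadicInt p y₂)
    (h₁ : ‖y₁‖ < 1) (h₂ : ‖y₂‖ < 1) : ∃ b : 𝓞 k, a = p * b := by
  have ht := intCast_trace_eq hk2 hσ a
  have hn := intCast_norm_eq hk2 hσ a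
  rw [hy₁, hy₂, ← map_add, ← map_intCast (ofPadicInt p)] at ht
  rw [hy₁, hy₂, ← map_mul, ← map_intCast (ofPadicInt p)] at hn
  have ht' := injective_ofPadicInt ht
  have hn' := injective_ofPadicInt hn
  have hp0 : (p : ℂ_[p]) ≠ 0 := natCast_ne_zero_padicComplex p
  have hpk : (p : k) ≠ 0 := Nat.cast_ne_zero.2 hp.out.ne_zero
  obtain ⟨c₁, rfl⟩ := PadicInt.norm_lt_one_iff_dvd _ |>.1 h₁
  obtain ⟨c₂, rfl⟩ := PadicInt.norm_lt_one_iff_dvd _ |>.1 h₂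
  obtain ⟨T, hT⟩ : (p : ℤ) ∣ Algebra.trace ℤ (𝓞 k) a := by
    rw [← PadicInt.norm_int_lt_one_iff_dvd, ht', PadicInt.norm_lt_one_iff_dvd]
    exact ⟨c₁ + c₂, by ring⟩
  obtain ⟨N, hN⟩ : ((p : ℤ) ^ 2) ∣ Algebra.norm ℤ a := by
    have : ‖((Algebra.norm ℤ a : ℤ) : ℤ_[p])‖ ≤ (p : ℝ) ^ (-(2 : ℕ) : ℤ) := by
      rw [hn', PadicInt.norm_le_pow_iff_mem_span_pow, Ideal.mem_span_singleton]
      exact ⟨c₁ * c₂, by ring⟩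
    rw [PadicInt.norm_int_le_pow_iff_dvd] at this
    exact_mod_cast this
  -- The trace of `a` is divisible by `p` and its norm by `p²`, so `a/p` has integral trace and
  -- norm.
  have hint : IsIntegral ℤ ((a : k) / p) := by
    refine isIntegral_of_trace_norm (σ₁ := σ₁) (σ₂ := σ₂) (T := T) (N := N) ?_ ?_
    · rw [map_div₀, map_div₀, map_natCast, map_natCast, ← add_div, ← intCast_trace_eq hk2 hσ, hT]
      push_cast
      field_simp
    · rw [map_div₀, map_div₀, map_natCast, map_natCast, div_mul_div_comm,
        ← intCast_norm_eq hk2 hσ, hN]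
      push_cast
      field_simp
  refine ⟨⟨(a : k) / p, hint⟩, ?_⟩
  apply NumberField.RingOfIntegers.ext
  change (a : k) = ((p : 𝓞 k) : k) * ((a : k) / p)
  rw [show ((p : 𝓞 k) : k) = p from map_natCast (algebraMap (𝓞 k) k) p]
  field_simp

end SplitPrime

/-! ### Passing from integers to a fractional ideal prime to `p`. -/

section FractionalIdeal

open NumberField

variable {k : Type*} [Field k] [NumberField k]
variable {p : ℕ} [hp : Fact p.Prime] {σ₁ σ₂ : k →+* ℂ_[p]}
variable (I : (FractionalIdeal (𝓞 k)⁰ k)ˣ)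

/-- The integers `d` of `k` with `d ∈ I` and `d I ⊆ 𝓞`. -/
noncomputable def denominatorIdeal : Ideal (𝓞 k) where
  carrier := {d | (d : k) ∈ toModule I ∧ ∀ x ∈ toModule I, ∃ b : 𝓞 k, (d : k) * x = b}
  zero_mem' := ⟨by simp, fun x _ => ⟨0, by simp⟩⟩
  add_mem' := by
    rintro d d' ⟨h₁, h₂⟩ ⟨h₁', h₂'⟩
    refine ⟨by simpa using (toModule I).add_mem h₁ h₁', fun x hx => ?_⟩
    obtain ⟨b, hb⟩ := h₂ x hx
    obtain ⟨b', hb'⟩ := h₂' x hx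
    exact ⟨b + b', by simp only [map_add]; rw [add_mul, hb, hb']⟩
  smul_mem' := by
    rintro r d ⟨h₁, h₂⟩
    refine ⟨by simpa [Algebra.smul_def] using (toModule I).smul_mem r h₁, fun x hx => ?_⟩
    obtain ⟨b, hb⟩ := h₂ x hx
    exact ⟨r * b, by simp only [smul_eq_mul, map_mul]; rw [mul_assoc, hb]⟩

lemma exists_eq_pow_mul (𝔮 : IsDedekindDomain.HeightOneSpectrum (𝓞 k)) {J : Ideal (𝓞 k)}
    (hJ : J ≠ 0) :
    ∃ 𝔟 : Ideal (𝓞 k), J = 𝔮.asIdeal ^ (Associates.mk 𝔮.asIdeal).count (Associates.mk J).factors * 𝔟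
      ∧ ¬ 𝔟 ≤ 𝔮.asIdeal := by
  classical
  set n := (Associates.mk 𝔮.asIdeal).count (Associates.mk J).factors with hn
  have hJ' : Associates.mk J ≠ 0 := Associates.mk_ne_zero.2 hJ
  have hirr := 𝔮.associates_irreducible
  have h1 : 𝔮.asIdeal ^ n ∣ J := by
    rw [← Associates.mk_le_mk_iff_dvd, Associates.mk_pow,
      Associates.prime_pow_dvd_iff_le hJ' hirr]
  obtain ⟨𝔟, h𝔟⟩ := h1
  refine ⟨𝔟, h𝔟, fun hle => ?_⟩
  have h2 : 𝔮.asIdeal ^ (n + 1) ∣ J := by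
    rw [h𝔟, pow_succ]
    exact mul_dvd_mul_left _ (Ideal.dvd_iff_le.2 hle)
  rw [← Associates.mk_le_mk_iff_dvd, Associates.mk_pow,
    Associates.prime_pow_dvd_iff_le hJ' hirr] at h2
  omega

/-- Write `I = a⁻¹J`. Zero order at `𝔮` means that `(a) = 𝔮ⁿ𝔠` and `J = 𝔮ⁿ𝔟` with the same `n`. An
element of `𝔠` outside `𝔮` clears the denominators of `I`, one of `𝔟` outside `𝔮` lies in `I`, and
their product does both. -/
lemma not_denominatorIdeal_le (𝔮 : IsDedekindDomain.HeightOneSpectrum (𝓞 k))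
    (h𝔮 : FractionalIdeal.count k 𝔮 (I : FractionalIdeal (𝓞 k)⁰ k) = 0) :
    ¬ denominatorIdeal I ≤ 𝔮.asIdeal := by
  classical
  intro hle
  obtain ⟨a, J, ha, hIJ⟩ :=
    FractionalIdeal.exists_eq_spanSingleton_mul (I : FractionalIdeal (𝓞 k)⁰ k)
  have hI : (I : FractionalIdeal (𝓞 k)⁰ k) ≠ 0 := I.ne_zero
  have hJ : J ≠ 0 := by
    rintro rfl
    apply hI
    rw [hIJ]
    simp
  have hak : (a : k) ≠ 0 := by
    simpa using ha
  have hcount := FractionalIdeal.count_well_defined k 𝔮 hI hIJ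
  rw [h𝔮] at hcount
  obtain ⟨𝔟, hb, hb'⟩ := exists_eq_pow_mul 𝔮 hJ
  obtain ⟨𝔠, hc, hc'⟩ := exists_eq_pow_mul 𝔮 (J := Ideal.span {a}) (by simpa using ha)
  have hn : (Associates.mk 𝔮.asIdeal).count (Associates.mk (Ideal.span {a})).factors =
      (Associates.mk 𝔮.asIdeal).count (Associates.mk J).factors := by omega
  rw [hn] at hc
  set n := (Associates.mk 𝔮.asIdeal).count (Associates.mk J).factors
  have hmem : ∀ x, x ∈ toModule I ↔ ∃ y ∈ J, (a : k)⁻¹ * (y : k) = x := by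
    intro x
    change x ∈ (I : FractionalIdeal (𝓞 k)⁰ k) ↔ _
    rw [hIJ, FractionalIdeal.mem_singleton_mul]
    constructor
    · rintro ⟨y, hy, rfl⟩
      obtain ⟨y', hy', rfl⟩ := (FractionalIdeal.mem_coeIdeal _).1 hy
      exact ⟨y', hy', rfl⟩
    · rintro ⟨y, hy, rfl⟩
      exact ⟨_, FractionalIdeal.mem_coeIdeal_of_mem _ hy, rfl⟩
  obtain ⟨d, hd, hd'⟩ := SetLike.not_le_iff_exists.1 hc'
  obtain ⟨d₂, hd₂, hd₂'⟩ := SetLike.not_le_iff_exists.1 hb'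
  have h1 : ∀ x ∈ toModule I, ∃ b : 𝓞 k, (d : k) * x = b := by
    intro x hx
    obtain ⟨y, hy, rfl⟩ := (hmem x).1 hx
    have : d * y ∈ Ideal.span {a} * 𝔟 := by
      rw [hc, mul_comm (𝔮.asIdeal ^ n) 𝔠, mul_assoc, ← hb]
      exact Ideal.mul_mem_mul hd hy
    obtain ⟨b, hb⟩ := Ideal.mem_span_singleton'.1 ((Ideal.mul_le_inf this).1)
    refine ⟨b, ?_⟩
    have hb' := congrArg (algebraMap (𝓞 k) k) hb
    simp only [map_mul] at hb'
    field_simp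
    linear_combination -hb'
  have h2 : (d₂ : k) ∈ toModule I := by
    refine (hmem _).2 ⟨d₂ * a, ?_, ?_⟩
    · rw [hb, mul_comm]
      refine Ideal.mul_mem_mul hd₂ ?_
      have : a ∈ 𝔮.asIdeal ^ n * 𝔠 := hc ▸ Ideal.mem_span_singleton_self a
      exact (Ideal.mul_le_inf this).1
    · simp only [map_mul]
      field_simp
  have h3 : d * d₂ ∈ denominatorIdeal I := by
    refine ⟨?_, fun x hx => ?_⟩
    · have := (toModule I).smul_mem d h2
      rwa [Algebra.smul_def, ← map_mul] at this
    · obtain ⟨b, hb⟩ := h1 x hx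
      exact ⟨d₂ * b, by simp only [map_mul]; linear_combination (d₂ : k) * hb⟩
  rcases 𝔮.isPrime.mem_or_mem (hle h3) with h | h
  · exact hd' h
  · exact hd₂' h

/-- The denominator ideal lies in no prime above `p`, so it contains some `d ≡ 1` modulo `p`. Its
norm is a multiple of `d` and is again `1` modulo `p`. -/
lemma exists_intCast_mem_denominatorIdeal (hk2 : Module.finrank ℚ k = 2) (hσ : σ₁ ≠ σ₂)
    (hpI : ∀ 𝔭 : IsDedekindDomain.HeightOneSpectrum (𝓞 k), (p : 𝓞 k) ∈ 𝔭.asIdeal →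
        FractionalIdeal.count k 𝔭 (I : FractionalIdeal (𝓞 k)⁰ k) = 0) :
    ∃ t : ℤ, ¬ (p : ℤ) ∣ t ∧ (t : 𝓞 k) ∈ denominatorIdeal I := by
  have hp0 : (p : 𝓞 k) ≠ 0 := Nat.cast_ne_zero.2 hp.out.ne_zero
  have htop : denominatorIdeal I ⊔ Ideal.span {(p : 𝓞 k)} = ⊤ := by
    by_contra h
    obtain ⟨𝔪, h𝔪, hle⟩ := Ideal.exists_le_maximal _ h
    have hpm : (p : 𝓞 k) ∈ 𝔪 := hle (Ideal.mem_sup_right (Ideal.mem_span_singleton_self _))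
    have hb : 𝔪 ≠ ⊥ := fun h => hp0 (by rw [h] at hpm; exact hpm)
    exact not_denominatorIdeal_le I ⟨𝔪, h𝔪.isPrime, hb⟩ (hpI _ hpm) (le_sup_left.trans hle)
  obtain ⟨d, hd, q, hq, hdq⟩ := Submodule.mem_sup.1 (htop ▸ Submodule.mem_top : (1 : 𝓞 k) ∈ _)
  obtain ⟨r, rfl⟩ := Ideal.mem_span_singleton'.1 hq
  obtain ⟨T, N, hT, hN, hNT⟩ := exists_trace_norm hk2 hσ d
  obtain ⟨T', N', hT', hN', -⟩ := exists_trace_norm hk2 hσ r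
  refine ⟨N, fun hdvd => ?_, ?_⟩
  · have hd' : d = 1 - r * p := by rw [← hdq]; ring
    have h : (N : ℂ_[p]) = ((1 - p * T' + p ^ 2 * N' : ℤ) : ℂ_[p]) := by
      push_cast
      rw [hN, hT', hN', hd']
      simp only [map_sub, map_mul, map_one, map_natCast]
      ring
    have h' : N = 1 - p * T' + p ^ 2 * N' := by exact_mod_cast h
    have h1 : (p : ℤ) ∣ 1 := by
      have : (1 : ℤ) = N + p * (T' - p * N') := by rw [h']; ring
      rw [this]
      exact dvd_add hdvd (dvd_mul_right _ _)
    exact (Nat.prime_iff_prime_int.1 hp.out).not_isUnit (isUnit_of_dvd_one h1)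
  · rw [hNT]
    exact (denominatorIdeal I).mul_mem_right _ hd

lemma exists_mem_sub_eq_prime_mul {t : ℤ} (hpt : ¬ (p : ℤ) ∣ t)
    (ht : (t : 𝓞 k) ∈ denominatorIdeal I) {a : k} (ha : a ∈ toModule I) {b : 𝓞 k}
    (hb : (t : k) * a = p * b) : ∃ x ∈ toModule I, a = p * x := by
  obtain ⟨α, β, hαβ⟩ := (Nat.prime_iff_prime_int.1 hp.out).coprime_iff_not_dvd.2 hpt
  -- The square is needed because one factor `t` turns `a` into the integer `p b`, and the other
  -- brings `b` back into `I`.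
  have ht' : ∃ α' β' : ℤ, α' * t ^ 2 + β' * p = 1 :=
    ⟨β ^ 2, α ^ 2 * p + 2 * α * β * t, by linear_combination (α * p + β * t + 1) * hαβ⟩
  obtain ⟨α', β', h⟩ := ht'
  have h1 : (t : k) * b ∈ toModule I := by
    have := (toModule I).smul_mem b ht.1
    rw [Algebra.smul_def] at this
    rw [mul_comm]
    simpa using this
  refine ⟨α' * (t * b) + β' * a, ?_, ?_⟩
  · refine (toModule I).add_mem ?_ ?_
    · simpa [Algebra.smul_def] using (toModule I).smul_mem (α' : 𝓞 k) h1
    · simpa [Algebra.smul_def] using (toModule I).smul_mem (β' : 𝓞 k) ha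
  · have h' : (α' : k) * t ^ 2 + β' * p = 1 := by exact_mod_cast congrArg (Int.cast : ℤ → k) h
    linear_combination (-a) * h' + (α' * t : k) * hb

lemma norm_intCast_eq_one {t : ℤ} (hpt : ¬ (p : ℤ) ∣ t) : ‖(t : ℤ_[p])‖ = 1 :=
  le_antisymm (PadicInt.norm_le_one _) (not_lt.1 fun h =>
    hpt ((PadicInt.norm_int_lt_one_iff_dvd t).1 h))

section Index

variable (hk2 : Module.finrank ℚ k = 2) (hσ : σ₁ ≠ σ₂)
  (hsplit : ∃ 𝔭₁ 𝔭₂ : Ideal (𝓞 k), 𝔭₁.IsPrime ∧ 𝔭₂.IsPrime ∧ 𝔭₁ ≠ 𝔭₂ ∧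
    Ideal.span {(p : 𝓞 k)} = 𝔭₁ * 𝔭₂)
  (hpI : ∀ 𝔭 : IsDedekindDomain.HeightOneSpectrum (𝓞 k), (p : 𝓞 k) ∈ 𝔭.asIdeal →
        FractionalIdeal.count k 𝔭 (I : FractionalIdeal (𝓞 k)⁰ k) = 0)
include hk2 hσ hsplit

lemma exists_ofPadicInt_eq_integer (a : 𝓞 k) :
    ∃ y₁ y₂ : ℤ_[p], σ₁ a = ofPadicInt p y₁ ∧ σ₂ a = ofPadicInt p y₂ := by
  obtain ⟨𝔭₁, 𝔭₂, h₁, h₂, hne, hs⟩ := hsplit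
  obtain ⟨e, w₁, w₂, he₁, he₂, hw₁, hw₂⟩ := exists_separating_integer hk2 hσ h₁ h₂ hne hs
  exact exists_ofPadicInt_eq hk2 hσ he₁ he₂ hw₁ hw₂ a

lemma norm_integer_le_one (a : 𝓞 k) : ‖σ₁ a‖ ≤ 1 ∧ ‖σ₂ a‖ ≤ 1 := by
  obtain ⟨y₁, y₂, h₁, h₂⟩ := exists_ofPadicInt_eq_integer hk2 hσ hsplit a
  rw [h₁, h₂]
  exact ⟨norm_ofPadicInt_le_one p _, norm_ofPadicInt_le_one p _⟩

lemma exists_eq_prime_mul_integer {a : 𝓞 k} (h₁ : ‖σ₁ a‖ < 1) (h₂ : ‖σ₂ a‖ < 1) :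
    ∃ b : 𝓞 k, a = p * b := by
  obtain ⟨y₁, y₂, hy₁, hy₂⟩ := exists_ofPadicInt_eq_integer hk2 hσ hsplit a
  rw [hy₁, norm_ofPadicInt] at h₁
  rw [hy₂, norm_ofPadicInt] at h₂
  exact exists_eq_prime_mul hk2 hσ hy₁ hy₂ h₁ h₂

include hpI

lemma exists_ofPadicInt_eq_mem {a : k} (ha : a ∈ toModule I) :
    ∃ y : ℤ_[p] × ℤ_[p], σ₁ a = ofPadicInt p y.1 ∧ σ₂ a = ofPadicInt p y.2 := by
  obtain ⟨t, hpt, ht⟩ := exists_intCast_mem_denominatorIdeal I hk2 hσ hpI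
  obtain ⟨b, hb⟩ := ht.2 a ha
  obtain ⟨y₁, y₂, hy₁, hy₂⟩ := exists_ofPadicInt_eq_integer hk2 hσ hsplit b
  obtain ⟨u, hu⟩ := PadicInt.isUnit_iff.2 (norm_intCast_eq_one hpt)
  have hu' : (t : ℂ_[p]) * ofPadicInt p (↑u⁻¹ : ℤ_[p]) = 1 := by
    rw [← map_intCast (ofPadicInt p), ← hu, ← map_mul, Units.mul_inv, map_one]
  rw [← hb] at hy₁ hy₂
  simp only [map_mul, map_intCast] at hy₁ hy₂
  refine ⟨(y₁ * ↑u⁻¹, y₂ * ↑u⁻¹), ?_, ?_⟩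
  · rw [map_mul, ← hy₁]
    linear_combination (-σ₁ a) * hu'
  · rw [map_mul, ← hy₂]
    linear_combination (-σ₂ a) * hu'

lemma exists_mem_eq_prime_mul {a : k} (ha : a ∈ toModule I) (h₁ : ‖σ₁ a‖ < 1) (h₂ : ‖σ₂ a‖ < 1) :
    ∃ x ∈ toModule I, a = p * x := by
  obtain ⟨t, hpt, ht⟩ := exists_intCast_mem_denominatorIdeal I hk2 hσ hpI
  obtain ⟨b, hb⟩ := ht.2 a ha
  have ht1 : ‖(t : ℂ_[p])‖ ≤ 1 := by
    rw [← map_intCast (ofPadicInt p)]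
    exact norm_ofPadicInt_le_one p _
  have hlt : ∀ σ : k →+* ℂ_[p], ‖σ a‖ < 1 → ‖σ b‖ < 1 := by
    intro σ h
    rw [← hb, map_mul, norm_mul]
    simp only [map_intCast]
    exact (mul_le_of_le_one_left (norm_nonneg _) ht1).trans_lt h
  obtain ⟨b', rfl⟩ := exists_eq_prime_mul_integer hk2 hσ hsplit (hlt σ₁ h₁) (hlt σ₂ h₂)
  refine exists_mem_sub_eq_prime_mul I hpt ht ha (b := b') ?_
  simpa using hb

end Index

end FractionalIdeal

/-! ### Divisibility of the index `|I : (a)|` by `p`. -/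

section RelIndex

variable {G : Type*} [AddCommGroup G] {H K : AddSubgroup G} {p : ℕ}

lemma exists_nsmul_mem_of_dvd_relIndex [hp : Fact p.Prime] (h0 : H.relIndex K ≠ 0)
    (hd : p ∣ H.relIndex K) : ∃ x ∈ K, x ∉ H ∧ p • x ∈ H := by
  have : Finite (K ⧸ H.addSubgroupOf K) := Nat.finite_of_card_ne_zero h0
  obtain ⟨y, hy⟩ := exists_prime_addOrderOf_dvd_card' (G := K ⧸ H.addSubgroupOf K) p hd
  obtain ⟨x, rfl⟩ := QuotientAddGroup.mk_surjective y
  refine ⟨x, x.2, fun hx => ?_, ?_⟩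
  · have : (QuotientAddGroup.mk x : K ⧸ H.addSubgroupOf K) = 0 :=
      (QuotientAddGroup.eq_zero_iff x).2 hx
    rw [this, addOrderOf_zero] at hy
    exact hp.out.one_lt.ne hy
  · have h : p • (QuotientAddGroup.mk x : K ⧸ H.addSubgroupOf K) = 0 := hy ▸ addOrderOf_nsmul_eq_zero _
    rw [← QuotientAddGroup.mk_nsmul, QuotientAddGroup.eq_zero_iff] at h
    exact h

lemma dvd_relIndex_of_nsmul_mem [hp : Fact p.Prime] {x : G} (hx : x ∈ K) (hxH : x ∉ H)
    (hpx : p • x ∈ H) : p ∣ H.relIndex K := by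
  have : addOrderOf (QuotientAddGroup.mk ⟨x, hx⟩ : K ⧸ H.addSubgroupOf K) = p := by
    refine addOrderOf_eq_prime ?_ ?_
    · rw [← QuotientAddGroup.mk_nsmul, QuotientAddGroup.eq_zero_iff]
      exact hpx
    · intro h
      exact hxH ((QuotientAddGroup.eq_zero_iff (⟨x, hx⟩ : K)).1 h)
  rw [← this]
  exact addOrderOf_dvd_natCard _

end RelIndex

section Index

open NumberField

variable {k : Type*} [Field k] [NumberField k]
variable {p : ℕ} [hp : Fact p.Prime] {σ₁ σ₂ : k →+* ℂ_[p]}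
variable (I : (FractionalIdeal (𝓞 k)⁰ k)ˣ)

lemma finite_int_toModule : Module.Finite ℤ ↥(toModule I) := by
  have : Module.Finite (𝓞 k) ↥(toModule I) :=
    Module.Finite.iff_fg.2 (FractionalIdeal.fg_unit I)
  exact Module.Finite.trans (𝓞 k) _

lemma exists_int_mul_integer (x : k) : ∃ (n : ℤ) (b : 𝓞 k), n ≠ 0 ∧ (n : k) * x = b := by
  obtain ⟨n, hn, hb⟩ := ((IsFractionRing.isAlgebraic_iff ℤ ℚ k).2
    (Algebra.IsAlgebraic.isAlgebraic x)).exists_integral_multiple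
  exact ⟨n, ⟨n • x, hb⟩, hn, (zsmul_eq_mul x n).symm⟩

/-- The quotient is finitely generated and torsion. Finiteness matters since the default index `0`
would be divisible by `p` without yielding `p`-torsion. -/
lemma idealIndex_ne_zero {a : k} (ha0 : a ≠ 0) : idealIndex I a ≠ 0 := by
  have := finite_int_toModule I
  have hG : AddGroup.FG ↥(toModule I).toAddSubgroup :=
    Module.Finite.iff_addGroup_fg.1 (inferInstanceAs (Module.Finite ℤ ↥(toModule I)))
  have hQ : AddGroup.FG (↥(toModule I).toAddSubgroup ⧸
    ((Submodule.span (𝓞 k) {a}).toAddSubgroup.addSubgroupOf (toModule I).toAddSubgroup)) :=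
    inferInstance
  have hfin := AddCommGroup.finite_of_fg_isAddTorsion (G := ↥(toModule I).toAddSubgroup ⧸
    ((Submodule.span (𝓞 k) {a}).toAddSubgroup.addSubgroupOf (toModule I).toAddSubgroup)) (by
      intro y
      obtain ⟨x, rfl⟩ := QuotientAddGroup.mk_surjective y
      obtain ⟨n, b, hn, hb⟩ := exists_int_mul_integer ((x : k) / a)
      rw [isOfFinAddOrder_iff_zsmul_eq_zero]
      refine ⟨n, hn, ?_⟩
      rw [← QuotientAddGroup.mk_zsmul, QuotientAddGroup.eq_zero_iff]
      change n • (x : k) ∈ Submodule.span (𝓞 k) {a}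
      rw [Submodule.mem_span_singleton]
      refine ⟨b, ?_⟩
      rw [Algebra.smul_def, zsmul_eq_mul]
      change (b : k) * a = _
      rw [← hb]
      field_simp)
  exact Nat.card_ne_zero.2 ⟨⟨0⟩, hfin⟩

variable (hk2 : Module.finrank ℚ k = 2) (hσ : σ₁ ≠ σ₂)
  (hsplit : ∃ 𝔭₁ 𝔭₂ : Ideal (𝓞 k), 𝔭₁.IsPrime ∧ 𝔭₂.IsPrime ∧ 𝔭₁ ≠ 𝔭₂ ∧
    Ideal.span {(p : 𝓞 k)} = 𝔭₁ * 𝔭₂)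
  (hpI : ∀ 𝔭 : IsDedekindDomain.HeightOneSpectrum (𝓞 k), (p : 𝓞 k) ∈ 𝔭.asIdeal →
        FractionalIdeal.count k 𝔭 (I : FractionalIdeal (𝓞 k)⁰ k) = 0)
include hk2 hσ hsplit hpI

/-- Here `ba` is small at both places, hence `ba = px` with `x ∈ I`. The class of `x` modulo `(a)`
has order `p`, because `x ∈ (a)` would make `b` divisible by `p`. -/
lemma dvd_idealIndex_of_integer {a : k} (ha : a ∈ toModule I) (ha0 : a ≠ 0) {b : 𝓞 k}
    (h₁ : ‖σ₁ a‖ * ‖σ₁ b‖ < 1) (h₂ : ‖σ₂ a‖ * ‖σ₂ b‖ < 1) (hb : ¬ (‖σ₁ b‖ < 1 ∧ ‖σ₂ b‖ < 1)) :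
    p ∣ idealIndex I a := by
  have hpk : (p : k) ≠ 0 := Nat.cast_ne_zero.2 hp.out.ne_zero
  have hab : (b : k) * a ∈ toModule I := by
    simpa [Algebra.smul_def] using (toModule I).smul_mem b ha
  obtain ⟨x, hx, hxa⟩ := exists_mem_eq_prime_mul I hk2 hσ hsplit hpI hab
    (by rw [map_mul, norm_mul, mul_comm]; exact h₁) (by rw [map_mul, norm_mul, mul_comm]; exact h₂)
  refine dvd_relIndex_of_nsmul_mem (x := x) hx (fun h => hb ?_) ?_
  · obtain ⟨c, hc⟩ := Submodule.mem_span_singleton.1 h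
    rw [Algebra.smul_def] at hc
    have hbc : (b : k) = p * (c : k) := by
      apply mul_right_cancel₀ ha0
      rw [hxa, ← hc]; ring
    have hp1 : (p : ℝ)⁻¹ < 1 := inv_lt_one_of_one_lt₀ (by exact_mod_cast hp.out.one_lt)
    obtain ⟨hc₁, hc₂⟩ := norm_integer_le_one hk2 hσ hsplit c
    rw [hbc]
    simp only [map_mul, map_natCast, norm_mul, norm_p_padicComplex]
    exact ⟨(mul_le_of_le_one_right (by positivity) hc₁).trans_lt hp1,
      (mul_le_of_le_one_right (by positivity) hc₂).trans_lt hp1⟩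
  · refine Submodule.mem_span_singleton.2 ⟨b, ?_⟩
    rw [Algebra.smul_def, hxa, nsmul_eq_mul]

lemma norm_mem_le_one {a : k} (ha : a ∈ toModule I) : ‖σ₁ a‖ ≤ 1 ∧ ‖σ₂ a‖ ≤ 1 := by
  obtain ⟨y, h₁, h₂⟩ := exists_ofPadicInt_eq_mem I hk2 hσ hsplit hpI ha
  rw [h₁, h₂]
  exact ⟨norm_ofPadicInt_le_one p _, norm_ofPadicInt_le_one p _⟩

/-- If both images of `a` are units and `px = ca` with `x ∈ I`, then `c` is small at both places, so
`c = pb` and `x = ba`: there is no `p`-torsion. Conversely, a separating integer that is a unit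
where `a` is not, and small at the other place, produces `p`-torsion. -/
lemma dvd_idealIndex_iff {a : k} (ha : a ∈ toModule I) (ha0 : a ≠ 0) :
    p ∣ idealIndex I a ↔ ‖σ₁ a‖ < 1 ∨ ‖σ₂ a‖ < 1 := by
  obtain ⟨ha₁, ha₂⟩ := norm_mem_le_one I hk2 hσ hsplit hpI ha
  have hp1 : (p : ℝ)⁻¹ < 1 := inv_lt_one_of_one_lt₀ (by exact_mod_cast hp.out.one_lt)
  have hpp : 0 < (p : ℝ) := by exact_mod_cast hp.out.pos
  constructor
  · intro hd
    by_contra! h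
    have h₁ := le_antisymm ha₁ h.1
    have h₂ := le_antisymm ha₂ h.2
    obtain ⟨x, hx, hxa, hpx⟩ := exists_nsmul_mem_of_dvd_relIndex (idealIndex_ne_zero I ha0) hd
    obtain ⟨hx₁, hx₂⟩ := norm_mem_le_one I hk2 hσ hsplit hpI hx
    obtain ⟨c, hc⟩ := Submodule.mem_span_singleton.1 hpx
    rw [Algebra.smul_def, nsmul_eq_mul] at hc
    have key : ∀ σ : k →+* ℂ_[p], ‖σ a‖ = 1 → ‖σ x‖ ≤ 1 → ‖σ c‖ < 1 := by
      intro σ hσa hσx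
      have := congrArg (fun z => ‖σ z‖) hc
      simp only [map_mul, norm_mul, hσa, mul_one, map_natCast, norm_p_padicComplex] at this
      rw [this]
      exact (mul_le_of_le_one_right (by positivity) hσx).trans_lt hp1
    obtain ⟨b, rfl⟩ := exists_eq_prime_mul_integer hk2 hσ hsplit (key σ₁ h₁ hx₁) (key σ₂ h₂ hx₂)
    apply hxa
    refine Submodule.mem_span_singleton.2 ⟨b, ?_⟩
    have hpk : (p : k) ≠ 0 := Nat.cast_ne_zero.2 hp.out.ne_zero
    rw [Algebra.smul_def]
    apply mul_left_cancel₀ hpk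
    rw [← hc]
    simp only [map_mul, map_natCast]
    ring
  · intro h
    have hsplit' := hsplit
    obtain ⟨𝔭₁, 𝔭₂, hp₁, hp₂, hne, hs⟩ := hsplit'
    rcases h with h | h
    · obtain ⟨e, w₁, w₂, he₁, he₂, hw₁, hw₂⟩ := exists_separating_integer hk2 hσ hp₁ hp₂ hne hs
      rw [← norm_ofPadicInt, ← he₁] at hw₁
      rw [← norm_ofPadicInt, ← he₂] at hw₂
      refine dvd_idealIndex_of_integer I hk2 hσ hsplit hpI ha ha0 (b := e) ?_ ?_ ?_
      · rwa [hw₁, mul_one]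
      · exact (mul_le_of_le_one_left (norm_nonneg _) ha₂).trans_lt hw₂
      · intro h'
        rw [hw₁] at h'
        exact lt_irrefl _ h'.1
    · obtain ⟨e, w₁, w₂, he₁, he₂, hw₁, hw₂⟩ := exists_separating_integer hk2 hσ.symm hp₁ hp₂ hne hs
      rw [← norm_ofPadicInt, ← he₁] at hw₁
      rw [← norm_ofPadicInt, ← he₂] at hw₂
      refine dvd_idealIndex_of_integer I hk2 hσ hsplit hpI ha ha0 (b := e) ?_ ?_ ?_
      · exact (mul_le_of_le_one_left (norm_nonneg _) ha₁).trans_lt hw₂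
      · rwa [hw₁, mul_one]
      · intro h'
        rw [hw₁] at h'
        exact lt_irrefl _ h'.2

end Index

lemma hasSum_fintype_prod {α β E : Type*} [Fintype α] [AddCommMonoid E] [TopologicalSpace E]
    [ContinuousAdd E] {f : α × β → E} {g : α → E} (h : ∀ a, HasSum (fun b => f (a, b)) (g a)) :
    HasSum f (∑ a, g a) := by
  classical
  have h1 : ∀ a ∈ Finset.univ, HasSum (fun z : α × β => if z.1 = a then f z else 0) (g a) := by
    intro a _
    have hinj : Function.Injective (fun b : β => (a, b)) := fun b b' hb => (Prod.mk.inj hb).2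
    rw [← hinj.hasSum_iff]
    · simpa [Function.comp_def] using h a
    · rintro ⟨a', b⟩ hz
      rw [if_neg]
      rintro rfl
      exact hz ⟨b, rfl⟩
  have h2 := hasSum_sum h1
  simpa using h2

lemma sum_range_mul {E : Type*} [AddCommMonoid E] (h : ℕ → E) (p q : ℕ) :
    ∑ n ∈ Finset.range (p * q), h n =
      ∑ n' ∈ Finset.range q, ∑ n₀ ∈ Finset.range p, h (n₀ + p * n') := by
  induction q with
  | zero => simp
  | succ q ih =>
    rw [Nat.mul_succ, Finset.sum_range_add, Finset.sum_range_succ, ih]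
    simp only [add_comm]

/-! ### Decomposition of the cone into translates of the parallelogram. -/

section Cone

variable {k : Type*} [Field k] [NumberField k] {τ₁ τ₂ : k}

lemma exists_coordinates (hk2 : Module.finrank ℚ k = 2) (hτ : LinearIndependent ℚ ![τ₁, τ₂])
    (a : k) : ∃ r s : ℚ, a = r • τ₁ + s • τ₂ := by
  have h := hτ.span_eq_top_of_card_eq_finrank (by simp [hk2])
  have ha : a ∈ Submodule.span ℚ (Set.range ![τ₁, τ₂]) := h ▸ Submodule.mem_top
  rw [Matrix.range_cons, Matrix.range_cons, Matrix.range_empty, Set.union_empty,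
    Set.singleton_union, Submodule.mem_span_pair] at ha
  obtain ⟨r, s, h⟩ := ha
  exact ⟨r, s, h.symm⟩

lemma coordinates_unique (hτ : LinearIndependent ℚ ![τ₁, τ₂]) {r s r' s' : ℚ}
    (h : r • τ₁ + s • τ₂ = r' • τ₁ + s' • τ₂) : r = r' ∧ s = s' := by
  have := LinearIndependent.pair_iff.1 hτ (r - r') (s - s') (by
    rw [sub_smul, sub_smul]
    linear_combination h)
  exact ⟨sub_eq_zero.1 this.1, sub_eq_zero.1 this.2⟩

lemma parallelogram_unique (hτ : LinearIndependent ℚ ![τ₁, τ₂]) {x x' : k}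
    (hx : x ∈ parallelogram τ₁ τ₂) (hx' : x' ∈ parallelogram τ₁ τ₂) {n m : ℤ}
    (h : x = x' + n • τ₁ + m • τ₂) : n = 0 ∧ m = 0 := by
  obtain ⟨r, s, hr0, hr1, hs0, hs1, rfl⟩ := hx
  obtain ⟨r', s', hr0', hr1', hs0', hs1', rfl⟩ := hx'
  have h' : r • τ₁ + s • τ₂ = (r' + n) • τ₁ + (s' + m) • τ₂ := by
    rw [h, add_smul, add_smul, Int.cast_smul_eq_zsmul, Int.cast_smul_eq_zsmul]
    abel
  obtain ⟨h1, h2⟩ := coordinates_unique hτ h'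
  constructor
  · have a1 : (n : ℚ) < 1 := by linarith
    have a2 : (-1 : ℚ) < n := by linarith
    have a1' : n < 1 := by exact_mod_cast a1
    have a2' : -1 < n := by exact_mod_cast a2
    omega
  · have a1 : (m : ℚ) < 1 := by linarith
    have a2 : (-1 : ℚ) < m := by linarith
    have a1' : m < 1 := by exact_mod_cast a1
    have a2' : -1 < m := by exact_mod_cast a2
    omega

lemma exists_parallelogram_add {a : k} (ha : a ∈ cone τ₁ τ₂) :
    ∃ x ∈ parallelogram τ₁ τ₂, ∃ n m : ℕ, a = x + n • τ₁ + m • τ₂ := by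
  obtain ⟨r, s, hr, hs, rfl⟩ := ha
  have hc : 0 < ⌈r⌉₊ := Nat.ceil_pos.2 hr
  have hc' : ((⌈r⌉₊ - 1 : ℕ) : ℚ) = ⌈r⌉₊ - 1 := by
    rw [Nat.cast_sub hc, Nat.cast_one]
  -- The ceiling serves the interval `0 < λ ≤ 1`, the floor the interval `0 ≤ μ < 1`.
  refine ⟨(r - (⌈r⌉₊ - 1 : ℕ)) • τ₁ + (s - ⌊s⌋₊) • τ₂,
    ⟨_, _, ?_, ?_, ?_, ?_, rfl⟩, ⌈r⌉₊ - 1, ⌊s⌋₊, ?_⟩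
  · rw [hc']
    linarith [Nat.ceil_lt_add_one hr.le]
  · rw [hc']
    linarith [Nat.le_ceil r]
  · linarith [Nat.floor_le hs]
  · linarith [Nat.lt_floor_add_one s]
  · rw [sub_smul, sub_smul, Nat.cast_smul_eq_nsmul, Nat.cast_smul_eq_nsmul]
    abel

lemma add_mem_cone {x : k} (hx : x ∈ parallelogram τ₁ τ₂) (n m : ℕ) :
    x + n • τ₁ + m • τ₂ ∈ cone τ₁ τ₂ := by
  obtain ⟨r, s, hr0, hr1, hs0, hs1, rfl⟩ := hx
  refine ⟨r + n, s + m, by positivity, by positivity, ?_⟩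
  rw [add_smul, add_smul, Nat.cast_smul_eq_nsmul, Nat.cast_smul_eq_nsmul]
  abel

end Cone

section FractionalIdeal

open NumberField

variable {k : Type*} [Field k] [NumberField k] {I : (FractionalIdeal (𝓞 k)⁰ k)ˣ}
  {τ₁ τ₂ : ↥(toModule I)}

/-- Points of the parallelogram are incongruent modulo the lattice `ℤτ₁ + ℤτ₂`, which has finite
index in `I`. -/
lemma finite_parallelogram (hk2 : Module.finrank ℚ k = 2)
    (hτ : LinearIndependent ℚ ![(τ₁ : k), (τ₂ : k)]) :
    {a : ↥(toModule I) | (a : k) ∈ parallelogram (τ₁ : k) (τ₂ : k)}.Finite := by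
  have := finite_int_toModule I
  let L : AddSubgroup ↥(toModule I) := AddSubgroup.closure {τ₁, τ₂}
  have hL : ∀ y, y ∈ L ↔ ∃ n m : ℤ, n • τ₁ + m • τ₂ = y := fun y =>
    AddSubgroup.mem_closure_pair
  have hG : AddGroup.FG ↥(toModule I) := Module.Finite.iff_addGroup_fg.1 this
  have hQ : AddGroup.FG (↥(toModule I) ⧸ L) := inferInstance
  have hfin : Finite (↥(toModule I) ⧸ L) := AddCommGroup.finite_of_fg_isAddTorsion
    (G := ↥(toModule I) ⧸ L) (by
      intro y
      obtain ⟨x, rfl⟩ := QuotientAddGroup.mk_surjective y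
      obtain ⟨r, s, hrs⟩ := exists_coordinates hk2 hτ (x : k)
      rw [isOfFinAddOrder_iff_zsmul_eq_zero]
      refine ⟨r.den * s.den, by positivity, ?_⟩
      rw [← QuotientAddGroup.mk_zsmul, QuotientAddGroup.eq_zero_iff, hL]
      refine ⟨r.num * s.den, r.den * s.num, ?_⟩
      apply Subtype.ext
      have e1 : (r.num : k) = r * r.den := by exact_mod_cast (Rat.mul_den_eq_num r).symm
      have e2 : (s.num : k) = s * s.den := by exact_mod_cast (Rat.mul_den_eq_num s).symm
      simp only [Submodule.coe_add, Submodule.coe_smul_of_tower, zsmul_eq_mul, hrs,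
        Rat.smul_def]
      push_cast
      rw [e1, e2]
      ring)
  refine Set.Finite.of_finite_image (f := fun a => (QuotientAddGroup.mk a : ↥(toModule I) ⧸ L))
    (Set.toFinite _) ?_
  intro a ha b hb hab
  rw [QuotientAddGroup.eq, hL] at hab
  obtain ⟨n, m, hnm⟩ := hab
  have hba : (b : k) = a + n • (τ₁ : k) + m • (τ₂ : k) := by
    have := congrArg (fun z : ↥(toModule I) => (z : k)) hnm
    simp only [Submodule.coe_add, Submodule.coe_smul_of_tower, Submodule.coe_neg] at this
    linear_combination -this
  obtain ⟨rfl, rfl⟩ := parallelogram_unique hτ hb ha hba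
  apply Subtype.ext
  simpa using hba.symm

/-- The points of `I ∩ P(τ₁, τ₂)`. -/
noncomputable def parallelogramPoints (hk2 : Module.finrank ℚ k = 2)
    (hτ : LinearIndependent ℚ ![(τ₁ : k), (τ₂ : k)]) : Finset ↥(toModule I) :=
  (finite_parallelogram hk2 hτ).toFinset

lemma mem_parallelogramPoints {hk2 : Module.finrank ℚ k = 2}
    {hτ : LinearIndependent ℚ ![(τ₁ : k), (τ₂ : k)]} {a : ↥(toModule I)} :
    a ∈ parallelogramPoints hk2 hτ ↔ (a : k) ∈ parallelogram (τ₁ : k) (τ₂ : k) :=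
  (finite_parallelogram hk2 hτ).mem_toFinset

/-- The points `x + i τ₁ + l τ₂` which represent the cone modulo translations
by multiples of `p τ₁` and `p τ₂`. -/
def shiftedPoint (τ₁ τ₂ : ↥(toModule I)) (y : ↥(toModule I) × ℕ × ℕ) :
    ↥(toModule I) :=
  y.1 + y.2.1 • τ₁ + y.2.2 • τ₂

/-- The points `a + n p τ₁ + m p τ₂`. -/
def translate (p : ℕ) (τ₁ τ₂ : ↥(toModule I)) (a : ↥(toModule I)) (n m : ℕ) :
    ↥(toModule I) :=
  a + n • (p • τ₁) + m • (p • τ₂)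

variable {p : ℕ}

lemma coe_translate_shiftedPoint (y : ↥(toModule I) × ℕ × ℕ) (n m : ℕ) :
    (translate p τ₁ τ₂ (shiftedPoint τ₁ τ₂ y) n m : k) =
      y.1 + (y.2.1 + p * n) • (τ₁ : k) + (y.2.2 + p * m) • (τ₂ : k) := by
  simp only [translate, shiftedPoint, Submodule.coe_add, Submodule.coe_smul_of_tower,
    nsmul_eq_mul]
  push_cast
  ring

/-- A cone point is uniquely `x + nτ₁ + mτ₂` with `x` in the parallelogram; dividing `n` and `m` by
`p` with remainder separates the representative from the translation. The predicates `Q` and `G` are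
compared only on the cone, which avoids `a = 0`. -/
lemma bijective_translate (hp : 0 < p) (hk2 : Module.finrank ℚ k = 2)
    (hτ : LinearIndependent ℚ ![(τ₁ : k), (τ₂ : k)]) {G : ↥(toModule I) → Prop}
    (hG : ∀ a n m, G (translate p τ₁ τ₂ a n m) ↔ G a) {Q : ↥(toModule I) → Prop}
    (hQ : ∀ a : ↥(toModule I), (a : k) ∈ cone (τ₁ : k) (τ₂ : k) → (Q a ↔ G a)) :
    Function.Bijective (fun z : {y : ↥(toModule I) × ℕ × ℕ //
      y ∈ parallelogramPoints hk2 hτ ×ˢ Finset.range p ×ˢ Finset.range p ∧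
        G (shiftedPoint τ₁ τ₂ y)} × (ℕ × ℕ) =>
      (⟨translate p τ₁ τ₂ (shiftedPoint τ₁ τ₂ z.1.1) z.2.1 z.2.2, by
        have hc : (translate p τ₁ τ₂ (shiftedPoint τ₁ τ₂ z.1.1) z.2.1 z.2.2 : k) ∈
            cone (τ₁ : k) (τ₂ : k) := by
          rw [coe_translate_shiftedPoint]
          exact add_mem_cone (mem_parallelogramPoints.1 (Finset.mem_product.1 z.1.2.1).1) _ _
        exact ⟨hc, (hQ _ hc).2 ((hG _ _ _).2 z.1.2.2)⟩⟩ :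
        {a : ↥(toModule I) // (a : k) ∈ cone (τ₁ : k) (τ₂ : k) ∧ Q a})) := by
  constructor
  · rintro ⟨⟨⟨x, i, l⟩, hy, hGy⟩, n, m⟩ ⟨⟨⟨x', i', l'⟩, hy', hGy'⟩, n', m'⟩ h
    have h' := congrArg (fun z => ((z : ↥(toModule I)) : k)) (congrArg Subtype.val h)
    simp only [coe_translate_shiftedPoint] at h'
    simp only [Finset.mem_product, Finset.mem_range, mem_parallelogramPoints] at hy hy'
    have h2 : (x : k) = x' + ((i' + p * n' : ℤ) - (i + p * n : ℤ)) • (τ₁ : k) +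
        ((l' + p * m' : ℤ) - (l + p * m : ℤ)) • (τ₂ : k) := by
      simp only [zsmul_eq_mul, nsmul_eq_mul] at h' ⊢
      push_cast at h' ⊢
      linear_combination h'
    obtain ⟨h3, h4⟩ := parallelogram_unique hτ hy.1 hy'.1 h2
    rw [h3, h4] at h2
    have hx : x = x' := Subtype.ext (by simpa using h2)
    have h3' : i' + p * n' = i + p * n := by
      have := sub_eq_zero.1 h3
      exact_mod_cast this
    have h4' : l' + p * m' = l + p * m := by
      have := sub_eq_zero.1 h4
      exact_mod_cast this
    have hi : i' = i := by
      have := congrArg (· % p) h3'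
      simpa [Nat.add_mul_mod_self_left, Nat.mod_eq_of_lt hy.2.1, Nat.mod_eq_of_lt hy'.2.1] using this
    have hl : l' = l := by
      have := congrArg (· % p) h4'
      simpa [Nat.add_mul_mod_self_left, Nat.mod_eq_of_lt hy.2.2, Nat.mod_eq_of_lt hy'.2.2] using this
    have hn : n' = n := by
      subst hi
      exact Nat.eq_of_mul_eq_mul_left hp (by omega)
    have hm : m' = m := by
      subst hl
      exact Nat.eq_of_mul_eq_mul_left hp (by omega)
    subst hx hi hl hn hm
    rfl
  · rintro ⟨a, hac, hQa⟩
    obtain ⟨x, hx, n, m, h⟩ := exists_parallelogram_add hac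
    have hxI : x ∈ toModule I := by
      have : x = ((a - n • τ₁ - m • τ₂ : ↥(toModule I)) : k) := by
        simp only [Submodule.coe_sub, Submodule.coe_smul_of_tower, h]
        abel
      rw [this]
      exact Subtype.mem _
    have ha : translate p τ₁ τ₂ (shiftedPoint τ₁ τ₂ (⟨x, hxI⟩, n % p, m % p)) (n / p) (m / p) = a := by
      apply Subtype.ext
      rw [coe_translate_shiftedPoint]
      simp only [Nat.mod_add_div]
      exact h.symm
    refine ⟨⟨⟨(⟨x, hxI⟩, n % p, m % p), ?_, ?_⟩, n / p, m / p⟩, Subtype.ext ha⟩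
    · simp only [Finset.mem_product, Finset.mem_range, mem_parallelogramPoints]
      exact ⟨hx, Nat.mod_lt _ hp, Nat.mod_lt _ hp⟩
    · rw [← hG _ (n / p) (m / p), ha]
      exact (hQ a hac).1 hQa

end FractionalIdeal

/-! ### Continuation of the twisted zeta function. -/

section Continuation

open NumberField

variable {k : Type*} [Field k] [NumberField k]

lemma exists_real_embedding {k : Type*} [Field k] (hkr : IsTotallyReal k) (ι : k →+* Qbar) :
    ∃ ρ : k →+* ℝ, ∀ x, ((ι x : Qbar) : ℂ) = ρ x := by
  have h := IsTotallyReal.complexEmbedding_isReal ((algebraMap Qbar ℂ).comp ι)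
  exact ⟨h.embedding, fun x => (h.coe_embedding_apply x).symm⟩

lemma powNeg_self {y : ℝ × ℝ} (hy : 0 < y.1 ∧ 0 < y.2) (s : ℂ) :
    powNeg s s y = ((y.1 : ℂ) * (y.2 : ℂ)) ^ (-s) := by
  rw [powNeg, Complex.mul_cpow_ofReal_nonneg hy.1.le hy.2.le]

lemma powNeg_neg_natCast (e : ℕ) (y : ℝ × ℝ) :
    powNeg (-(e : ℂ)) (-(e : ℂ)) y = ((y.1 : ℂ) * (y.2 : ℂ)) ^ e := by
  rw [powNeg, neg_neg, Complex.cpow_natCast, Complex.cpow_natCast, mul_pow]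

lemma pos_of_mem_cone {τ₁ τ₂ a : k} (h₁ : TotallyPositive τ₁) (h₂ : TotallyPositive τ₂)
    (ha : a ∈ cone τ₁ τ₂) (ρ : k →+* ℝ) : 0 < ρ a := by
  obtain ⟨r, s, hr, hs, rfl⟩ := ha
  simp only [Rat.smul_def, map_add, map_mul, map_ratCast]
  have hr' : (0 : ℝ) < r := by exact_mod_cast hr
  have hs' : (0 : ℝ) ≤ s := by exact_mod_cast hs
  have := mul_pos hr' (h₁ ρ)
  have := mul_nonneg hs' (h₂ ρ).le
  linarith

variable {I : (FractionalIdeal (𝓞 k)⁰ k)ˣ} {ξ : AddChar ↥(toModule I) Qbar}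
  {τ₁ τ₂ : ↥(toModule I)} {p : ℕ}

lemma map_translate (hup : ∀ x, ξ x ^ p = ξ x) (a : ↥(toModule I)) (n m : ℕ) :
    ξ (translate p τ₁ τ₂ a n m) = ξ a * (ξ τ₁ ^ n * ξ τ₂ ^ m) := by
  rw [translate, AddChar.map_add_eq_mul, AddChar.map_add_eq_mul, AddChar.map_nsmul_eq_pow,
    AddChar.map_nsmul_eq_pow, AddChar.map_nsmul_eq_pow, AddChar.map_nsmul_eq_pow, hup, hup, mul_assoc]

lemma norm_eq_one_of_isOfFinOrder {z : ℂ} (hz : IsOfFinOrder z) : ‖z‖ = 1 := by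
  obtain ⟨n, hn, h⟩ := isOfFinOrder_iff_pow_eq_one.1 hz
  have h1 : ‖z‖ ^ n = 1 := by rw [← norm_pow, h, norm_one]
  exact (pow_eq_one_iff_of_nonneg (norm_nonneg _) hn.ne').1 h1

/-- The value of `z_{T_p}` at `-e` in terms of iterated Abel summation; `Y` represents the points
of the cone modulo translations by multiples of `p τ₁` and `p τ₂`. -/
noncomputable def interpolationValue (p : ℕ) (ι₁ ι₂ : k →+* Qbar)
    (ξ : AddChar ↥(toModule I) Qbar) (τ₁ τ₂ : ↥(toModule I))
    (Y : Finset (↥(toModule I) × ℕ × ℕ)) (e : ℕ) : Qbar :=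
  ∑ y ∈ Y, ξ (shiftedPoint τ₁ τ₂ y) *
    abelSum (2 * e + 8) (ξ τ₁) fun n => abelSum (2 * e + 8) (ξ τ₂) fun m =>
      (ι₁ (translate p τ₁ τ₂ (shiftedPoint τ₁ τ₂ y) n m : k) *
        ι₂ (translate p τ₁ τ₂ (shiftedPoint τ₁ τ₂ y) n m : k)) ^ e

/-- Over each class of points modulo `pτ₁`, `pτ₂` the series is a double series with real positive
directions. The multipliers are still `ξ(τ₁)` and `ξ(τ₂)`, because `ξ^p = ξ`. -/
theorem exists_isContinuation (hk2 : Module.finrank ℚ k = 2) (hkr : IsTotallyReal k)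
    (ι₁ ι₂ : k →+* Qbar) (hp : 0 < p) (hξ : ∀ x, IsOfFinOrder (ξ x))
    (hup : ∀ x, ξ x ^ p = ξ x)
    (hτ : LinearIndependent ℚ ![(τ₁ : k), (τ₂ : k)])
    (hτ₁ : TotallyPositive (τ₁ : k)) (hτ₂ : TotallyPositive (τ₂ : k))
    (hξ₁ : ξ τ₁ ≠ 1) (hξ₂ : ξ τ₂ ≠ 1) {G : ↥(toModule I) → Prop}
    (hG : ∀ a n m, G (translate p τ₁ τ₂ a n m) ↔ G a)
    (hQ : ∀ a : ↥(toModule I), (a : k) ∈ cone (τ₁ : k) (τ₂ : k) →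
      (¬ p ∣ idealIndex I (a : k) ↔ G a))
    (Y : Finset (↥(toModule I) × ℕ × ℕ))
    (hY : ∀ y, y ∈ Y ↔ y ∈ parallelogramPoints hk2 hτ ×ˢ Finset.range p ×ˢ Finset.range p ∧
      G (shiftedPoint τ₁ τ₂ y)) :
    ∃ Z : ℂ → ℂ, IsContinuation p ι₁ ι₂ I ξ τ₁ τ₂ Z ∧
      ∀ e : ℕ, Z (-(e : ℂ)) = (interpolationValue p ι₁ ι₂ ξ τ₁ τ₂ Y e : ℂ) := by
  classical
  obtain ⟨ρ₁, hρ₁⟩ := exists_real_embedding hkr ι₁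
  obtain ⟨ρ₂, hρ₂⟩ := exists_real_embedding hkr ι₂
  have hρ₁' : ∀ x, algebraMap Qbar ℂ (ι₁ x) = ρ₁ x := hρ₁
  have hρ₂' : ∀ x, algebraMap Qbar ℂ (ι₂ x) = ρ₂ x := hρ₂
  let P : k → ℝ × ℝ := fun a => (ρ₁ a, ρ₂ a)
  have hpp : (0 : ℝ) < p := by exact_mod_cast hp
  have hPτ : ∀ τ : ↥(toModule I), TotallyPositive (τ : k) →
      0 < (P ((p • τ : ↥(toModule I)) : k)).1 ∧ 0 < (P ((p • τ : ↥(toModule I)) : k)).2 := by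
    intro τ h
    simp only [P, Submodule.coe_smul_of_tower, nsmul_eq_mul, map_mul, map_natCast]
    exact ⟨mul_pos hpp (h ρ₁), mul_pos hpp (h ρ₂)⟩
  have hPc : ∀ a : ↥(toModule I), (a : k) ∈ cone (τ₁ : k) (τ₂ : k) →
      0 < (P (a : k)).1 ∧ 0 < (P (a : k)).2 := fun a ha =>
    ⟨pos_of_mem_cone hτ₁ hτ₂ ha ρ₁, pos_of_mem_cone hτ₁ hτ₂ ha ρ₂⟩
  have hPt : ∀ (a : ↥(toModule I)) (n m : ℕ), P (translate p τ₁ τ₂ a n m : k) =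
      P a + n • P ((p • τ₁ : ↥(toModule I)) : k) + m • P ((p • τ₂ : ↥(toModule I)) : k) := by
    intro a n m
    simp only [P, translate, Submodule.coe_add, Submodule.coe_smul_of_tower, map_add, map_nsmul,
      Prod.ext_iff, Prod.fst_add, Prod.snd_add, Prod.smul_fst, Prod.smul_snd, and_self]
  have hcone : ∀ y ∈ Y, (shiftedPoint τ₁ τ₂ y : k) ∈ cone (τ₁ : k) (τ₂ : k) := by
    intro y hy
    have := add_mem_cone (mem_parallelogramPoints.1 (Finset.mem_product.1 ((hY y).1 hy).1).1)
      y.2.1 y.2.2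
    simpa only [shiftedPoint, Submodule.coe_add, Submodule.coe_smul_of_tower] using this
  have hnorm : ∀ x, ‖((ξ x : Qbar) : ℂ)‖ = 1 := fun x =>
    norm_eq_one_of_isOfFinOrder (MonoidHom.isOfFinOrder (algebraMap Qbar ℂ : Qbar →* ℂ) (hξ x))
  have hne : ∀ x, ξ x ≠ 1 → ((ξ x : Qbar) : ℂ) ≠ 1 := fun x hx h => hx (by exact_mod_cast h)
  have key : ∀ y : {y // y ∈ parallelogramPoints hk2 hτ ×ˢ Finset.range p ×ˢ Finset.range p ∧
      G (shiftedPoint τ₁ τ₂ y)}, _ := fun y =>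
    exists_shintani_continuation (hPc _ (hcone y.1 ((hY _).2 y.2))) (hPτ τ₁ hτ₁) (hPτ τ₂ hτ₂)
      (hnorm τ₁) (hnorm τ₂) (hne _ hξ₁) (hne _ hξ₂)
  choose Z hZd hZs hZv using key
  have : Fintype {y // y ∈ parallelogramPoints hk2 hτ ×ˢ Finset.range p ×ˢ Finset.range p ∧
      G (shiftedPoint τ₁ τ₂ y)} := Fintype.ofFinset Y hY
  have hdiff : Differentiable ℂ fun s => ∑ y, (ξ (shiftedPoint τ₁ τ₂ y.1) : ℂ) * Z y s := by
    exact Differentiable.fun_sum fun y _ => (hZd y).const_mul _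
  refine ⟨fun s => ∑ y, (ξ (shiftedPoint τ₁ τ₂ y.1) : ℂ) * Z y s, ⟨fun s hs => ?_, ?_, ?_⟩, ?_⟩
  · rw [← (Equiv.ofBijective _ (bijective_translate hp hk2 hτ hG hQ)).hasSum_iff]
    refine hasSum_fintype_prod fun y => ?_
    have h := (hZs y s hs).mul_left (ξ (shiftedPoint τ₁ τ₂ y.1) : ℂ)
    refine (congrArg (fun f => HasSum f _) (funext fun q => ?_)).mpr h
    have hc : (translate p τ₁ τ₂ (shiftedPoint τ₁ τ₂ y.1) q.1 q.2 : k) ∈ cone (τ₁ : k) (τ₂ : k) := by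
      rw [coe_translate_shiftedPoint]
      exact add_mem_cone (mem_parallelogramPoints.1 (Finset.mem_product.1 y.2.1).1) _ _
    rw [← hPt, powNeg_self (hPc _ hc)]
    change (ξ (translate p τ₁ τ₂ (shiftedPoint τ₁ τ₂ y.1) q.1 q.2) : ℂ) / (algebraMap Qbar ℂ
      (ι₁ (translate p τ₁ τ₂ (shiftedPoint τ₁ τ₂ y.1) q.1 q.2 : k) *
        ι₂ (translate p τ₁ τ₂ (shiftedPoint τ₁ τ₂ y.1) q.1 q.2 : k))) ^ s = _
    rw [map_mul, hρ₁', hρ₂', map_translate hup, Complex.cpow_neg, div_eq_mul_inv]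
    push_cast
    ring
  · exact fun s => (hdiff.analyticAt s).meromorphicAt
  · exact fun m _ => hdiff.analyticAt _
  · intro e
    change _ = algebraMap Qbar ℂ (interpolationValue p ι₁ ι₂ ξ τ₁ τ₂ Y e)
    rw [interpolationValue, Finset.sum_subtype (F := this) Y hY]
    simp only [hZv _ e _ le_rfl, map_sum, map_mul, map_abelSum, map_pow, hρ₁', hρ₂', ← hPt,
      powNeg_neg_natCast]
    rfl

end Continuation

/-! ### Values at negative integers as `p`-adic Riemann sums. -/

section Riemann

open NumberField

variable {k : Type*} [Field k] [NumberField k] {I : (FractionalIdeal (𝓞 k)⁰ k)ˣ}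
  {p : ℕ} [hp : Fact p.Prime] {τ₁ τ₂ : ↥(toModule I)}

lemma norm_eq_one_of_pow_eq_self {u : ℂ_[p]} (hu : u ^ p = u) (hu0 : u ≠ 0) : ‖u‖ = 1 := by
  have h : u ^ (p - 1) = 1 := by
    apply mul_right_cancel₀ hu0
    rw [← pow_succ, Nat.sub_add_cancel hp.out.one_lt.le, hu, one_mul]
  have h1 : ‖u‖ ^ (p - 1) = 1 := by rw [← norm_pow, h, norm_one]
  exact (pow_eq_one_iff_of_nonneg (norm_nonneg _)
    (Nat.sub_ne_zero_of_lt hp.out.one_lt)).1 h1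

/-- If `‖1 - u‖ < 1`, all powers of `u` are congruent to `1`, and the vanishing sum `∑_{i < p-1} uⁱ`
would be congruent to the unit `p - 1`. -/
lemma norm_one_sub_eq_one {u : ℂ_[p]} (hu : u ^ p = u) (hu0 : u ≠ 0) (hu1 : u ≠ 1) :
    ‖1 - u‖ = 1 := by
  have hn := norm_eq_one_of_pow_eq_self hu hu0
  have h : u ^ (p - 1) = 1 := by
    apply mul_right_cancel₀ hu0
    rw [← pow_succ, Nat.sub_add_cancel hp.out.one_lt.le, hu, one_mul]
  refine le_antisymm (norm_sub_le_of_le norm_one.le hn.le) (not_lt.1 fun hlt => ?_)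
  have hsum : ∑ i ∈ Finset.range (p - 1), u ^ i = 0 := by
    have := mul_geom_sum u (p - 1)
    rw [h, sub_self] at this
    exact (mul_eq_zero.1 this).resolve_left (sub_ne_zero.2 hu1)
  have hle : ∀ i, ‖1 - u ^ i‖ ≤ ‖1 - u‖ := by
    intro i
    have h2 := mul_neg_geom_sum u i
    rw [← h2, norm_mul]
    refine mul_le_of_le_one_right (norm_nonneg _) ?_
    refine IsUltrametricDist.norm_sum_le_of_forall_le_of_nonneg zero_le_one fun l _ => ?_
    rw [norm_pow, hn, one_pow]
  have hd : ‖((p - 1 : ℕ) : ℂ_[p])‖ ≤ ‖1 - u‖ := by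
    have : ((p - 1 : ℕ) : ℂ_[p]) = ∑ i ∈ Finset.range (p - 1), (1 - u ^ i) := by
      rw [Finset.sum_sub_distrib, hsum]
      simp
    rw [this]
    exact IsUltrametricDist.norm_sum_le_of_forall_le_of_nonneg (norm_nonneg _) fun i _ => hle i
  have hd1 : ‖((p - 1 : ℕ) : ℂ_[p])‖ = 1 := by
    rw [← map_natCast (ofPadicInt p), norm_ofPadicInt, PadicInt.norm_natCast_eq_one_iff,
      hp.out.coprime_iff_not_dvd]
    exact Nat.not_dvd_of_pos_of_lt (Nat.sub_pos_of_lt hp.out.one_lt)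
      (Nat.sub_lt hp.out.pos one_pos)
  rw [hd1] at hd
  exact absurd (hd.trans_lt hlt) (lt_irrefl _)

/-- The Riemann sum of `h` over the points `a + n τ₁ + m τ₂` with `a ∈ S` and `n, m < q`. -/
noncomputable def riemannSum (τ₁ τ₂ : ↥(toModule I)) (S : Finset ↥(toModule I)) (q : ℕ)
    (h : ↥(toModule I) → ℂ_[p]) : ℂ_[p] :=
  ∑ a ∈ S, ∑ n ∈ Finset.range q, ∑ m ∈ Finset.range q, h (a + n • τ₁ + m • τ₂)

lemma norm_riemannSum_sub_le {S : Finset ↥(toModule I)} {q : ℕ} {h h' : ↥(toModule I) → ℂ_[p]}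
    {ε : ℝ} (hε : 0 ≤ ε) (hh : ∀ a, ‖h a - h' a‖ ≤ ε) :
    ‖riemannSum τ₁ τ₂ S q h - riemannSum τ₁ τ₂ S q h'‖ ≤ ε := by
  simp only [riemannSum, ← Finset.sum_sub_distrib]
  refine IsUltrametricDist.norm_sum_le_of_forall_le_of_nonneg hε fun a _ => ?_
  refine IsUltrametricDist.norm_sum_le_of_forall_le_of_nonneg hε fun n _ => ?_
  exact IsUltrametricDist.norm_sum_le_of_forall_le_of_nonneg hε fun m _ => hh _

lemma riemannSum_mul (S : Finset ↥(toModule I)) (q : ℕ) (h : ↥(toModule I) → ℂ_[p]) :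
    riemannSum τ₁ τ₂ S (p * q) h =
      ∑ y ∈ S ×ˢ Finset.range p ×ˢ Finset.range p, ∑ n ∈ Finset.range q, ∑ m ∈ Finset.range q,
        h (translate p τ₁ τ₂ (shiftedPoint τ₁ τ₂ y) n m) := by
  simp only [riemannSum, sum_range_mul, Finset.sum_product]
  refine Finset.sum_congr rfl fun a _ => ?_
  rw [Finset.sum_comm]
  refine Finset.sum_congr rfl fun i _ => ?_
  simp only [Finset.sum_comm (s := Finset.range p) (t := Finset.range q)]
  refine Finset.sum_congr rfl fun n _ => Finset.sum_congr rfl fun m _ =>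
    Finset.sum_congr rfl fun l _ => congrArg h ?_
  simp only [translate, shiftedPoint, add_smul, smul_smul, mul_comm p]
  abel

lemma norm_pow_mul_sub_le {x x' : ℤ_[p] × ℤ_[p]} {r : ℕ} (h₁ : (p : ℤ_[p]) ^ r ∣ x.1 - x'.1)
    (h₂ : (p : ℤ_[p]) ^ r ∣ x.2 - x'.2) (e : ℕ) :
    ‖ofPadicInt p ((x.1 * x.2) ^ e) - ofPadicInt p ((x'.1 * x'.2) ^ e)‖ ≤ (p : ℝ) ^ (-(r : ℤ)) := by
  rw [← map_sub, norm_ofPadicInt, PadicInt.norm_le_pow_iff_mem_span_pow, Ideal.mem_span_singleton]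
  refine dvd_trans ?_ (sub_dvd_pow_sub_pow _ _ e)
  have : x.1 * x.2 - x'.1 * x'.2 = (x.1 - x'.1) * x.2 + x'.1 * (x.2 - x'.2) := by ring
  rw [this]
  exact dvd_add (h₁.mul_right _) (h₂.mul_left _)

variable {χ : AddChar ↥(toModule I) ℂ_[p]} {c : ↥(toModule I) →+ ℤ_[p] × ℤ_[p]}

open Classical in
/-- The function `a ↦ (c₁(a) c₂(a))^e`, restricted to the points at which both
coordinates are units. -/
noncomputable def unitPow (c : ↥(toModule I) →+ ℤ_[p] × ℤ_[p]) (e : ℕ) (a : ↥(toModule I)) :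
    ℂ_[p] :=
  if ‖(c a).1‖ = 1 ∧ ‖(c a).2‖ = 1 then ofPadicInt p (((c a).1 * (c a).2) ^ e) else 0

lemma norm_eq_one_iff_of_dvd_sub {x x' : ℤ_[p]} (h : (p : ℤ_[p]) ∣ x - x') :
    ‖x‖ = 1 ↔ ‖x'‖ = 1 := by
  have h0 := (PadicInt.norm_lt_one_iff_dvd _).2 h
  have key : ∀ y y' : ℤ_[p], ‖y - y'‖ < 1 → ‖y'‖ = 1 → ‖y‖ = 1 := by
    intro y y' hyy h1
    refine le_antisymm (PadicInt.norm_le_one _) (not_lt.1 fun hy => ?_)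
    have := (PadicInt.nonarchimedean (y' - y) y).trans_lt (max_lt (by rwa [norm_sub_rev]) hy)
    rw [sub_add_cancel, h1] at this
    exact lt_irrefl _ this
  exact ⟨key x' x (by rwa [norm_sub_rev]), key x x' h0⟩

lemma map_translate_coordinates (a : ↥(toModule I)) (n m : ℕ) :
    c (translate p τ₁ τ₂ a n m) =
      (((c a).1 + n * (p * (c τ₁).1)) + m * (p * (c τ₂).1),
        ((c a).2 + n * (p * (c τ₁).2)) + m * (p * (c τ₂).2)) := by
  simp only [translate, map_add, map_nsmul, Prod.ext_iff, Prod.fst_add, Prod.snd_add,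
    Prod.smul_fst, Prod.smul_snd]
  simp only [nsmul_eq_mul, and_self]

lemma isUnit_translate_iff (a : ↥(toModule I)) (n m : ℕ) :
    (‖(c (translate p τ₁ τ₂ a n m)).1‖ = 1 ∧ ‖(c (translate p τ₁ τ₂ a n m)).2‖ = 1) ↔
      (‖(c a).1‖ = 1 ∧ ‖(c a).2‖ = 1) := by
  rw [map_translate_coordinates]
  refine and_congr (norm_eq_one_iff_of_dvd_sub ⟨n * (c τ₁).1 + m * (c τ₂).1, by ring⟩)
    (norm_eq_one_iff_of_dvd_sub ⟨n * (c τ₁).2 + m * (c τ₂).2, by ring⟩)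

/-- Splitting `n, m < p · p^r` by residues modulo `p` yields one double sum for each representative.
It vanishes if the coordinates are not both units, and otherwise it is the finite sum approximating
an iterated Abel sum. A shift of an index by `p^r` changes the polynomial summand only by a multiple
of `p^r`. -/
lemma norm_interpolationValue_sub_riemannSum_le {j : Qbar →+* ℂ_[p]} {ι₁ ι₂ : k →+* Qbar}
    {ξ : AddChar ↥(toModule I) Qbar} (hup : ∀ x, ξ x ^ p = ξ x)
    (hξ₁ : ξ τ₁ ≠ 1) (hξ₂ : ξ τ₂ ≠ 1)
    (hc : ∀ a : ↥(toModule I), j (ι₁ a) = ofPadicInt p (c a).1 ∧ j (ι₂ a) = ofPadicInt p (c a).2)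
    (S : Finset ↥(toModule I)) (Y : Finset (↥(toModule I) × ℕ × ℕ))
    (hY : ∀ y, y ∈ Y ↔ y ∈ S ×ˢ Finset.range p ×ˢ Finset.range p ∧
      (‖(c (shiftedPoint τ₁ τ₂ y)).1‖ = 1 ∧ ‖(c (shiftedPoint τ₁ τ₂ y)).2‖ = 1)) (e r : ℕ) :
    ‖(1 - j (ξ τ₁)) * (1 - j (ξ τ₂)) * j (interpolationValue p ι₁ ι₂ ξ τ₁ τ₂ Y e) -
      riemannSum τ₁ τ₂ S (p * p ^ r) (fun a => j (ξ a) * unitPow c e a)‖ ≤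
        (p : ℝ) ^ (-(r : ℤ)) := by
  classical
  have hε : (0 : ℝ) ≤ (p : ℝ) ^ (-(r : ℤ)) := by positivity
  have hξ0 : ∀ x, j (ξ x) ≠ 0 := fun x => by
    rw [map_ne_zero]
    intro h
    have := AddChar.map_add_eq_mul ξ x (-x)
    rw [h, zero_mul, add_neg_cancel, AddChar.map_zero_eq_one] at this
    exact one_ne_zero this
  have hjp : ∀ x, j (ξ x) ^ p = j (ξ x) := fun x => by rw [← map_pow, hup]
  have hj1 : ∀ x, ξ x ≠ 1 → j (ξ x) ≠ 1 := fun x hx h => hx (j.injective (by rw [h, map_one]))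
  have hjq : ∀ x, j (ξ x) ^ p ^ r = j (ξ x) := by
    intro x
    induction r with
    | zero => simp
    | succ r ih => rw [pow_succ, pow_mul, ih, hjp]; positivity
  rw [riemannSum_mul, interpolationValue, map_sum, Finset.mul_sum]
  have hsub : Y ⊆ S ×ˢ Finset.range p ×ˢ Finset.range p := fun y hy => ((hY y).1 hy).1
  rw [← Finset.sum_subset hsub (fun y hy hyY => by
    refine Finset.sum_eq_zero fun n _ => Finset.sum_eq_zero fun m _ => ?_
    rw [unitPow, if_neg, mul_zero]
    rw [isUnit_translate_iff]
    exact fun h => hyY ((hY y).2 ⟨hy, h⟩)), ← Finset.sum_sub_distrib]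
  refine IsUltrametricDist.norm_sum_le_of_forall_le_of_nonneg hε fun y hy => ?_
  have hgood := ((hY y).1 hy).2
  set b := shiftedPoint τ₁ τ₂ y with hb
  let G : ℕ → ℕ → ℂ_[p] := fun n m =>
    ofPadicInt p (((c (translate p τ₁ τ₂ b n m)).1 * (c (translate p τ₁ τ₂ b n m)).2) ^ e)
  have hval : j (ξ b * abelSum (2 * e + 8) (ξ τ₁) fun n => abelSum (2 * e + 8) (ξ τ₂) fun m =>
      (ι₁ (translate p τ₁ τ₂ b n m : k) * ι₂ (translate p τ₁ τ₂ b n m : k)) ^ e) =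
      j (ξ b) * abelSum (2 * e + 8) (j (ξ τ₁)) fun n => abelSum (2 * e + 8) (j (ξ τ₂)) (G n) := by
    simp only [map_mul, map_abelSum, map_pow, (hc _).1, (hc _).2, G]
  have hR : ∑ n ∈ Finset.range (p ^ r), ∑ m ∈ Finset.range (p ^ r),
      j (ξ (translate p τ₁ τ₂ b n m)) * unitPow c e (translate p τ₁ τ₂ b n m) =
      j (ξ b) * ∑ n ∈ Finset.range (p ^ r), ∑ m ∈ Finset.range (p ^ r),
        j (ξ τ₁) ^ n * (j (ξ τ₂) ^ m * G n m) := by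
    simp only [Finset.mul_sum]
    refine Finset.sum_congr rfl fun n _ => Finset.sum_congr rfl fun m _ => ?_
    rw [unitPow, if_pos ((isUnit_translate_iff b n m).2 hgood), map_translate hup]
    simp only [map_mul, map_pow, G]
    ring
  have e1 := norm_abelSum_abelSum_sub_sum_le (2 * e + 8)
    (norm_eq_one_of_pow_eq_self (hjp τ₁) (hξ0 τ₁))
    (norm_one_sub_eq_one (hjp τ₁) (hξ0 τ₁) (hj1 τ₁ hξ₁))
    (norm_eq_one_of_pow_eq_self (hjp τ₂) (hξ0 τ₂))
    (norm_one_sub_eq_one (hjp τ₂) (hξ0 τ₂) (hj1 τ₂ hξ₂)) hε (G := G) (fun m => by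
      have := fwdDiff_iterate_linear_pow_eq_zero (e := e) (K := 2 * e + 8)
        (ofPadicInt p ((c b).1 + m * (p * (c τ₂).1))) (ofPadicInt p ((c b).2 + m * (p * (c τ₂).2)))
        (ofPadicInt p (p * (c τ₁).1)) (ofPadicInt p (p * (c τ₁).2)) (by omega)
      rw [← this]
      congr 1
      funext n
      simp only [G, map_translate_coordinates, map_pow, map_mul, map_add, map_natCast]
      ring) (fun n => by
      have := fwdDiff_iterate_linear_pow_eq_zero (e := e) (K := 2 * e + 8)
        (ofPadicInt p ((c b).1 + n * (p * (c τ₁).1))) (ofPadicInt p ((c b).2 + n * (p * (c τ₁).2)))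
        (ofPadicInt p (p * (c τ₂).1)) (ofPadicInt p (p * (c τ₂).2)) (by omega)
      rw [← this]
      congr 1
      funext m
      simp only [G, map_translate_coordinates, map_pow, map_mul, map_add, map_natCast])
    (hjq τ₁) (hjq τ₂) (fun n m => by
      refine norm_pow_mul_sub_le ?_ ?_ e
      · simp only [map_translate_coordinates]
        exact ⟨p * (c τ₁).1, by push_cast; ring⟩
      · simp only [map_translate_coordinates]
        exact ⟨p * (c τ₁).2, by push_cast; ring⟩) (fun n m => by
      refine norm_pow_mul_sub_le ?_ ?_ e
      · simp only [map_translate_coordinates]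
        exact ⟨p * (c τ₂).1, by push_cast; ring⟩
      · simp only [map_translate_coordinates]
        exact ⟨p * (c τ₂).2, by push_cast; ring⟩)
  rw [hval, hR]
  have e2 : ∀ A B C D : ℂ_[p], A * B * (C * D) = C * (A * B * D) := fun A B C D => by ring
  rw [e2, ← mul_sub, norm_mul, norm_eq_one_of_pow_eq_self (hjp b) (hξ0 b), one_mul]
  exact e1

end Riemann

lemma exists_continuous_extension {α γ ι : Type*} [PseudoMetricSpace α] [MetricSpace γ]
    [CompleteSpace γ] {e : ι → α} (hd : DenseRange e) {f : ι → γ}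
    (hf : ∀ x y, dist (f x) (f y) ≤ dist (e x) (e y)) :
    ∃ g : α → γ, Continuous g ∧ ∀ x, g (e x) = f x := by
  let _ : PseudoMetricSpace ι := PseudoMetricSpace.induced e inferInstance
  have he : IsUniformInducing e := ⟨rfl⟩
  have hL : LipschitzWith 1 f := LipschitzWith.of_dist_le_mul fun x y => by
    rw [NNReal.coe_one, one_mul]
    exact hf x y
  exact ⟨_, (uniformContinuous_uniformly_extend he hd hL.uniformContinuous).continuous,
    fun x => (he.isDenseInducing hd).extend_eq hL.continuous x⟩

/-! ### Density of the interpolation set. -/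

section Interpolation

variable {p : ℕ} [hp : Fact p.Prime]

lemma mem_interpolationSet_iff (hodd : Odd p) {m : ℤ} :
    m ∈ interpolationSet p ↔ m ≤ 0 ∧ ((p : ℤ) - 1) ∣ m - 1 := by
  rw [interpolationSet, Set.mem_ofPred_eq, rootNumber_eq hodd, Int.modEq_comm,
    Int.modEq_iff_dvd, Nat.cast_sub hp.out.one_lt.le, Nat.cast_one]

lemma exists_mem_interpolationSet (hodd : Odd p) (x : ℤ_[p]) (t : ℕ) :
    ∃ m ∈ interpolationSet p, ‖x - (m : ℤ_[p])‖ ≤ (p : ℝ) ^ (-(t : ℤ)) := by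
  set n := x.appr t with hn
  have h3 : 3 ≤ p := by
    have := hp.out.two_le
    rcases hodd with ⟨l, hl⟩
    omega
  have hpt : 1 ≤ (p : ℤ) ^ t := one_le_pow₀ (by exact_mod_cast hp.out.one_lt.le)
  have h3' : (3 : ℤ) ≤ p := by exact_mod_cast h3
  -- As `p^t ≡ 1` modulo `p - 1`, the first two terms give a number congruent to `x` modulo `p^t`
  -- and to `1` modulo `p - 1`. The third term preserves both congruences and makes it non-positive.
  refine ⟨n + p ^ t * (1 - n) - p ^ t * (p - 1) * (n + 1), ?_, ?_⟩
  · rw [mem_interpolationSet_iff hodd]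
    constructor
    · have h0 : (0 : ℤ) ≤ n := Int.natCast_nonneg _
      have h1 : (p : ℤ) ^ t * 2 * (n + 1) ≤ p ^ t * (p - 1) * (n + 1) := by
        gcongr
        linarith
      nlinarith
    · obtain ⟨q, hq⟩ : ((p : ℤ) - 1) ∣ p ^ t - 1 := sub_one_dvd_pow_sub_one _ _
      exact ⟨q * (1 - n) - p ^ t * (n + 1), by linear_combination (1 - (n : ℤ)) * hq⟩
  · have h := PadicInt.appr_spec t x
    rw [PadicInt.norm_le_pow_iff_mem_span_pow]
    have h2 : x - ((n + p ^ t * (1 - n) - p ^ t * (p - 1) * (n + 1) : ℤ) : ℤ_[p]) =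
        (x - n) + p ^ t * ((p - 1) * (n + 1) - (1 - n)) := by
      push_cast
      ring
    rw [h2]
    exact Ideal.add_mem _ h (Ideal.mul_mem_right _ _ (Ideal.mem_span_singleton_self _))

lemma denseRange_interpolationSet (hodd : Odd p) :
    DenseRange fun m : interpolationSet p =>
      (⟨(m.1 : ℤ_[p]), intCast_mem_domain p m.2⟩ : domain p) := by
  rw [Metric.denseRange_iff]
  intro x r hr
  obtain ⟨t, ht⟩ := exists_pow_lt_of_lt_one hr
    (inv_lt_one_of_one_lt₀ (by exact_mod_cast hp.out.one_lt : (1 : ℝ) < p))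
  obtain ⟨m, hm, h⟩ := exists_mem_interpolationSet hodd x.1 t
  refine ⟨⟨m, hm⟩, ?_⟩
  rw [Subtype.dist_eq, dist_eq_norm]
  refine h.trans_lt ?_
  rwa [zpow_neg, zpow_natCast, ← inv_pow]

lemma norm_intCast_sub_le_iff {m m' : ℤ} {t : ℕ} :
    ‖(m : ℤ_[p]) - (m' : ℤ_[p])‖ ≤ (p : ℝ) ^ (-(t : ℤ)) ↔ ((p : ℤ) ^ t) ∣ m - m' := by
  rw [← Int.cast_sub, PadicInt.norm_int_le_pow_iff_dvd]

/-- The moduli `p - 1` and `p^t` are coprime. The case `m' = 1`, which is outside the set, is needed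
for the limit at `1`. -/
lemma dvd_sub_of_mem_interpolationSet (hodd : Odd p) {m m' : ℤ} (hm : m ∈ interpolationSet p)
    (hm' : m' ∈ interpolationSet p ∨ m' = 1) {t : ℕ} (h : ((p : ℤ) ^ t) ∣ m - m') :
    ((p : ℤ) - 1) * p ^ t ∣ m - m' := by
  have h1 : ((p : ℤ) - 1) ∣ m - m' := by
    have a1 := ((mem_interpolationSet_iff hodd).1 hm).2
    rcases hm' with hm' | rfl
    · have a2 := ((mem_interpolationSet_iff hodd).1 hm').2
      have := dvd_sub a1 a2
      rwa [sub_sub_sub_cancel_right] at this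
    · exact a1
  have hc : IsCoprime ((p : ℤ) - 1) (p ^ t) := IsCoprime.pow_right ⟨-1, 1, by ring⟩
  exact hc.mul_dvd h1 h

lemma exists_norm_intCast_sub_eq {m m' : ℤ} (h : m ≠ m') :
    ∃ t : ℕ, ‖(m : ℤ_[p]) - (m' : ℤ_[p])‖ = (p : ℝ) ^ (-(t : ℤ)) := by
  refine ⟨((m : ℤ_[p]) - (m' : ℤ_[p])).valuation, PadicInt.norm_eq_zpow_neg_valuation ?_⟩
  rw [sub_ne_zero]
  exact_mod_cast h

end Interpolation

/-! ### Kummer congruences. -/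

section Estimates

open NumberField

variable {k : Type*} [Field k] [NumberField k] {I : (FractionalIdeal (𝓞 k)⁰ k)ˣ}
  {p : ℕ} [hp : Fact p.Prime] {τ₁ τ₂ : ↥(toModule I)}
  {c : ↥(toModule I) →+ ℤ_[p] × ℤ_[p]}

/-- The function `a ↦ (c₁(a) c₂(a))⁻¹`, restricted to the points at which both
coordinates are units. -/
noncomputable def unitInv (c : ↥(toModule I) →+ ℤ_[p] × ℤ_[p]) (a : ↥(toModule I)) : ℂ_[p] :=
  negInvUnit p (c a).1 * negInvUnit p (c a).2

lemma norm_unitPow_sub_le {e e' t : ℕ} (he : e' ≤ e) (h : (p - 1) * p ^ t ∣ e - e')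
    (a : ↥(toModule I)) : ‖unitPow c e a - unitPow c e' a‖ ≤ (p : ℝ) ^ (-(t : ℤ)) := by
  have hε : (0 : ℝ) ≤ (p : ℝ) ^ (-(t : ℤ)) := by positivity
  rw [unitPow, unitPow]
  split_ifs with hc
  · have h1 : ‖(c a).1 * (c a).2‖ = 1 := by rw [norm_mul, hc.1, hc.2, one_mul]
    have h2 : ((c a).1 * (c a).2) ^ e - ((c a).1 * (c a).2) ^ e' =
        ((c a).1 * (c a).2) ^ e' * (((c a).1 * (c a).2) ^ (e - e') - 1) := by
      rw [mul_sub, ← pow_add, Nat.add_sub_cancel' he, mul_one]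
    rw [← map_sub, norm_ofPadicInt, h2, norm_mul, norm_pow, h1, one_pow, one_mul]
    exact norm_pow_sub_one_le h1 h
  · simp

/-- For the unit `w = c₁c₂` one has `w^e - w⁻¹ = (w^(e+1) - 1) w⁻¹`; the two signs in `negInvUnit`
cancel. -/
lemma norm_unitPow_sub_unitInv_le {e t : ℕ} (h : (p - 1) * p ^ t ∣ e + 1) (a : ↥(toModule I)) :
    ‖unitPow c e a - unitInv c a‖ ≤ (p : ℝ) ^ (-(t : ℤ)) := by
  have hε : (0 : ℝ) ≤ (p : ℝ) ^ (-(t : ℤ)) := by positivity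
  rw [unitPow, unitInv, negInvUnit, negInvUnit]
  by_cases hc : ‖(c a).1‖ = 1 ∧ ‖(c a).2‖ = 1
  · have h1 : ‖(c a).1 * (c a).2‖ = 1 := by rw [norm_mul, hc.1, hc.2, one_mul]
    rw [if_pos hc, if_pos hc.1, if_pos hc.2, neg_mul_neg, ← mul_inv, ← map_mul]
    set w := (c a).1 * (c a).2 with hw
    have h0 : ofPadicInt p w ≠ 0 := by
      rw [← norm_ne_zero_iff, norm_ofPadicInt, h1]
      exact one_ne_zero
    have h2 : ofPadicInt p (w ^ e) - (ofPadicInt p w)⁻¹ =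
        ofPadicInt p (w ^ (e + 1) - 1) * (ofPadicInt p w)⁻¹ := by
      rw [map_sub, map_pow, map_pow, map_one, pow_succ]
      field_simp
    rw [h2, norm_mul, norm_inv, norm_ofPadicInt, norm_ofPadicInt, h1, inv_one, mul_one]
    exact norm_pow_sub_one_le h1 h
  · rw [if_neg hc]
    rw [not_and_or] at hc
    rcases hc with hc | hc
    · simp [hc]
    · simp [hc]

lemma norm_add_le_of_le' {x y : ℂ_[p]} {C : ℝ} (hx : ‖x‖ ≤ C) (hy : ‖y‖ ≤ C) : ‖x + y‖ ≤ C :=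
  (IsUltrametricDist.norm_add_le_max x y).trans (max_le hx hy)

variable {χ : ↥(toModule I) → ℂ_[p]} (hχ : ∀ a, ‖χ a‖ = 1) {S : Finset ↥(toModule I)} {κ : ℂ_[p]}
  {f : ℕ → ℂ_[p]} (hf : ∀ e r : ℕ, ‖κ * f e -
    riemannSum τ₁ τ₂ S (p * p ^ r) (fun a => χ a * unitPow c e a)‖ ≤ (p : ℝ) ^ (-(r : ℤ)))
include hχ

lemma norm_riemannSum_mul_sub_le {q : ℕ} {g g' : ↥(toModule I) → ℂ_[p]} {ε : ℝ} (hε : 0 ≤ ε)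
    (hg : ∀ a, ‖g a - g' a‖ ≤ ε) :
    ‖riemannSum τ₁ τ₂ S q (fun a => χ a * g a) - riemannSum τ₁ τ₂ S q (fun a => χ a * g' a)‖ ≤ ε :=
  norm_riemannSum_sub_le hε fun a => by
    rw [← mul_sub, norm_mul, hχ, one_mul]
    exact hg a

include hf

/-- Both values are compared with their Riemann sums of the same level `t`, whose summands are
already congruent. -/
lemma norm_sub_le_of_dvd (hκ : ‖κ‖ = 1) {e e' t : ℕ} (he : e' ≤ e)
    (h : (p - 1) * p ^ t ∣ e - e') : ‖f e - f e'‖ ≤ (p : ℝ) ^ (-(t : ℤ)) := by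
  have hε : (0 : ℝ) ≤ (p : ℝ) ^ (-(t : ℤ)) := by positivity
  have h1 := norm_riemannSum_mul_sub_le (τ₁ := τ₁) (τ₂ := τ₂) (S := S) (q := p * p ^ t) hχ hε
    (norm_unitPow_sub_le (c := c) he h)
  have h2 := norm_sub_le_of_le (norm_add_le_of_le' (hf e t) h1) (hf e' t)
  have h3 : ‖κ * (f e - f e')‖ ≤ (p : ℝ) ^ (-(t : ℤ)) := by
    refine le_of_eq_of_le (congrArg norm ?_) h2
    ring
  rwa [norm_mul, hκ, one_mul] at h3

lemma norm_sub_riemannSum_unitInv_le {e t : ℕ} (h : (p - 1) * p ^ t ∣ e + 1) (r : ℕ) (hr : t ≤ r) :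
    ‖κ * f e - riemannSum τ₁ τ₂ S (p * p ^ r) (fun a => χ a * unitInv c a)‖ ≤
      (p : ℝ) ^ (-(t : ℤ)) := by
  have hε : (0 : ℝ) ≤ (p : ℝ) ^ (-(t : ℤ)) := by positivity
  have h1 := norm_riemannSum_mul_sub_le (τ₁ := τ₁) (τ₂ := τ₂) (S := S) (q := p * p ^ r) hχ hε
    (norm_unitPow_sub_unitInv_le (c := c) h)
  have hr' : (p : ℝ) ^ (-(r : ℤ)) ≤ (p : ℝ) ^ (-(t : ℤ)) :=
    zpow_le_zpow_right₀ (by exact_mod_cast hp.out.one_lt.le) (by omega)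
  have h2 := norm_add_le_of_le' ((hf e r).trans hr') h1
  refine le_of_eq_of_le (congrArg norm ?_) h2
  ring

end Estimates

/-! ### Truncated Mahler expansions and the coefficients `a_{i,l}`. -/

section Truncation

open NumberField

variable {k : Type*} [Field k] [NumberField k] {I : (FractionalIdeal (𝓞 k)⁰ k)ˣ}
  {p : ℕ} [hp : Fact p.Prime] {τ₁ τ₂ : ↥(toModule I)}
  {c : ↥(toModule I) →+ ℤ_[p] × ℤ_[p]} {j : Qbar →+* ℂ_[p]} {ι₁ ι₂ : k →+* Qbar}
  {ξ : AddChar ↥(toModule I) Qbar}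

/-- The product of binomial coefficients `C(c₁(a) - 1, i) C(c₂(a) - 1, l)`. -/
noncomputable def chooseProd (c : ↥(toModule I) →+ ℤ_[p] × ℤ_[p]) (i l : ℕ) (a : ↥(toModule I)) :
    ℂ_[p] :=
  ofPadicInt p (Ring.choose ((c a).1 - 1) i) * ofPadicInt p (Ring.choose ((c a).2 - 1) l)

lemma norm_unitInv_sub_le {M : ℝ} (hM : 2 * ((p : ℝ) - 1) / Real.log p - 2 ≤ M)
    (a : ↥(toModule I)) :
    ‖unitInv c a - ∑ q ∈ pairsBelow M, mahlerCoeff p q.1 * mahlerCoeff p q.2 *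
      chooseProd c q.1 q.2 a‖ ≤ (p : ℝ) ^ (-errorFn p M) := by
  have h := norm_negInvUnit_mul_sub_le p hM ((c a).1 - 1) ((c a).2 - 1)
  rw [sub_add_cancel, sub_add_cancel] at h
  exact h

lemma riemannSum_sum_mul {ι : Type*} (T : Finset ι) (w : ι → ℂ_[p]) (χ : ↥(toModule I) → ℂ_[p])
    (g : ι → ↥(toModule I) → ℂ_[p]) (S : Finset ↥(toModule I)) (q : ℕ) :
    riemannSum τ₁ τ₂ S q (fun a => χ a * ∑ t ∈ T, w t * g t a) =
      ∑ t ∈ T, w t * riemannSum τ₁ τ₂ S q (fun a => χ a * g t a) := by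
  simp only [riemannSum, Finset.mul_sum]
  rw [Finset.sum_comm (s := T)]
  refine Finset.sum_congr rfl fun a _ => ?_
  rw [Finset.sum_comm (s := T)]
  refine Finset.sum_congr rfl fun n _ => ?_
  rw [Finset.sum_comm (s := T)]
  refine Finset.sum_congr rfl fun m _ => Finset.sum_congr rfl fun t _ => ?_
  ring

/-- The denominator has constant term `(1 - ξ τ₁)(1 - ξ τ₂) ≠ 0`, so the power series inverse is a
true inverse. -/
lemma shintaniSeries_mul (hk2 : Module.finrank ℚ k = 2)
    (hτ : LinearIndependent ℚ ![(τ₁ : k), (τ₂ : k)]) (hξ₁ : ξ τ₁ ≠ 1) (hξ₂ : ξ τ₂ ≠ 1) :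
    shintaniSeries ι₁ ι₂ I ξ τ₁ τ₂ *
      ((1 - MvPowerSeries.C (ξ τ₁) * binomSeries (ι₁ (τ₁ : k), ι₂ (τ₁ : k))) *
        (1 - MvPowerSeries.C (ξ τ₂) * binomSeries (ι₁ (τ₂ : k), ι₂ (τ₂ : k)))) =
      ∑ a ∈ parallelogramPoints hk2 hτ,
        MvPowerSeries.C (ξ a) * binomSeries (ι₁ (a : k), ι₂ (a : k)) := by
  have hcc : ∀ y : Qbar × Qbar, MvPowerSeries.constantCoeff (binomSeries y) = 1 := by
    intro y
    rw [← MvPowerSeries.coeff_zero_eq_constantCoeff_apply, coeff_binomSeries]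
    simp
  rw [shintaniSeries, finsum_mem_eq_finite_toFinset_sum _ (finite_parallelogram hk2 hτ), mul_assoc]
  change _ * (((1 - MvPowerSeries.C (ξ τ₁) * binomSeries (ι₁ (τ₁ : k), ι₂ (τ₁ : k))) *
        (1 - MvPowerSeries.C (ξ τ₂) * binomSeries (ι₁ (τ₂ : k), ι₂ (τ₂ : k))))⁻¹ * _) = _
  rw [MvPowerSeries.inv_mul_cancel, mul_one]
  · rfl
  · simp only [map_mul, map_sub, map_one, hcc, MvPowerSeries.constantCoeff_C, mul_one]
    exact mul_ne_zero (sub_ne_zero.2 hξ₁.symm) (sub_ne_zero.2 hξ₂.symm)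

lemma tendsto_riemannSum_chooseProd (hk2 : Module.finrank ℚ k = 2)
    (hτ : LinearIndependent ℚ ![(τ₁ : k), (τ₂ : k)]) (hξ₁ : ξ τ₁ ≠ 1) (hξ₂ : ξ τ₂ ≠ 1)
    (hup : ∀ x, ξ x ^ p = ξ x)
    (hc : ∀ a : ↥(toModule I), j (ι₁ a) = ofPadicInt p (c a).1 ∧ j (ι₂ a) = ofPadicInt p (c a).2)
    (i l : ℕ) :
    Filter.Tendsto (fun r : ℕ => riemannSum τ₁ τ₂ (parallelogramPoints hk2 hτ) (p ^ r)
      (fun a => j (ξ a) * chooseProd c i l a)) Filter.atTop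
      (nhds ((1 - j (ξ τ₁)) * (1 - j (ξ τ₂)) * coeffA p j ι₁ ι₂ I ξ τ₁ τ₂ i l)) := by
  have hjq : ∀ x, ∀ r, j (ξ x) ^ p ^ r = j (ξ x) := by
    intro x r
    induction r with
    | zero => simp
    | succ r ih => rw [pow_succ, pow_mul, ih, ← map_pow, hup]
  have hb : ∀ a : ↥(toModule I), MvPowerSeries.map j (binomSeries (ι₁ (a : k), ι₂ (a : k))) =
      binomSeries (ofPadicIntProd (c a)) := by
    intro a
    rw [map_binomSeries, (hc a).1, (hc a).2, ofPadicIntProd]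
  have hF := congrArg (MvPowerSeries.map j)
    (shintaniSeries_mul (ι₁ := ι₁) (ι₂ := ι₂) hk2 hτ hξ₁ hξ₂)
  simp only [map_mul, map_sub, map_one, map_sum, MvPowerSeries.map_C, hb] at hF
  have h := tendsto_riemann_choose (parallelogramPoints hk2 hτ) (fun a => j (ξ a)) c (c τ₁) (c τ₂)
    (hjq τ₁) (hjq τ₂) _ hF i l
  refine h.congr fun r => ?_
  refine Finset.sum_congr rfl fun a _ => Finset.sum_congr rfl fun n _ =>
    Finset.sum_congr rfl fun m _ => ?_
  simp only [chooseProd, map_add, map_nsmul, Prod.fst_add, Prod.snd_add, Prod.smul_fst,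
    Prod.smul_snd, AddChar.map_add_eq_mul, AddChar.map_nsmul_eq_pow, map_mul, map_pow]
  simp only [nsmul_eq_mul, mul_assoc]

lemma norm_sum_lt {ι : Type*} (T : Finset ι) {g : ι → ℂ_[p]} {ε : ℝ} (hε : 0 < ε)
    (h : ∀ t ∈ T, ‖g t‖ < ε) : ‖∑ t ∈ T, g t‖ < ε := by
  classical
  induction T using Finset.induction_on with
  | empty => simpa using hε
  | insert t T ht ih =>
    rw [Finset.sum_insert ht]
    exact (IsUltrametricDist.norm_add_le_max _ _).trans_lt
      (max_lt (h t (Finset.mem_insert_self _ _)) (ih fun s hs => h s (Finset.mem_insert_of_mem hs)))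

lemma norm_sub_lt_of_lt {x y z : ℂ_[p]} {ε : ℝ} (hx : ‖x - y‖ < ε) (hy : ‖y - z‖ < ε) :
    ‖x - z‖ < ε := by
  rw [← sub_add_sub_cancel x y z]
  exact (IsUltrametricDist.norm_add_le_max _ _).trans_lt (max_lt hx hy)

end Truncation

/-! ### The order of the character and the `p`-adic coordinates. -/

section Character

open NumberField

variable {k : Type*} [Field k] [NumberField k] {I : (FractionalIdeal (𝓞 k)⁰ k)ˣ}
  {p : ℕ} {ξ : AddChar ↥(toModule I) Qbar}

/-- The integer `f` lies in the annihilator, so `ξ x ^ f = ξ (f x) = 1`. -/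
lemma pow_sub_one_eq_one {f : ℕ}
    (hf : Ideal.comap (algebraMap ℤ (𝓞 k)) (annihilator I ξ) = Ideal.span {(f : ℤ)})
    (hpf : f ∣ p - 1) (x : ↥(toModule I)) : ξ x ^ (p - 1) = 1 := by
  have h1 : (f : ℤ) ∈ Ideal.comap (algebraMap ℤ (𝓞 k)) (annihilator I ξ) := by
    rw [hf]
    exact Ideal.mem_span_singleton_self _
  have h2 : ξ ((algebraMap ℤ (𝓞 k) f) • x) = 1 := h1 x
  have h3 : (algebraMap ℤ (𝓞 k) f) • x = f • x := by
    simp [Nat.cast_smul_eq_nsmul]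
  rw [h3, AddChar.map_nsmul_eq_pow] at h2
  obtain ⟨d, hd⟩ := hpf
  rw [hd, pow_mul, h2, one_pow]

lemma exists_coordinates_padic [hp : Fact p.Prime] {σ₁ σ₂ : k →+* ℂ_[p]}
    (h : ∀ a ∈ toModule I, ∃ y : ℤ_[p] × ℤ_[p], σ₁ a = ofPadicInt p y.1 ∧ σ₂ a = ofPadicInt p y.2) :
    ∃ c : ↥(toModule I) →+ ℤ_[p] × ℤ_[p], ∀ a : ↥(toModule I),
      σ₁ a = ofPadicInt p (c a).1 ∧ σ₂ a = ofPadicInt p (c a).2 := by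
  choose c hc using fun a : ↥(toModule I) => h a.1 a.2
  refine ⟨AddMonoidHom.mk' c fun a b => Prod.ext ?_ ?_, hc⟩
  · apply injective_ofPadicInt
    rw [← (hc _).1, Prod.fst_add, map_add, ← (hc a).1, ← (hc b).1, Submodule.coe_add, map_add]
  · apply injective_ofPadicInt
    rw [← (hc _).2, Prod.snd_add, map_add, ← (hc a).2, ← (hc b).2, Submodule.coe_add, map_add]

end Character

/-! ### The interpolating function and its value at `1`. -/

section Interpolation

open NumberField

variable {p : ℕ} [hp : Fact p.Prime]

lemma dvd_toNat_sub_toNat {m m' : ℤ} (hm : m ≤ m') (hm' : m' ≤ 0) {t : ℕ}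
    (h : ((p : ℤ) - 1) * p ^ t ∣ m - m') :
    (p - 1) * p ^ t ∣ (-m).toNat - (-m').toNat := by
  zify [Int.toNat_le_toNat (neg_le_neg hm), hp.out.one_lt.le]
  rw [Int.toNat_of_nonneg (by omega), Int.toNat_of_nonneg (by omega), ← dvd_neg]
  rwa [show -(-m - -m') = m - m' by ring]

/-- The congruences say that the values are `1`-Lipschitz for the `p`-adic metric on a dense set, so
they extend to `D(p)`. -/
lemma exists_continuous_interpolation (hodd : Odd p) {f : ℕ → ℂ_[p]}
    (hf : ∀ e e' t : ℕ, e' ≤ e → (p - 1) * p ^ t ∣ e - e' → ‖f e - f e'‖ ≤ (p : ℝ) ^ (-(t : ℤ))) :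
    ∃ z : domain p → ℂ_[p], Continuous z ∧ ∀ (m : ℤ) (hm : m ∈ interpolationSet p),
      z ⟨(m : ℤ_[p]), intCast_mem_domain p hm⟩ = f (-m).toNat := by
  have key : ∀ m m' : ℤ, m ∈ interpolationSet p → m' ∈ interpolationSet p → m ≤ m' →
      ‖f (-m).toNat - f (-m').toNat‖ ≤ ‖(m : ℤ_[p]) - (m' : ℤ_[p])‖ := by
    intro m m' hm hm' hle
    rcases eq_or_ne m m' with rfl | hne
    · simp
    obtain ⟨t, ht⟩ := exists_norm_intCast_sub_eq (p := p) hne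
    rw [ht]
    refine hf _ _ t (Int.toNat_le_toNat (neg_le_neg hle)) (dvd_toNat_sub_toNat hle hm'.1 ?_)
    exact dvd_sub_of_mem_interpolationSet hodd hm (Or.inl hm') (norm_intCast_sub_le_iff.1 ht.le)
  obtain ⟨z, hz, hzf⟩ := exists_continuous_extension (denseRange_interpolationSet hodd)
    (f := fun m : interpolationSet p => f (-m.1).toNat) (fun m m' => by
      rw [Subtype.dist_eq, dist_eq_norm, dist_eq_norm]
      rcases le_total m.1 m'.1 with h | h
      · exact key _ _ m.2 m'.2 h
      · rw [norm_sub_rev, norm_sub_rev (m.1 : ℤ_[p])]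
        exact key _ _ m'.2 m.2 h)
  exact ⟨z, hz, fun m hm => hzf ⟨m, hm⟩⟩

lemma exists_near_one (hodd : Odd p) {f : ℕ → ℂ_[p]} {z : domain p → ℂ_[p]} (hz : Continuous z)
    (hzf : ∀ (m : ℤ) (hm : m ∈ interpolationSet p),
      z ⟨(m : ℤ_[p]), intCast_mem_domain p hm⟩ = f (-m).toNat) {ε : ℝ} (hε : 0 < ε) :
    ∃ e t : ℕ, (p - 1) * p ^ t ∣ e + 1 ∧ (p : ℝ) ^ (-(t : ℤ)) < ε ∧
      ‖z ⟨1, one_mem_domain p⟩ - f e‖ < ε := by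
  choose m hm hmt using exists_mem_interpolationSet hodd (1 : ℤ_[p])
  have hp1 : (p : ℝ)⁻¹ < 1 := inv_lt_one_of_one_lt₀ (by exact_mod_cast hp.out.one_lt)
  have hpow : Filter.Tendsto (fun t : ℕ => (p : ℝ) ^ (-(t : ℤ))) Filter.atTop (nhds 0) := by
    simp only [zpow_neg, zpow_natCast, ← inv_pow]
    exact tendsto_pow_atTop_nhds_zero_of_lt_one (by positivity) hp1
  have hlim : Filter.Tendsto
      (fun t => (⟨(m t : ℤ_[p]), intCast_mem_domain p (hm t)⟩ : domain p)) Filter.atTop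
      (nhds ⟨1, one_mem_domain p⟩) := by
    rw [tendsto_iff_dist_tendsto_zero]
    refine squeeze_zero (fun t => dist_nonneg) (fun t => ?_) hpow
    rw [dist_comm, Subtype.dist_eq, dist_eq_norm]
    exact hmt t
  have hzl := (hz.tendsto _).comp hlim
  rw [tendsto_iff_dist_tendsto_zero] at hzl
  obtain ⟨t, h1, h2⟩ := ((hzl.eventually_lt_const hε).and (hpow.eventually_lt_const hε)).exists
  refine ⟨(-m t).toNat, t, ?_, h2, ?_⟩
  · have h3 := dvd_sub_of_mem_interpolationSet hodd (hm t) (Or.inr rfl) (t := t)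
      (norm_intCast_sub_le_iff.1 (by rw [norm_sub_rev, Int.cast_one]; exact hmt t))
    have h0 := (hm t).1
    zify [hp.out.one_lt.le]
    rw [Int.toNat_of_nonneg (by omega), ← dvd_neg]
    rwa [show -(-m t + 1) = m t - 1 by ring]
  · rw [← hzf _ (hm t), ← dist_eq_norm, dist_comm]
    exact h1

variable {k : Type*} [Field k] [NumberField k] {I : (FractionalIdeal (𝓞 k)⁰ k)ˣ}
  {τ₁ τ₂ : ↥(toModule I)} {c : ↥(toModule I) →+ ℤ_[p] × ℤ_[p]}

/-- Up to the unit `κ`, four approximations are chained: `z(1)` by `f e` with `-e` near `1`, `f e`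
by a Riemann sum of `1/(c₁c₂)`, this function by its truncated Mahler expansion, and the resulting
Riemann sums by their limit. The ultrametric inequality prevents errors from accumulating. -/
lemma norm_interpolation_one_sub_lt (hodd : Odd p) {χ : ↥(toModule I) → ℂ_[p]}
    (hχ : ∀ a, ‖χ a‖ = 1) {S : Finset ↥(toModule I)} {κ : ℂ_[p]} (hκ : ‖κ‖ = 1)
    {f : ℕ → ℂ_[p]} (hf : ∀ e r : ℕ, ‖κ * f e -
      riemannSum τ₁ τ₂ S (p * p ^ r) (fun a => χ a * unitPow c e a)‖ ≤ (p : ℝ) ^ (-(r : ℤ)))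
    {z : domain p → ℂ_[p]} (hz : Continuous z)
    (hzf : ∀ (m : ℤ) (hm : m ∈ interpolationSet p),
      z ⟨(m : ℤ_[p]), intCast_mem_domain p hm⟩ = f (-m).toNat) {A : ℕ → ℕ → ℂ_[p]}
    (hA : ∀ i l, Filter.Tendsto (fun r : ℕ => riemannSum τ₁ τ₂ S (p ^ r)
      (fun a => χ a * chooseProd c i l a)) Filter.atTop (nhds (κ * A i l))) {M ε : ℝ}
    (hM : 2 * ((p : ℝ) - 1) / Real.log p - 2 ≤ M) (hMε : (p : ℝ) ^ (-errorFn p M) < ε) :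
    ‖z ⟨1, one_mem_domain p⟩ -
      ∑ q ∈ pairsBelow M, mahlerCoeff p q.1 * mahlerCoeff p q.2 * A q.1 q.2‖ < ε := by
  have hpos : (0 : ℝ) < p := by exact_mod_cast hp.out.pos
  have h0 : (0 : ℝ) ≤ (p : ℝ) ^ (-errorFn p M) := (Real.rpow_pos_of_pos hpos _).le
  have hε : 0 < ε := h0.trans_lt hMε
  obtain ⟨e, t, hdvd, ht, hze⟩ := exists_near_one hodd hz hzf hε
  have hlim : Filter.Tendsto (fun r : ℕ => ∑ q ∈ pairsBelow M,
      mahlerCoeff p q.1 * mahlerCoeff p q.2 * riemannSum τ₁ τ₂ S (p ^ r)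
        (fun a => χ a * chooseProd c q.1 q.2 a)) Filter.atTop
      (nhds (∑ q ∈ pairsBelow M, mahlerCoeff p q.1 * mahlerCoeff p q.2 * (κ * A q.1 q.2))) :=
    tendsto_finsetSum _ fun q _ => (hA q.1 q.2).const_mul _
  -- The index shift matches the level `p · p^r` in `hf`.
  have hlim' := hlim.comp (Filter.tendsto_add_atTop_nat 1)
  rw [tendsto_iff_dist_tendsto_zero] at hlim'
  obtain ⟨r, hr, htr⟩ :=
    ((hlim'.eventually_lt_const hε).and (Filter.eventually_ge_atTop t)).exists
  simp only [Function.comp_apply, pow_succ', ← riemannSum_sum_mul] at hr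
  rw [dist_eq_norm] at hr
  have h1 : ‖κ * z ⟨1, one_mem_domain p⟩ - κ * f e‖ < ε := by
    rw [← mul_sub, norm_mul, hκ, one_mul]
    exact hze
  have h2 := (norm_sub_riemannSum_unitInv_le hχ hf hdvd r htr).trans_lt ht
  have h3 := (norm_riemannSum_mul_sub_le (τ₁ := τ₁) (τ₂ := τ₂) (S := S) (q := p * p ^ r) hχ h0
    (norm_unitInv_sub_le (c := c) hM)).trans_lt hMε
  have h4 := norm_sub_lt_of_lt h1 (norm_sub_lt_of_lt h2 (norm_sub_lt_of_lt h3 hr))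
  have h5 : ∑ q ∈ pairsBelow M, mahlerCoeff p q.1 * mahlerCoeff p q.2 * (κ * A q.1 q.2) =
      κ * ∑ q ∈ pairsBelow M, mahlerCoeff p q.1 * mahlerCoeff p q.2 * A q.1 q.2 := by
    rw [Finset.mul_sum]
    exact Finset.sum_congr rfl fun q _ => by ring
  rwa [h5, ← mul_sub, norm_mul, hκ, one_mul] at h4

lemma inv_sq_mul_finsum_eq (M : ℝ) (a' : ℕ → ℕ → ℤ_[p]) :
    1 / (p : ℂ_[p]) ^ 2 * ∑ᶠ q ∈ {q : ℕ × ℕ | (q.1 : ℝ) + (q.2 : ℝ) < M},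
      TwistedZeta.c p (q.1 + 1) * TwistedZeta.c p (q.2 + 1)
        * algebraMap ℚ_[p] ℂ_[p] (a' q.1 q.2 : ℚ_[p]) / (((q.1 : ℂ_[p]) + 1) * ((q.2 : ℂ_[p]) + 1)) =
      ∑ q ∈ pairsBelow M, mahlerCoeff p q.1 * mahlerCoeff p q.2 * ofPadicInt p (a' q.1 q.2) := by
  have hset : {q : ℕ × ℕ | (q.1 : ℝ) + (q.2 : ℝ) < M} = ↑(pairsBelow M) := by
    ext q
    rw [Finset.mem_coe, mem_pairsBelow]
    rfl
  have hp0 := natCast_ne_zero_padicComplex p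
  rw [hset, finsum_mem_coe_finset, Finset.mul_sum]
  refine Finset.sum_congr rfl fun q _ => ?_
  have h1 : ((q.1 : ℂ_[p]) + 1) ≠ 0 := by exact_mod_cast Nat.succ_ne_zero q.1
  have h2 : ((q.2 : ℂ_[p]) + 1) ≠ 0 := by exact_mod_cast Nat.succ_ne_zero q.2
  change 1 / (p : ℂ_[p]) ^ 2 * (TwistedZeta.c p (q.1 + 1) * TwistedZeta.c p (q.2 + 1)
    * ofPadicInt p (a' q.1 q.2) / (((q.1 : ℂ_[p]) + 1) * ((q.2 : ℂ_[p]) + 1))) = _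
  rw [mahlerCoeff, mahlerCoeff]
  field_simp

/-- The Mahler coefficients are integral, so errors in the `a_{i,l}` are not amplified. -/
lemma norm_sum_mahlerCoeff_sub_lt {M ε : ℝ} (hε : 0 < ε) {A : ℕ → ℕ → ℂ_[p]}
    {a' : ℕ → ℕ → ℤ_[p]}
    (h : ∀ i l : ℕ, (i : ℝ) + (l : ℝ) < M → ‖ofPadicInt p (a' i l) - A i l‖ < ε) :
    ‖∑ q ∈ pairsBelow M, mahlerCoeff p q.1 * mahlerCoeff p q.2 * A q.1 q.2 -
      ∑ q ∈ pairsBelow M, mahlerCoeff p q.1 * mahlerCoeff p q.2 * ofPadicInt p (a' q.1 q.2)‖ < ε := by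
  rw [← Finset.sum_sub_distrib]
  refine norm_sum_lt _ hε fun q hq => ?_
  rw [← mul_sub, norm_mul, norm_mul, norm_sub_rev]
  refine lt_of_le_of_lt ?_ (h q.1 q.2 (mem_pairsBelow.1 hq))
  exact mul_le_of_le_one_left (norm_nonneg _)
    (mul_le_one₀ (norm_mahlerCoeff_le_one p _) (norm_nonneg _) (norm_mahlerCoeff_le_one p _))

end Interpolation

end TwistedZeta

/-! ### The main theorem. -/

theorem mainTheorem3
    {k : Type*} [Field k] [NumberField k]
    -- `k` is a real quadratic field with embeddings `ι₁`, `ι₂`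
    (hk2 : Module.finrank ℚ k = 2) (hkr : NumberField.IsTotallyReal k)
    (ι₁ ι₂ : k →+* TwistedZeta.Qbar) (hι : ι₁ ≠ ι₂)
    -- `ξ` is a character of finite order on the fractional ideal `I`, with annihilator `𝔣`
    (I : (FractionalIdeal (nonZeroDivisors (NumberField.RingOfIntegers k)) k)ˣ)
    (ξ : AddChar ↥(TwistedZeta.toModule I) TwistedZeta.Qbar)
    (hξ : ∀ x, IsOfFinOrder (ξ x))
    (𝔣 : Ideal (NumberField.RingOfIntegers k)) (h𝔣 : 𝔣 = TwistedZeta.annihilator I ξ)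
    -- `𝔣 ∩ ℤ = f ℤ`
    (f : ℕ) (hf : Ideal.comap (algebraMap ℤ (NumberField.RingOfIntegers k)) 𝔣
      = Ideal.span {(f : ℤ)})
    -- `p` is prime to `𝔣`, splits in `k`, is prime to `I`, and `f ∣ p - 1`
    (p : ℕ) [Fact p.Prime]
    (hp𝔣 : IsCoprime (Ideal.span {(p : NumberField.RingOfIntegers k)}) 𝔣)
    (hsplit : ∃ 𝔭₁ 𝔭₂ : Ideal (NumberField.RingOfIntegers k), 𝔭₁.IsPrime ∧ 𝔭₂.IsPrime ∧
      𝔭₁ ≠ 𝔭₂ ∧ Ideal.span {(p : NumberField.RingOfIntegers k)} = 𝔭₁ * 𝔭₂)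
    (hpI : ∀ 𝔭 : IsDedekindDomain.HeightOneSpectrum (NumberField.RingOfIntegers k),
      (p : NumberField.RingOfIntegers k) ∈ 𝔭.asIdeal →
        FractionalIdeal.count k 𝔭
          (I : FractionalIdeal (nonZeroDivisors (NumberField.RingOfIntegers k)) k) = 0)
    (hpf : f ∣ p - 1)
    (j : TwistedZeta.Qbar →+* ℂ_[p])
    -- `τ₁, τ₂` are linearly independent totally positive elements of `I` not in `ker ξ`
    (τ₁ τ₂ : ↥(TwistedZeta.toModule I))
    (hτ : LinearIndependent ℚ ![(τ₁ : k), (τ₂ : k)])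
    (hτ₁ : TwistedZeta.TotallyPositive (τ₁ : k)) (hτ₂ : TwistedZeta.TotallyPositive (τ₂ : k))
    (hξ₁ : ξ τ₁ ≠ 1) (hξ₂ : ξ τ₂ ≠ 1) :
    (∃! z : TwistedZeta.domain p → ℂ_[p],
      TwistedZeta.IsPadicInterpolation p j ι₁ ι₂ I ξ τ₁ τ₂ z) ∧
    ∀ z : TwistedZeta.domain p → ℂ_[p],
      TwistedZeta.IsPadicInterpolation p j ι₁ ι₂ I ξ τ₁ τ₂ z →
      ∀ (N : ℕ) (M : ℝ), 2 * ((p : ℝ) - 1) / Real.log p - 2 ≤ M →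
        (N : ℝ) < TwistedZeta.errorFn p M →
        ∀ a' : ℕ → ℕ → ℤ_[p],
          (∀ i l : ℕ, (i : ℝ) + (l : ℝ) < M →
            ‖algebraMap ℚ_[p] ℂ_[p] (a' i l : ℚ_[p])
              - TwistedZeta.coeffA p j ι₁ ι₂ I ξ τ₁ τ₂ i l‖ < (p : ℝ) ^ (-(N : ℤ))) →
          ‖z ⟨1, TwistedZeta.one_mem_domain p⟩
            - 1 / (p : ℂ_[p]) ^ 2 * ∑ᶠ q ∈ {q : ℕ × ℕ | (q.1 : ℝ) + (q.2 : ℝ) < M},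
                TwistedZeta.c p (q.1 + 1) * TwistedZeta.c p (q.2 + 1)
                  * algebraMap ℚ_[p] ℂ_[p] (a' q.1 q.2 : ℚ_[p])
                  / (((q.1 : ℂ_[p]) + 1) * ((q.2 : ℂ_[p]) + 1))‖ < (p : ℝ) ^ (-(N : ℤ)) := by
  classical
  have hp2 : 1 < p := (Fact.out : p.Prime).one_lt
  have hpos : (0 : ℝ) < p := by exact_mod_cast hp2.le
  subst h𝔣
  have hpow := TwistedZeta.pow_sub_one_eq_one (p := p) hf hpf
  -- For `p = 2` the relation `ξ^(p-1) = 1` would make `ξ` trivial at `τ₁`.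
  have hodd : Odd p := by
    refine (Fact.out : p.Prime).odd_of_ne_two fun h => hξ₁ ?_
    have := hpow τ₁
    rwa [h, pow_one] at this
  have hup : ∀ x, ξ x ^ p = ξ x := fun x => by
    rw [← Nat.sub_add_cancel hp2.le, pow_succ, hpow, one_mul]
  have hσ : j.comp ι₁ ≠ j.comp ι₂ := fun h => hι (RingHom.ext fun x =>
    j.injective (DFunLike.congr_fun h x))
  obtain ⟨c, hc⟩ := TwistedZeta.exists_coordinates_padic fun a ha =>
    TwistedZeta.exists_ofPadicInt_eq_mem I hk2 hσ hsplit hpI ha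
  have hQ : ∀ a : ↥(TwistedZeta.toModule I),
      (a : k) ∈ TwistedZeta.cone (τ₁ : k) (τ₂ : k) →
      (¬ p ∣ TwistedZeta.idealIndex I (a : k) ↔ (‖(c a).1‖ = 1 ∧ ‖(c a).2‖ = 1)) := by
    intro a ha
    obtain ⟨ρ, -⟩ := TwistedZeta.exists_real_embedding hkr ι₁
    have ha0 : (a : k) ≠ 0 := fun h => by
      have := TwistedZeta.pos_of_mem_cone hτ₁ hτ₂ ha ρ
      rw [h, map_zero] at this
      exact lt_irrefl _ this
    rw [TwistedZeta.dvd_idealIndex_iff I hk2 hσ hsplit hpI a.2 ha0, (hc a).1, (hc a).2,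
      TwistedZeta.norm_ofPadicInt, TwistedZeta.norm_ofPadicInt, not_or, not_lt, not_lt]
    exact and_congr ⟨(PadicInt.norm_le_one _).antisymm, ge_of_eq⟩
      ⟨(PadicInt.norm_le_one _).antisymm, ge_of_eq⟩
  obtain ⟨Y, hY⟩ : ∃ Y : Finset (↥(TwistedZeta.toModule I) × ℕ × ℕ), ∀ y, y ∈ Y ↔
      y ∈ TwistedZeta.parallelogramPoints hk2 hτ ×ˢ Finset.range p ×ˢ Finset.range p ∧
        (‖(c (TwistedZeta.shiftedPoint τ₁ τ₂ y)).1‖ = 1 ∧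
          ‖(c (TwistedZeta.shiftedPoint τ₁ τ₂ y)).2‖ = 1) :=
    ⟨_, fun y => Finset.mem_filter⟩
  obtain ⟨Z, hZ, hZv⟩ := TwistedZeta.exists_isContinuation hk2 hkr ι₁ ι₂ (by omega) hξ hup hτ
    hτ₁ hτ₂ hξ₁ hξ₂ (TwistedZeta.isUnit_translate_iff (c := c)) hQ Y hY
  have hj0 : ∀ x, j (ξ x) ≠ 0 := fun x => by
    rw [map_ne_zero]
    intro h
    have := hpow x
    rw [h, zero_pow (by omega)] at this
    exact zero_ne_one this
  have hjp : ∀ x, j (ξ x) ^ p = j (ξ x) := fun x => by rw [← map_pow, hup]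
  have hj1 : ∀ x, ξ x ≠ 1 → j (ξ x) ≠ 1 := fun x hx h => hx (j.injective (by rw [h, map_one]))
  have hχ : ∀ x, ‖j (ξ x)‖ = 1 := fun x =>
    TwistedZeta.norm_eq_one_of_pow_eq_self (hjp x) (hj0 x)
  have hκ : ‖(1 - j (ξ τ₁)) * (1 - j (ξ τ₂))‖ = 1 := by
    rw [norm_mul, TwistedZeta.norm_one_sub_eq_one (hjp _) (hj0 _) (hj1 _ hξ₁),
      TwistedZeta.norm_one_sub_eq_one (hjp _) (hj0 _) (hj1 _ hξ₂), one_mul]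
  have hR := TwistedZeta.norm_interpolationValue_sub_riemannSum_le hup hξ₁ hξ₂ hc
    (TwistedZeta.parallelogramPoints hk2 hτ) Y hY
  obtain ⟨z, hz, hzf⟩ := TwistedZeta.exists_continuous_interpolation hodd
    (f := fun e => j (TwistedZeta.interpolationValue p ι₁ ι₂ ξ τ₁ τ₂ Y e))
    fun e e' t he h => TwistedZeta.norm_sub_le_of_dvd hχ hR hκ he h
  have hvalue : ∀ m ∈ TwistedZeta.interpolationSet p,
      (TwistedZeta.interpolationValue p ι₁ ι₂ ξ τ₁ τ₂ Y (-m).toNat : ℂ) = Z m := by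
    intro m hm
    have h0 : m ≤ 0 := hm.1
    rw [← hZv]
    congr 1
    have : (((-m).toNat : ℤ) : ℂ) = -(m : ℂ) := by
      rw [Int.toNat_of_nonneg (by omega), Int.cast_neg]
    rw [Int.cast_natCast] at this
    rw [this, neg_neg]
  -- Another interpolation may use another complex continuation; the two agree at all `m ≤ 0`, and
  -- density of `𝓜(p)` finishes the argument.
  have huniq : ∀ z' : TwistedZeta.domain p → ℂ_[p],
      TwistedZeta.IsPadicInterpolation p j ι₁ ι₂ I ξ τ₁ τ₂ z' → z' = z := by
    rintro z' ⟨hz', Z', hZ', hv'⟩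
    refine (TwistedZeta.denseRange_interpolationSet hodd).equalizer hz' hz (funext fun m => ?_)
    obtain ⟨v, hv, hzv⟩ := hv' m.1 m.2
    have hZZ : Z' m.1 = Z m.1 :=
      TwistedZeta.eq_of_meromorphic_of_eqOn hZ'.meromorphic hZ.meromorphic
        (fun s hs => (hZ'.hasSum s hs).unique (hZ.hasSum s hs))
        (hZ'.analyticAt m.1 m.2.1) (hZ.analyticAt m.1 m.2.1)
    rw [Function.comp_apply, Function.comp_apply, hzv, hzf m.1 m.2]
    congr 1
    apply Subtype.ext
    rw [hv, hZZ, hvalue m.1 m.2]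
  refine ⟨⟨z, ⟨hz, Z, hZ, fun m hm => ⟨_, hvalue m hm, hzf m hm⟩⟩, huniq⟩, ?_⟩
  intro z' hz' N M hM hN a' ha'
  rw [huniq z' hz', TwistedZeta.inv_sq_mul_finsum_eq]
  have hNε : (p : ℝ) ^ (-TwistedZeta.errorFn p M) < (p : ℝ) ^ (-(N : ℤ)) := by
    rw [← Real.rpow_intCast]
    refine Real.rpow_lt_rpow_of_exponent_lt (by exact_mod_cast hp2) ?_
    push_cast
    linarith
  exact TwistedZeta.norm_sub_lt_of_lt
    (TwistedZeta.norm_interpolation_one_sub_lt hodd hχ hκ hR hz hzf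
      (TwistedZeta.tendsto_riemannSum_chooseProd hk2 hτ hξ₁ hξ₂ hup hc) hM hNε)
    (TwistedZeta.norm_sum_mahlerCoeff_sub_lt (by positivity) ha')
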